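/- A decision tree over $x_1,\dots,x_n$ is a rooted binary tree whose internal nodes are labeled with variables and whose leaves are labeled with bits; on input $x\in\{0,1\}^n$ one follows, from the root, the left or right child according to whether the variable at the node is $0$ or $1$, and outputs the bit at the leaf reached. Its size is its number of leaves, its depth the maximal number of edges from the root to a leaf. Let $\mathbb{DT}_d^s$ be the class of Boolean functions $f:\{0,1\}^n\to\{0,1\}$ computed by a decision tree of depth at most $d$ and size at most $s$. **Theorem.** The class $\mathbb{DT}_d^s$ is exactly properly learnable by a randomized algorithm from $m=O\big(s(2^d\log(s/\delta)+\log n)\big)$ black box queries in time $s^{O(d)}\log(1/\delta)+O(mn)$. That is: there are an absolute constant $c$ and one randomized random-access machine program (unit-cost addition, truncated subtraction, indirect addressing and fair coin flips; a black box query at a point $x\in\{0,1\}^n$ returns $f(x)$ and costs $n$ further steps) such that for all $n\ge 1$, all $d,s$ and all $0<\delta\le 1/2$ there is $m\le c\,s\,(2^d\log_2(s/\delta)+\log_2 n)$ with the following property. For every $f\in\mathbb{DT}_d^s$, the program, given $n$, $d$, $s$, $\lceil 1/\delta\rceil$ and black box access to $f$, always halts after at most $m$ black box queries and at most $s^{cd}\log_2(1/\delta)+c\,m\,n$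 steps, and with probability at least $1-\delta$ over its coin flips it outputs a decision tree of depth at most $d$ and size at most $s$ that computes $f$ exactly. -/

import Mathlib

namespace DTLearn

/-! ### Decision trees over `n` Boolean variables -/

/-- Points of the cube `{0,1}^n`. -/
abbrev Cube (n : ℕ) : Type := Fin n → Bool

/-- Decision trees: leaves carry an output bit, internal nodes carry a variable and have a left
child (followed when the variable is `0`) and a right child (followed when it is `1`). -/
inductive DTree (n : ℕ) : Type where
  | leaf (b : Bool) : DTree n
  | node (i : Fin n) (l r : DTree n) : DTree n

namespace DTree

variable {n : ℕ}

/-- The Boolean function computed by a tree. -/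
def eval : DTree n → Cube n → Bool
  | leaf b, _ => b
  | node i l r, x => if x i then r.eval x else l.eval x

/-- The number of leaves. -/
def size : DTree n → ℕ
  | leaf _ => 1
  | node _ l r => l.size + r.size

/-- The largest number of edges on a path from the root to a leaf. -/
def depth : DTree n → ℕ
  | leaf _ => 0
  | node _ l r => max l.depth r.depth + 1

/-- `T.StoredAt mem a`: the memory `mem` holds the tree `T` as a linked structure with root at
address `a`. A leaf with output `b` is a cell with content `b`; a node labeled with the variable of
index `i` is a cell with content `i + 2`, followed by two cells that hold the addresses of the
left and of the right child. -/
def StoredAt (mem : ℕ → ℕ) : DTree n → ℕ → Prop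
  | leaf b, a => mem a = b.toNat
  | node i l r, a =>
      mem a = (i : ℕ) + 2 ∧ l.StoredAt mem (mem (a + 1)) ∧ r.StoredAt mem (mem (a + 2))

end DTree

/-- The class of Boolean functions of `n` variables that are computed by a decision tree of depth
at most `d` and size at most `s`. -/
def DT (n d s : ℕ) : Set (Cube n → Bool) :=
  {f | ∃ T : DTree n, T.depth ≤ d ∧ T.size ≤ s ∧ T.eval = f}

/-! ### Randomized random-access machines with a black box

Registers and memory cells hold natural numbers. Programs are structured: assignments, indirect
stores, coin flips, black box queries, sequencing, conditionals and loops. The only arithmetic is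
addition and truncated subtraction, at unit cost; a black box query costs `n` further steps. -/

/-- Expressions; `load e` is the content of the memory cell whose address is the value of `e`. -/
inductive Expr : Type where
  | lit (k : ℕ) : Expr
  | reg (x : ℕ) : Expr
  | add (e₁ e₂ : Expr) : Expr
  | sub (e₁ e₂ : Expr) : Expr
  | load (e : Expr) : Expr

/-- The state of a machine: registers, memory, and the numbers of coins flipped, of black box
queries asked and of steps made so far. -/
structure State : Type where
  reg : ℕ → ℕ
  mem : ℕ → ℕ
  flips : ℕ
  queries : ℕ
  time : ℕ

namespace Expr

/-- The value of an expression (`sub` is truncated). -/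
def eval (σ : State) : Expr → ℕ
  | lit k => k
  | reg x => σ.reg x
  | add e₁ e₂ => e₁.eval σ + e₂.eval σ
  | sub e₁ e₂ => e₁.eval σ - e₂.eval σ
  | load e => σ.mem (e.eval σ)

/-- The number of steps needed to evaluate an expression: one for each of its operations and
operands. -/
def cost : Expr → ℕ
  | lit _ => 1
  | reg _ => 1
  | add e₁ e₂ => e₁.cost + e₂.cost + 1
  | sub e₁ e₂ => e₁.cost + e₂.cost + 1
  | load e => e.cost + 1

end Expr

/-- Programs. -/
inductive Prog : Type where
  | skip : Prog
  | set (x : ℕ) (e : Expr) : Prog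
  | store (a e : Expr) : Prog
  | flip (x : ℕ) : Prog
  | query (x : ℕ) (a : Expr) : Prog
  | seq (p q : Prog) : Prog
  | cond (e : Expr) (p q : Prog) : Prog
  | loop (e : Expr) (p : Prog) : Prog

namespace State

/-- Let `k` steps pass. -/
def tick (σ : State) (k : ℕ) : State := { σ with time := σ.time + k }

/-- Assign the value `v` to register `x`. -/
def setReg (σ : State) (x v : ℕ) : State := { σ with reg := Function.update σ.reg x v }

/-- Write the value `v` to the memory cell with address `a`. -/
def setMem (σ : State) (a v : ℕ) : State := { σ with mem := Function.update σ.mem a v }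

/-- The point of `{0,1}^n` written in the `n` memory cells from address `a` on (a nonzero content
is read as `1`). -/
def point (σ : State) (n a : ℕ) : Cube n := fun i => decide (σ.mem (a + i) ≠ 0)

/-- The initial state on input `(n, d, s, N)`: the input is in registers `0, 1, 2, 3`, and all
other registers and all memory cells are `0`. -/
def init (n d s N : ℕ) : State where
  reg := fun x => if x = 0 then n else if x = 1 then d else if x = 2 then s else
    if x = 3 then N else 0
  mem := fun _ => 0
  flips := 0
  queries := 0
  time := 0

end State

/-- `Exec f ω p σ σ'`: the program `p`, started in the state `σ` with black box `f` and with the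
sequence of coins `ω`, halts in the state `σ'`. -/
inductive Exec {n : ℕ} (f : Cube n → Bool) (ω : ℕ → Bool) : Prog → State → State → Prop where
  | skip (σ : State) : Exec f ω Prog.skip σ (σ.tick 1)
  | set (σ : State) (x : ℕ) (e : Expr) :
      Exec f ω (Prog.set x e) σ ((σ.setReg x (e.eval σ)).tick (e.cost + 1))
  | store (σ : State) (a e : Expr) :
      Exec f ω (Prog.store a e) σ
        ((σ.setMem (a.eval σ) (e.eval σ)).tick (a.cost + e.cost + 1))
  | flip (σ : State) (x : ℕ) :
      Exec f ω (Prog.flip x) σ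
        { (σ.setReg x (ω σ.flips).toNat).tick 1 with flips := σ.flips + 1 }
  | query (σ : State) (x : ℕ) (a : Expr) :
      Exec f ω (Prog.query x a) σ
        { (σ.setReg x (f (σ.point n (a.eval σ))).toNat).tick (a.cost + n + 1) with
          queries := σ.queries + 1 }
  | seq {σ σ' σ'' : State} {p q : Prog} (hp : Exec f ω p σ σ') (hq : Exec f ω q σ' σ'') :
      Exec f ω (Prog.seq p q) σ σ''
  | cond_true {σ σ' : State} {e : Expr} {p q : Prog} (he : e.eval σ ≠ 0)
      (hp : Exec f ω p (σ.tick (e.cost + 1)) σ') : Exec f ω (Prog.cond e p q) σ σ'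
  | cond_false {σ σ' : State} {e : Expr} {p q : Prog} (he : e.eval σ = 0)
      (hq : Exec f ω q (σ.tick (e.cost + 1)) σ') : Exec f ω (Prog.cond e p q) σ σ'
  | loop_true {σ σ' σ'' : State} {e : Expr} {p : Prog} (he : e.eval σ ≠ 0)
      (hp : Exec f ω p (σ.tick (e.cost + 1)) σ') (hl : Exec f ω (Prog.loop e p) σ' σ'') :
      Exec f ω (Prog.loop e p) σ σ''
  | loop_false {σ : State} {e : Expr} {p : Prog} (he : e.eval σ = 0) :
      Exec f ω (Prog.loop e p) σ (σ.tick (e.cost + 1))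

/-- Executions are deterministic once the coins are fixed. -/
theorem Exec.unique {n : ℕ} {f : Cube n → Bool} {ω : ℕ → Bool} {p : Prog} {σ σ₁ σ₂ : State}
    (h₁ : Exec f ω p σ σ₁) (h₂ : Exec f ω p σ σ₂) : σ₁ = σ₂ := by
  induction h₁ generalizing σ₂ with
  | skip | set | store | flip | query => cases h₂; rfl
  | seq _ _ ihp ihq =>
    cases h₂ with
    | seq hp hq => obtain rfl := ihp hp; exact ihq hq
  | cond_true he _ ih =>
    cases h₂ with
    | cond_true _ h => exact ih h
    | cond_false he' _ => exact absurd he' he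
  | cond_false he _ ih =>
    cases h₂ with
    | cond_true he' _ => exact absurd he he'
    | cond_false _ h => exact ih h
  | loop_true he _ _ ihp ihl =>
    cases h₂ with
    | loop_true _ hp hl => obtain rfl := ihp hp; exact ihl hl
    | loop_false he' => exact absurd he' he
  | loop_false he =>
    cases h₂ with
    | loop_true he' _ _ => exact absurd he he'
    | loop_false _ => rfl

/-- The law of an infinite sequence of independent fair coins. -/
noncomputable def coins : MeasureTheory.Measure (ℕ → Bool) :=
  MeasureTheory.Measure.infinitePi fun _ => (PMF.uniformOfFintype Bool).toMeasure

/-- In the state `σ`, register `0` holds the address of a decision tree of depth at most `d` and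
size at most `s` that computes exactly the function `f`. -/
def OutputsTree {n : ℕ} (d s : ℕ) (f : Cube n → Bool) (σ : State) : Prop :=
  ∃ T : DTree n, T.depth ≤ d ∧ T.size ≤ s ∧ T.StoredAt σ.mem (σ.reg 0) ∧ T.eval = f

/-- The program `p`, given `n`, `d`, `s` and `⌈1/δ⌉`, exactly properly learns `DT n d s` from at
most `m` black box queries in time at most `t`: for every target `f` in the class, every run halts
after at most `m` queries and at most `t` steps, and with probability at least `1 - δ` over the
coins the output is a decision tree of depth at most `d` and size at most `s` that computes `f`. -/
def ExactlyProperlyLearns (p : Prog) (n d s : ℕ) (δ m t : ℝ) : Prop :=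
  ∀ f ∈ DT n d s,
    (∀ ω : ℕ → Bool, ∃ σ : State, Exec f ω p (State.init n d s ⌈1 / δ⌉₊) σ ∧
      (σ.queries : ℝ) ≤ m ∧ (σ.time : ℝ) ≤ t) ∧
    1 - δ ≤ coins.real {ω | ∃ σ : State, Exec f ω p (State.init n d s ⌈1 / δ⌉₊) σ ∧
      OutputsTree d s f σ}

end DTLearn

/-! The learner draws $M = 2^{d+1}(2s(k+1)+l+1)$ uniform samples, where $k$ and $l$ are the binary
lengths of $s$ and $\lceil 1/\delta\rceil$. Everything rests on one distance bound: a tree of depth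
at most $d$ computes a polynomial of degree at most $d$ over the field with two elements, so two
such trees with different functions differ on at least a $2^{-d}$ fraction of the cube
(`HasDegree.two_pow_le`, `DTree.two_pow_le_card_ne`). It is used twice.

Finding the variables. Let $R$ be the set of relevant variables known so far. Setting the variables
outside $R$ to $0$ turns $f$ into a function that again has a tree of depth at most $d$. As long as
it is not $f$, a sample tells the two apart with probability at least $2^{-d}$, and a binary search
along hybrid points then yields a new relevant variable for $\lceil\log_2 n\rceil$ queries. A tree
with at most $s$ leaves has fewer than $s$ variables, so this happens fewer than $s$ times;
`card_misses_le` bounds the number of sample sequences that leave $R$ incomplete.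

Finding the tree. The learner outputs a smallest tree over $R$ of depth at most $d$ that is
consistent with all samples. The variables in $R$ occur in every tree for $f$, so at most
$(s+2)^{2s}$ outputs of size at most $s$ are possible, independently of $n$, and a union bound
excludes the wrong ones (`card_fools_le`). Both kinds of bad sequences number at most
$2^{2s(k+1)}(1-2^{-(d+1)})^M$ times $2^{nM}$, which gives failure probability at most
$2^{-l}\le\delta$ (`coins_bad_le`).

The search unrolls the recursion "either a leaf, or a variable of $R$ and two subtrees" into a
complete tree with $2|R|$ children per node and depth $d$, which has at most $(2|R|+1)^d$ nodes.
Samples are distributed from the root down and best sizes are computed from the bottom up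
(`Solved.sound`, `Solved.optimal`).

Memory layout: cells below $n$ hold the hybrid point to be queried, the next $n$ the flags of $R$,
the next $n$ the list of $R$; then come the samples, each with its label, and from `sampleAddr n M`
on the records of the search nodes, numbered level by level. -/

namespace DTLearn

/-! ### Symbolic execution -/

/-- The program `p` started in `σ` halts in a state that satisfies `Q`. -/
def Run {n : ℕ} (f : Cube n → Bool) (ω : ℕ → Bool) (p : Prog) (σ : State) (Q : State → Prop) :
    Prop :=
  ∃ σ', Exec f ω p σ σ' ∧ Q σ'

infixr:60 " ;; " => Prog.seq

section Run

variable {n : ℕ} {f : Cube n → Bool} {ω : ℕ → Bool} {σ : State} {Q Q' : State → Prop}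

theorem Run.mono {p : Prog} (h : Run f ω p σ Q) (hQ : ∀ τ, Q τ → Q' τ) : Run f ω p σ Q' := by
  obtain ⟨τ, h1, h2⟩ := h
  exact ⟨τ, h1, hQ τ h2⟩

/-- The rules are equivalences, so that rewriting with them turns a loop-free program into its
weakest precondition. -/
theorem run_seq {p q : Prog} :
    Run f ω (p ;; q) σ Q ↔ Run f ω p σ (fun τ => Run f ω q τ Q) := by
  constructor
  · rintro ⟨τ, h, hQ⟩
    cases h with
    | seq hp hq => exact ⟨_, hp, _, hq, hQ⟩
  · rintro ⟨τ, hp, τ', hq, hQ⟩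
    exact ⟨_, .seq hp hq, hQ⟩

theorem run_skip : Run f ω .skip σ Q ↔ Q (σ.tick 1) := by
  constructor
  · rintro ⟨τ, h, hQ⟩
    cases h
    exact hQ
  · exact fun h => ⟨_, .skip σ, h⟩

theorem run_set {x : ℕ} {e : Expr} :
    Run f ω (.set x e) σ Q ↔ Q ((σ.setReg x (e.eval σ)).tick (e.cost + 1)) := by
  constructor
  · rintro ⟨τ, h, hQ⟩
    cases h
    exact hQ
  · exact fun h => ⟨_, .set σ x e, h⟩

theorem run_store {a e : Expr} :
    Run f ω (.store a e) σ Q ↔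
      Q ((σ.setMem (a.eval σ) (e.eval σ)).tick (a.cost + e.cost + 1)) := by
  constructor
  · rintro ⟨τ, h, hQ⟩
    cases h
    exact hQ
  · exact fun h => ⟨_, .store σ a e, h⟩

theorem run_flip {x : ℕ} :
    Run f ω (.flip x) σ Q ↔
      Q { (σ.setReg x (ω σ.flips).toNat).tick 1 with flips := σ.flips + 1 } := by
  constructor
  · rintro ⟨τ, h, hQ⟩
    cases h
    exact hQ
  · exact fun h => ⟨_, .flip σ x, h⟩

theorem run_query {x : ℕ} {a : Expr} :
    Run f ω (.query x a) σ Q ↔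
      Q { (σ.setReg x (f (σ.point n (a.eval σ))).toNat).tick (a.cost + n + 1) with
          queries := σ.queries + 1 } := by
  constructor
  · rintro ⟨τ, h, hQ⟩
    cases h
    exact hQ
  · exact fun h => ⟨_, .query σ x a, h⟩

theorem run_cond {e : Expr} {p q : Prog} :
    Run f ω (.cond e p q) σ Q ↔
      (e.eval σ ≠ 0 → Run f ω p (σ.tick (e.cost + 1)) Q) ∧
      (e.eval σ = 0 → Run f ω q (σ.tick (e.cost + 1)) Q) := by
  constructor
  · rintro ⟨τ, h, hQ⟩
    cases h with
    | cond_true he hp => exact ⟨fun _ => ⟨_, hp, hQ⟩, fun h => absurd h he⟩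
    | cond_false he hp => exact ⟨fun h => absurd he h, fun _ => ⟨_, hp, hQ⟩⟩
  · rintro ⟨h1, h2⟩
    by_cases he : e.eval σ = 0
    · obtain ⟨τ, h, hQ⟩ := h2 he
      exact ⟨τ, .cond_false he h, hQ⟩
    · obtain ⟨τ, h, hQ⟩ := h1 he
      exact ⟨τ, .cond_true he h, hQ⟩

/-- The invariant rule: `I k` holds after `k` rounds, and there are at most `N` rounds. -/
theorem run_loop {e : Expr} {p : Prog} (I : ℕ → State → Prop) (N : ℕ) (h0 : I 0 σ)
    (step : ∀ k τ, I k τ → e.eval τ ≠ 0 → k < N ∧ Run f ω p (τ.tick (e.cost + 1)) (I (k + 1)))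
    (done : ∀ k τ, I k τ → e.eval τ = 0 → Q (τ.tick (e.cost + 1))) :
    Run f ω (.loop e p) σ Q := by
  -- `j` bounds the number of rounds left; at `j = 0` the guard must vanish, since `step` would give
  -- `k < N`.
  have key : ∀ j k τ, N ≤ k + j → I k τ → Run f ω (.loop e p) τ Q := by
    intro j
    induction j with
    | zero =>
      intro k τ hk hI
      by_cases he : e.eval τ = 0
      · exact ⟨_, .loop_false he, done k τ hI he⟩
      · have := (step k τ hI he).1
        omega
    | succ j ih =>
      intro k τ hk hI
      by_cases he : e.eval τ = 0
      · exact ⟨_, .loop_false he, done k τ hI he⟩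
      · obtain ⟨-, τ₁, h1, hI1⟩ := step k τ hI he
        obtain ⟨τ₂, h2, hQ⟩ := ih (k + 1) τ₁ (by omega) hI1
        exact ⟨τ₂, .loop_true he h1 h2, hQ⟩
  exact key N 0 σ (by omega) h0

end Run

/-! ### Effect of the elementary operations on the state -/

namespace State

variable (σ : State) (x v k y a : ℕ)

@[simp] theorem tick_reg : (σ.tick k).reg = σ.reg := rfl
@[simp] theorem tick_mem : (σ.tick k).mem = σ.mem := rfl
@[simp] theorem tick_flips : (σ.tick k).flips = σ.flips := rfl
@[simp] theorem tick_queries : (σ.tick k).queries = σ.queries := rfl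
@[simp] theorem tick_time : (σ.tick k).time = σ.time + k := rfl
@[simp] theorem setReg_reg : (σ.setReg x v).reg y = if y = x then v else σ.reg y := by
  simp [setReg, Function.update_apply]
@[simp] theorem setReg_mem : (σ.setReg x v).mem = σ.mem := rfl
@[simp] theorem setReg_flips : (σ.setReg x v).flips = σ.flips := rfl
@[simp] theorem setReg_queries : (σ.setReg x v).queries = σ.queries := rfl
@[simp] theorem setReg_time : (σ.setReg x v).time = σ.time := rfl
@[simp] theorem setMem_reg : (σ.setMem a v).reg = σ.reg := rfl
@[simp] theorem setMem_mem : (σ.setMem a v).mem y = if y = a then v else σ.mem y := by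
  simp [setMem, Function.update_apply]
@[simp] theorem setMem_flips : (σ.setMem a v).flips = σ.flips := rfl
@[simp] theorem setMem_queries : (σ.setMem a v).queries = σ.queries := rfl
@[simp] theorem setMem_time : (σ.setMem a v).time = σ.time := rfl

end State

end DTLearn

namespace DTLearn

open DTLearn.Expr DTLearn.Prog

/-! ### Computing the number of samples -/

/-- Register `y` becomes the length in binary of register `x`. -/
def binLength (x y : ℕ) : Prog :=
  .set 8 (lit 1) ;; .set y (lit 0) ;;
  -- Register 8 runs through the powers $2^k$; the guard is nonzero exactly while $2^k \le x$. The
  -- last doubling thus starts from a power that is at most $x$, whence $x < 2^k \le 2x$ at the end.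
  .loop (sub (add (reg x) (lit 1)) (reg 8)) (.set 8 (add (reg 8) (reg 8)) ;;
    .set y (add (reg y) (lit 1)))

/-- Register `4` becomes the number `2 ^ (d + 1) * (2 * s * (k + 1) + l + 1)` of samples, where `k`
and `l` are the binary lengths of `s` and of `⌈1/δ⌉`; register `5` becomes the address of the first
sample. -/
def setup : Prog :=
  binLength 2 9 ;; binLength 3 10 ;;
  .set 4 (add (reg 10) (lit 1)) ;; .set 8 (add (reg 2) (reg 2)) ;;
  .loop (reg 8) (.set 4 (add (reg 4) (add (reg 9) (lit 1))) ;; .set 8 (sub (reg 8) (lit 1))) ;;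
  .set 8 (add (reg 1) (lit 1)) ;;
  .loop (reg 8) (.set 4 (add (reg 4) (reg 4)) ;; .set 8 (sub (reg 8) (lit 1))) ;;
  .set 5 (add (reg 0) (add (reg 0) (reg 0)))

variable {n : ℕ} {f : Cube n → Bool} {ω : ℕ → Bool}

theorem run_binLength {x y : ℕ} (hx : x ≠ 8) (hy : y ≠ 8) (hxy : x ≠ y) (σ : State)
    (hσ : 0 < σ.reg x) :
    Run f ω (binLength x y) σ fun τ =>
      (∃ k, τ.reg y = k ∧ σ.reg x < 2 ^ k ∧ 2 ^ k ≤ 2 * σ.reg x ∧ τ.time ≤ σ.time + 14 * k + 10) ∧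
      (∀ z, z ≠ 8 → z ≠ y → τ.reg z = σ.reg z) ∧ τ.mem = σ.mem ∧ τ.flips = σ.flips ∧
      τ.queries = σ.queries := by
  unfold binLength
  simp only [run_seq, run_set]
  refine run_loop (fun k τ => τ.reg 8 = 2 ^ k ∧ τ.reg y = k ∧ 2 ^ k ≤ 2 * σ.reg x ∧
    τ.time ≤ σ.time + 14 * k + 4 ∧
    (∀ z, z ≠ 8 → z ≠ y → τ.reg z = σ.reg z) ∧ τ.mem = σ.mem ∧ τ.flips = σ.flips ∧
      τ.queries = σ.queries) (σ.reg x) ?_ ?_ ?_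
  · simp [Expr.eval, Expr.cost, hy.symm]
    exact ⟨by omega, fun z h1 h2 => by simp [h1, h2]⟩
  · rintro k τ ⟨h8, hyk, hk, ht, hz, hm, hf, hq⟩ he
    have hx' := hz x hx hxy
    simp only [Expr.eval, h8, hx'] at he
    have h2 : k < 2 ^ k := Nat.lt_two_pow_self
    refine ⟨by omega, ?_⟩
    simp only [run_seq, run_set]
    simp [Expr.eval, Expr.cost, hy.symm, hy, h8, hyk, hm, hf, hq]
    refine ⟨by ring, by rw [pow_succ]; omega, by omega, ?_⟩
    intro z h1 h2
    simp [h1, h2, hz]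
  · rintro k τ ⟨h8, hyk, hk, ht, hz, hm, hf, hq⟩ he
    have hx' := hz x hx hxy
    simp only [Expr.eval, h8, hx'] at he
    simp [Expr.cost]
    exact ⟨by rw [hyk]; exact ⟨by omega, hk, by omega⟩, hz, hm, hf, hq⟩

/-- The loops take $O(k + l + s + d)$ steps, and each of these four numbers is at most the number of
samples. Bounding the time by a multiple of register `4` lets the sampling phase absorb it. -/
theorem run_setup {d s N : ℕ} (hs : 0 < s) (hN : 0 < N) :
    Run f ω setup (State.init n d s N) fun τ =>
      (∃ k l, s < 2 ^ k ∧ 2 ^ k ≤ 2 * s ∧ N < 2 ^ l ∧ 2 ^ l ≤ 2 * N ∧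
        τ.reg 4 = 2 ^ (d + 1) * (2 * s * (k + 1) + l + 1)) ∧
      τ.reg 0 = n ∧ τ.reg 1 = d ∧ τ.reg 2 = s ∧ τ.reg 5 = 3 * n ∧ τ.reg 6 = 0 ∧
      τ.mem = (fun _ => 0) ∧ τ.flips = 0 ∧ τ.queries = 0 ∧ τ.time ≤ 80 * τ.reg 4 := by
  unfold setup
  rw [run_seq]
  refine (run_binLength (by decide) (by decide) (by decide) _ (by simpa [State.init])).mono ?_
  rintro τ ⟨⟨k, hk, hk1, hk2, ht⟩, hz, hm, hf, hq⟩
  rw [run_seq]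
  refine (run_binLength (by decide) (by decide) (by decide) _
    (by rw [hz 3 (by decide) (by decide)]; simpa [State.init])).mono ?_
  rintro τ₁ ⟨⟨l, hl, hl1, hl2, ht1⟩, hz1, hm1, hf1, hq1⟩
  have h9 := hz1 9 (by decide) (by decide)
  have r0 := (hz1 0 (by decide) (by decide)).trans (hz 0 (by decide) (by decide))
  have r1 := (hz1 1 (by decide) (by decide)).trans (hz 1 (by decide) (by decide))
  have r2 := (hz1 2 (by decide) (by decide)).trans (hz 2 (by decide) (by decide))
  have r6 := (hz1 6 (by decide) (by decide)).trans (hz 6 (by decide) (by decide))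
  rw [hz 3 (by decide) (by decide)] at hl1 hl2
  rw [hm] at hm1
  rw [hf] at hf1
  rw [hq] at hq1
  rw [hk] at h9
  simp [State.init] at r0 r1 r2 r6 hk1 hk2 hl1 hl2 hm1 hf1 hq1 ht
  simp only [run_seq, run_set]
  refine run_loop (fun i τ => i ≤ 2 * s ∧ τ.reg 8 = 2 * s - i ∧ τ.reg 4 = l + 1 + i * (k + 1) ∧
    τ.reg 9 = k ∧ τ.reg 0 = n ∧ τ.reg 1 = d ∧ τ.reg 2 = s ∧ τ.reg 6 = 0 ∧
    τ.mem = (fun _ => 0) ∧ τ.flips = 0 ∧ τ.queries = 0 ∧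
    τ.time ≤ 14 * k + 14 * l + 28 + 12 * i) (2 * s) ?_ ?_ ?_
  · simp [Expr.eval, Expr.cost, r0, r1, r2, r6, hl, h9, hm1, hf1, hq1]
    omega
  · rintro i τ ⟨hi, h8, h4, h9, h0, h1, h2, h6, hm, hf, hq, ht⟩ he
    simp only [Expr.eval, h8] at he
    refine ⟨by omega, ?_⟩
    simp only [run_seq, run_set]
    simp [Expr.eval, Expr.cost, *]
    refine ⟨by omega, by omega, by ring, by omega⟩
  · rintro i τ ⟨hi, h8, h4, h9, h0, h1, h2, h6, hm, hf, hq, ht⟩ he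
    simp only [Expr.eval, h8] at he
    obtain rfl : i = 2 * s := by omega
    have h4' : τ.reg 4 = 2 * s * (k + 1) + l + 1 := by rw [h4]; ring
    set E := 2 * s * (k + 1) + l + 1 with hE
    refine run_loop (fun i τ => i ≤ d + 1 ∧ τ.reg 8 = d + 1 - i ∧ τ.reg 4 = 2 ^ i * E ∧
      τ.reg 0 = n ∧ τ.reg 1 = d ∧ τ.reg 2 = s ∧ τ.reg 6 = 0 ∧
      τ.mem = (fun _ => 0) ∧ τ.flips = 0 ∧ τ.queries = 0 ∧
      τ.time ≤ 14 * k + 14 * l + 36 + 24 * s + 10 * i) (d + 1) ?_ ?_ ?_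
    · simp [Expr.eval, Expr.cost, *]
      omega
    · rintro i τ ⟨hi, h8, h4, h0, h1, h2, h6, hm, hf, hq, ht⟩ he
      simp only [Expr.eval, h8] at he
      refine ⟨by omega, ?_⟩
      simp only [run_seq, run_set]
      simp [Expr.eval, Expr.cost, *]
      refine ⟨by omega, by omega, by ring, by omega⟩
    · rintro i τ ⟨hi, h8, h4, h0, h1, h2, h6, hm, hf, hq, ht⟩ he
      simp only [Expr.eval, h8] at he
      obtain rfl : i = d + 1 := by omega
      simp only [State.tick_reg, State.setReg_reg, Expr.eval, Expr.cost, State.tick_mem,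
        State.setReg_mem, State.tick_flips, State.setReg_flips, State.tick_queries,
        State.setReg_queries, State.tick_time, State.setReg_time, h0, h1, h2, h6, hm, hf, hq]
      refine ⟨⟨k, l, hk1, hk2, hl1, hl2, by simpa using h4⟩, by simp, by simp, by simp,
        by simp; ring, by simp, trivial, trivial, trivial, ?_⟩
      simp only [show (4 : ℕ) ≠ 5 by decide, if_false, h4]
      have e1 : d + 1 < 2 ^ (d + 1) := Nat.lt_two_pow_self
      have e2 : E + (d + 1) ≤ 2 ^ (d + 1) * E := by
        calc E + (d + 1) ≤ E + (d + 1) * E := by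
              gcongr
              exact Nat.le_mul_of_pos_right _ (by omega)
          _ = (d + 2) * E := by ring
          _ ≤ 2 ^ (d + 1) * E := Nat.mul_le_mul_right _ e1
      have e3 : k + s + l ≤ E := by
        have : s * k + s ≤ 2 * (s * k + s) := by omega
        have : k ≤ s * k := Nat.le_mul_of_pos_left _ hs
        have : 2 * s * (k + 1) = 2 * (s * k + s) := by ring
        omega
      clear_value E
      generalize 2 ^ (d + 1) * E = M at *
      omega

end DTLearn

namespace DTLearn

open DTLearn.Expr DTLearn.Prog

/-! ### Collecting relevant variables -/

variable {n : ℕ}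

/-- The point that agrees with `x` on the coordinates in `R` and on those below `m`, and is `0`
elsewhere. -/
def hybrid (R : Finset (Fin n)) (m : ℕ) (x : Cube n) : Cube n :=
  fun i => if (i : ℕ) < m ∨ i ∈ R then x i else false

/-- The point that agrees with `x` on `R` and is `0` elsewhere. -/
def project (R : Finset (Fin n)) (x : Cube n) : Cube n := fun i => if i ∈ R then x i else false

theorem hybrid_zero (R : Finset (Fin n)) (x : Cube n) : hybrid R 0 x = project R x := by
  funext i
  simp [hybrid, project]

theorem hybrid_self (R : Finset (Fin n)) (x : Cube n) : hybrid R n x = x := by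
  funext i
  simp [hybrid]

/-- `f` depends on the variable `i`. -/
def Relevant (f : Cube n → Bool) (i : Fin n) : Prop :=
  ∃ x y : Cube n, (∀ j, j ≠ i → x j = y j) ∧ f x ≠ f y

/-- The effect of the sample `x` on the set `R` of known relevant variables. -/
def Step (f : Cube n → Bool) (R : Finset (Fin n)) (x : Cube n) (R' : Finset (Fin n)) : Prop :=
  (f (project R x) = f x ∧ R' = R) ∨
    (f (project R x) ≠ f x ∧ ∃ i, i ∉ R ∧ Relevant f i ∧ R' = insert i R)

/-- Consecutive hybrids can differ only in coordinate `m`, and they do not even differ there if `m`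
belongs to `R`. -/
theorem relevant_of_hybrid {f : Cube n → Bool} {R : Finset (Fin n)} {x : Cube n} {m : ℕ}
    (hm : m < n) (h : f (hybrid R m x) ≠ f (hybrid R (m + 1) x)) :
    (⟨m, hm⟩ : Fin n) ∉ R ∧ Relevant f ⟨m, hm⟩ := by
  constructor
  · intro hR
    apply h
    congr 1
    funext i
    by_cases hi : (i : ℕ) = m
    · obtain rfl : i = ⟨m, hm⟩ := Fin.ext hi
      simp [hybrid, hR]
    · have : (i : ℕ) < m + 1 ↔ (i : ℕ) < m := by omega
      simp [hybrid, this]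
  · refine ⟨_, _, fun i hi => ?_, h⟩
    have : (i : ℕ) ≠ m := fun h => hi (Fin.ext h)
    have : (i : ℕ) < m + 1 ↔ (i : ℕ) < m := by omega
    simp [hybrid, this]

/-- Registers: `0` holds `n`, `5` the address of the sample, `9` the threshold. Ask for the value at
the hybrid point and put it into register `13`. -/
def ask : Prog :=
  .set 8 (lit 0) ;;
  .loop (sub (reg 0) (reg 8))
    -- Addition serves as disjunction: the truncated difference is nonzero when the coordinate lies
    -- below the threshold, the loaded flag when it belongs to `R`.
    (.cond (add (sub (reg 9) (reg 8)) (load (add (reg 0) (reg 8))))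
      (.store (reg 8) (load (add (reg 5) (reg 8)))) (.store (reg 8) (lit 0)) ;;
    .set 8 (add (reg 8) (lit 1))) ;;
  .query 13 (lit 0)

/-- Register `9` becomes the middle of the interval between registers `10` and `11`. -/
def halve : Prog :=
  .set 9 (reg 10) ;; .set 14 (reg 11) ;;
  -- The machine cannot divide, so the two ends walk towards each other. The linear time does no
  -- harm, since the query that follows costs `n` steps anyway.
  .loop (sub (reg 14) (reg 9)) (.set 9 (add (reg 9) (lit 1)) ;; .set 14 (sub (reg 14) (lit 1)))

/-- Binary search for a relevant variable, whose index ends up in register `10`. -/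
def search : Prog :=
  .set 10 (lit 0) ;; .set 11 (reg 0) ;;
  .loop (sub (reg 11) (add (reg 10) (lit 1))) (halve ;; ask ;;
    -- One of the two truncated differences is nonzero exactly when the registers differ.
    .cond (add (sub (reg 12) (reg 13)) (sub (reg 13) (reg 12)))
      (.set 10 (reg 9)) (.set 11 (reg 9)))

/-- Draw a sample, and look for a new relevant variable. -/
def sample : Prog :=
  .set 8 (lit 0) ;;
  .loop (sub (reg 0) (reg 8))
    (.flip 9 ;; .store (add (reg 5) (reg 8)) (reg 9) ;; .set 8 (add (reg 8) (lit 1))) ;;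
  .query 12 (reg 5) ;; .store (add (reg 5) (reg 0)) (reg 12) ;;
  .set 9 (lit 0) ;; ask ;;
  .cond (add (sub (reg 12) (reg 13)) (sub (reg 13) (reg 12)))
    (search ;;
      .store (add (reg 0) (reg 10)) (lit 1) ;;
      .store (add (add (reg 0) (reg 0)) (reg 6)) (reg 10) ;;
      .set 6 (add (reg 6) (lit 1)))
    .skip ;;
  .set 5 (add (reg 5) (add (reg 0) (lit 1)))

/-- Draw all samples. -/
def sampling : Prog :=
  .set 7 (lit 0) ;; .loop (sub (reg 4) (reg 7)) (sample ;; .set 7 (add (reg 7) (lit 1)))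

/-- The flags in the cells from `n` on mark the set `R`. -/
def Flags (R : Finset (Fin n)) (mem : ℕ → ℕ) : Prop :=
  ∀ i : Fin n, mem (n + i) ≠ 0 ↔ i ∈ R

/-- The cells from `2 * n` on list the elements of `R`. -/
def Lists (R : Finset (Fin n)) (mem : ℕ → ℕ) : Prop :=
  (∀ v < R.card, ∃ i ∈ R, mem (2 * n + v) = i) ∧ ∀ i ∈ R, ∃ v < R.card, mem (2 * n + v) = i

variable {f : Cube n → Bool} {ω : ℕ → Bool}

/-- The point is assembled in the cells below `n`. Flags, list and samples lie at or above `n`, so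
they survive; this is the condition `n ≤ a`. -/
theorem run_ask {R : Finset (Fin n)} {x : Cube n} (σ : State) (h0 : σ.reg 0 = n)
    (h5 : 3 * n ≤ σ.reg 5) (hx : σ.point n (σ.reg 5) = x) (hR : Flags R σ.mem) :
    Run f ω ask σ fun τ => τ.reg 13 = (f (hybrid R (σ.reg 9) x)).toNat ∧
      (∀ z, z ≠ 8 → z ≠ 13 → τ.reg z = σ.reg z) ∧ (∀ a, n ≤ a → τ.mem a = σ.mem a) ∧
      τ.flips = σ.flips ∧ τ.queries = σ.queries + 1 ∧ τ.time ≤ σ.time + 31 * n + 10 := by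
  unfold ask
  simp only [run_seq, run_set]
  refine run_loop (fun k τ => k ≤ n ∧ τ.reg 8 = k ∧
    (∀ i < k, τ.mem i = if σ.reg 9 - i + σ.mem (n + i) ≠ 0 then σ.mem (σ.reg 5 + i) else 0) ∧
    (∀ z, z ≠ 8 → τ.reg z = σ.reg z) ∧ (∀ a, n ≤ a → τ.mem a = σ.mem a) ∧
      τ.flips = σ.flips ∧ τ.queries = σ.queries ∧ τ.time ≤ σ.time + 2 + 30 * k) n ?_ ?_ ?_
  · simp [Expr.eval, Expr.cost]
    intro z hz
    simp [hz]
  · rintro k τ ⟨hk, h8, hm, hz, ha, hf, hq, ht⟩ he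
    have r0 : τ.reg 0 = n := (hz 0 (by decide)).trans h0
    have r5 := hz 5 (by decide)
    have r9 := hz 9 (by decide)
    simp only [Expr.eval, r0, h8] at he
    refine ⟨by omega, ?_⟩
    have m1 := ha (n + k) (by omega)
    have m2 := ha (σ.reg 5 + k) (by omega)
    simp only [run_seq, run_set, run_cond, run_store]
    simp only [Expr.eval, Expr.cost, State.tick_reg, State.tick_mem, State.setReg_reg,
      State.setReg_mem, State.setMem_reg, State.setMem_mem, State.tick_time, State.setReg_time,
      State.setMem_time, State.tick_flips, State.setReg_flips, State.setMem_flips,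
      State.tick_queries, State.setReg_queries, State.setMem_queries, r0, r5, r9, h8, m1, m2, if_true]
    constructor
    · intro hc
      refine ⟨by omega, trivial, ?_, ?_, ?_, hf, hq, by omega⟩
      · intro i hi
        by_cases hik : i = k
        · subst hik
          rw [if_pos rfl, if_pos hc]
        · rw [if_neg hik, hm i (by omega)]
      · intro z hz8
        rw [if_neg hz8, hz z hz8]
      · intro a han
        rw [if_neg (by omega), ha a han]
    · intro hc
      refine ⟨by omega, trivial, ?_, ?_, ?_, hf, hq, by omega⟩
      · intro i hi
        by_cases hik : i = k
        · subst hik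
          rw [if_pos rfl, if_neg (not_not.2 hc)]
        · rw [if_neg hik, hm i (by omega)]
      · intro z hz8
        rw [if_neg hz8, hz z hz8]
      · intro a han
        rw [if_neg (by omega), ha a han]
  · rintro k τ ⟨hk, h8, hm, hz, ha, hf, hq, ht⟩ he
    have r0 : τ.reg 0 = n := (hz 0 (by decide)).trans h0
    simp only [Expr.eval, r0, h8] at he
    obtain rfl : k = n := by omega
    have hp : τ.point k 0 = hybrid R (σ.reg 9) x := by
      funext i
      rw [← hx]
      have := hR i
      simp only [State.point, hybrid, zero_add, hm i i.2]
      by_cases hi : (i : ℕ) < σ.reg 9 ∨ i ∈ R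
      · rw [if_pos hi, if_pos]
        rcases hi with hi | hi
        · omega
        · have := this.2 hi
          omega
      · rw [if_neg hi, if_neg]
        · simp
        · push Not at hi ⊢
          have : σ.mem (k + i) = 0 := by
            by_contra h
            exact hi.2 (this.1 h)
          omega
    rw [run_query]
    simp only [Expr.eval, Expr.cost, State.tick_reg, State.tick_mem, State.setReg_reg,
      State.setReg_mem, State.tick_time, State.setReg_time, State.tick_flips, State.setReg_flips,
      State.tick_queries, if_true]
    refine ⟨?_, ?_, ha, hf, by rw [hq], by omega⟩
    · rw [← hp]
      rfl
    · intro z h8 h13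
      rw [if_neg h13, hz z h8]

theorem run_halve (σ : State) (h : σ.reg 10 ≤ σ.reg 11) :
    Run f ω halve σ fun τ => τ.reg 9 = σ.reg 10 + (σ.reg 11 - σ.reg 10 + 1) / 2 ∧
      (∀ z, z ≠ 9 → z ≠ 14 → τ.reg z = σ.reg z) ∧ τ.mem = σ.mem ∧
      τ.flips = σ.flips ∧ τ.queries = σ.queries ∧
      τ.time ≤ σ.time + 12 * (σ.reg 11 - σ.reg 10) + 8 := by
  unfold halve
  simp only [run_seq, run_set]
  refine run_loop (fun k τ => 2 * k ≤ σ.reg 11 - σ.reg 10 + 1 ∧ τ.reg 9 = σ.reg 10 + k ∧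
    τ.reg 14 = σ.reg 11 - k ∧
    (∀ z, z ≠ 9 → z ≠ 14 → τ.reg z = σ.reg z) ∧ τ.mem = σ.mem ∧
      τ.flips = σ.flips ∧ τ.queries = σ.queries ∧ τ.time ≤ σ.time + 4 + 12 * k)
      (σ.reg 11 - σ.reg 10) ?_ ?_ ?_
  · simp [Expr.eval, Expr.cost]
    intro z h9 h14
    simp [h9, h14]
  · rintro k τ ⟨hk, h9, h14, hz, hm, hf, hq, ht⟩ he
    simp only [Expr.eval, h9, h14] at he
    refine ⟨by omega, ?_⟩
    simp only [run_seq, run_set]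
    simp [Expr.eval, Expr.cost, h9, h14, hm, hf, hq]
    refine ⟨by omega, by omega, by omega, ?_, by omega⟩
    intro z h9 h14
    simp [h9, h14, hz]
  · rintro k τ ⟨hk, h9, h14, hz, hm, hf, hq, ht⟩ he
    simp only [Expr.eval, h9, h14] at he
    simp only [State.tick_reg, State.tick_mem, State.tick_time, Expr.cost, State.tick_flips,
      State.tick_queries]
    exact ⟨by omega, hz, hm, hf, hq, by omega⟩

theorem toNat_eval_ne (b c : Bool) :
    (b.toNat - c.toNat + (c.toNat - b.toNat) ≠ 0) ↔ b ≠ c := by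
  cases b <;> cases c <;> simp

/-- The hybrid at threshold `0` is the projection, where `f` has the wrong value, and the hybrid at
threshold `n` is `x` itself. Bisection keeps a wrong value at the lower end and the right value at
the upper end until the ends are adjacent; then `relevant_of_hybrid` applies. -/
theorem run_search {R : Finset (Fin n)} {x : Cube n} (σ : State) (h0 : σ.reg 0 = n) (hn : 1 ≤ n)
    (h5 : 3 * n ≤ σ.reg 5) (hx : σ.point n (σ.reg 5) = x) (hR : Flags R σ.mem)
    (hy : σ.reg 12 = (f x).toNat) (hne : f (project R x) ≠ f x) :
    Run f ω search σ fun τ => (∃ i, i ∉ R ∧ Relevant f i ∧ τ.reg 10 = i) ∧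
      (∀ z < 8, τ.reg z = σ.reg z) ∧ (∀ a, n ≤ a → τ.mem a = σ.mem a) ∧
      τ.flips = σ.flips ∧ τ.queries ≤ σ.queries + Nat.clog 2 n ∧
      τ.time ≤ σ.time + (Nat.clog 2 n + 1) * (80 * n) := by
  unfold search
  simp only [run_seq, run_set]
  refine run_loop (fun k τ => k ≤ Nat.clog 2 n ∧ τ.reg 10 < τ.reg 11 ∧ τ.reg 11 ≤ n ∧
    τ.reg 11 - τ.reg 10 ≤ 2 ^ (Nat.clog 2 n - k) ∧
    f (hybrid R (τ.reg 10) x) ≠ f x ∧ f (hybrid R (τ.reg 11) x) = f x ∧ τ.reg 12 = σ.reg 12 ∧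
    (∀ z < 8, τ.reg z = σ.reg z) ∧ (∀ a, n ≤ a → τ.mem a = σ.mem a) ∧
    τ.flips = σ.flips ∧ τ.queries ≤ σ.queries + k ∧
    τ.time ≤ σ.time + k * (80 * n) + 4) (Nat.clog 2 n) ?_ ?_ ?_
  · simp only [Expr.eval, Expr.cost, State.tick_reg, State.tick_mem, State.setReg_reg,
      State.setReg_mem, State.tick_time, State.setReg_time, State.tick_flips, State.setReg_flips,
      State.tick_queries, State.setReg_queries]
    simp [h0, hybrid_zero, hybrid_self, hne]
    refine ⟨by omega, Nat.le_pow_clog (by norm_num) n, ?_⟩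
    intro z hz
    simp [show z ≠ 11 by omega, show z ≠ 10 by omega]
  · rintro k τ ⟨hk, hlt, h11, hw, hlo, hhi, h12, hz, ha, hf, hq, ht⟩ he
    simp only [Expr.eval] at he
    -- After `Nat.clog 2 n` halvings the length of the interval is at most $2^0$, so the guard is
    -- zero.
    have hkJ : k < Nat.clog 2 n := by
      by_contra h
      rw [show Nat.clog 2 n - k = 0 by omega] at hw
      omega
    refine ⟨hkJ, ?_⟩
    simp only [run_seq]
    refine (run_halve _ (by simpa using hlt.le)).mono ?_
    rintro τ₁ ⟨h9, hz1, hm1, hf1, hq1, ht1⟩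
    simp only [State.tick_reg, State.tick_mem, State.tick_flips, State.tick_queries,
      State.tick_time, Expr.cost] at h9 hz1 hm1 hf1 hq1 ht1
    have hz1' : ∀ z < 8, τ₁.reg z = σ.reg z := fun z hz8 => by
      rw [hz1 z (by omega) (by omega), hz z hz8]
    have ha1 : ∀ a, n ≤ a → τ₁.mem a = σ.mem a := fun a han => by rw [hm1, ha a han]
    refine (run_ask (R := R) (x := x) τ₁ ((hz1' 0 (by decide)).trans h0)
      (by rwa [hz1' 5 (by decide)]) ?_ ?_).mono ?_
    · rw [hz1' 5 (by decide), ← hx]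
      funext i
      simp only [State.point]
      rw [ha1 _ (by omega)]
    · intro i
      rw [ha1 _ (by omega)]
      exact hR i
    rintro τ₂ ⟨h13, hz2, ha2, hf2, hq2, ht2⟩
    have r12 : τ₂.reg 12 = (f x).toNat := by
      rw [hz2 12 (by decide) (by decide), hz1 12 (by decide) (by decide), h12, hy]
    have r9 := hz2 9 (by decide) (by decide)
    have r10 := (hz2 10 (by decide) (by decide)).trans (hz1 10 (by decide) (by decide))
    have r11 := (hz2 11 (by decide) (by decide)).trans (hz1 11 (by decide) (by decide))
    have hpow : 2 ^ (Nat.clog 2 n - k) = 2 * 2 ^ (Nat.clog 2 n - (k + 1)) := by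
      rw [show Nat.clog 2 n - k = Nat.clog 2 n - (k + 1) + 1 by omega, pow_succ]
      ring
    rw [hpow] at hw
    generalize 2 ^ (Nat.clog 2 n - (k + 1)) = W at hw
    have htime : (k + 1) * (80 * n) = k * (80 * n) + 80 * n := by ring
    have hz2' : ∀ z < 8, τ₂.reg z = σ.reg z := fun z hz8 => by
      rw [hz2 z (by omega) (by omega), hz1' z hz8]
    simp only [run_cond, run_set]
    simp only [Expr.eval, Expr.cost, State.tick_reg, State.tick_mem, State.setReg_reg,
      State.setReg_mem, State.tick_time, State.setReg_time, State.tick_flips, State.setReg_flips,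
      State.tick_queries, State.setReg_queries, r12, h13, toNat_eval_ne]
    simp only [show (11 : ℕ) ≠ 10 by decide, show (10 : ℕ) ≠ 11 by decide,
      show (12 : ℕ) ≠ 11 by decide, show (12 : ℕ) ≠ 10 by decide, if_false, if_true, r9, r10, r11,
      hy, true_and]
    constructor
    · intro hc
      refine ⟨by omega, by omega, by omega, by omega, Ne.symm hc, hhi, ?_,
        fun a han => by rw [ha2 a han, ha1 a han], by omega, by omega, by omega⟩
      intro z hz8
      rw [if_neg (by omega), hz2' z hz8]
    · intro hc
      have hc' : f x = f (hybrid R (τ₁.reg 9) x) := by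
        by_contra h
        exact (toNat_eval_ne _ _).2 h hc
      refine ⟨by omega, by omega, by omega, by omega, hlo, hc'.symm, ?_,
        fun a han => by rw [ha2 a han, ha1 a han], by omega, by omega, by omega⟩
      intro z hz8
      rw [if_neg (by omega), hz2' z hz8]
  · rintro k τ ⟨hk, hlt, h11, hw, hlo, hhi, h12, hz, ha, hf, hq, ht⟩ he
    simp only [Expr.eval] at he
    simp only [State.tick_reg, State.tick_mem, State.tick_time, Expr.cost, State.tick_flips,
      State.tick_queries]
    have h11' : τ.reg 11 = τ.reg 10 + 1 := by omega
    rw [h11'] at hhi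
    obtain ⟨h1, h2⟩ := relevant_of_hybrid (R := R) (x := x) (f := f) (m := τ.reg 10) (by omega)
      (by rw [hhi]; exact hlo)
    have htime : k * (80 * n) ≤ Nat.clog 2 n * (80 * n) := Nat.mul_le_mul_right _ hk
    have : (Nat.clog 2 n + 1) * (80 * n) = Nat.clog 2 n * (80 * n) + 80 * n := by ring
    exact ⟨⟨_, h1, h2, rfl⟩, hz, ha, hf, by omega, by omega⟩

end DTLearn

/-! ### Drawing the samples -/

namespace DTLearn

open DTLearn.Expr DTLearn.Prog

variable {n : ℕ} {f : Cube n → Bool} {ω : ℕ → Bool}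

theorem Flags.insert {R : Finset (Fin n)} {mem mem' : ℕ → ℕ} (h : Flags R mem) (i : Fin n)
    (hi : mem' (n + i) ≠ 0) (hm : ∀ j : Fin n, j ≠ i → mem' (n + j) = mem (n + j)) :
    Flags (insert i R) mem' := by
  intro j
  by_cases hj : j = i
  · subst hj
    simpa using hi
  · rw [hm j hj, h j]
    simp [hj]

theorem Lists.insert {R : Finset (Fin n)} {mem mem' : ℕ → ℕ} (h : Lists R mem) (i : Fin n)
    (hR : i ∉ R) (hi : mem' (2 * n + R.card) = i)
    (hm : ∀ v < R.card, mem' (2 * n + v) = mem (2 * n + v)) :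
    Lists (insert i R) mem' := by
  refine ⟨fun v hv => ?_, fun j hj => ?_⟩
  · rw [Finset.card_insert_of_notMem hR] at hv
    by_cases hv' : v = R.card
    · exact ⟨i, by simp, by rw [hv', hi]⟩
    · obtain ⟨j, hj, hj'⟩ := h.1 v (by omega)
      exact ⟨j, by simp [hj], by rw [hm v (by omega), hj']⟩
  · rw [Finset.card_insert_of_notMem hR]
    by_cases hj' : j = i
    · exact ⟨R.card, by omega, by rw [hi, hj']⟩
    · obtain ⟨v, hv, hv'⟩ := h.2 j (by simpa [hj'] using hj)
      exact ⟨v, by omega, by rw [hm v hv, hv']⟩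

theorem card_lt_of_notMem {R : Finset (Fin n)} {i : Fin n} (hi : i ∉ R) : R.card < n := by
  have := Finset.card_lt_univ_of_notMem hi
  simpa using this

/-- The costs are amortized: a search is paid for by the growth of $|R|$. The old potential stands
on the left side because subtraction of natural numbers is truncated. The two queries outside the
search are those at the sample and at its projection. -/
theorem run_sample {R : Finset (Fin n)} (σ : State) (h0 : σ.reg 0 = n) (hn : 1 ≤ n)
    (h5 : 3 * n ≤ σ.reg 5) (h6 : σ.reg 6 = R.card) (hR : Flags R σ.mem) (hL : Lists R σ.mem)
    (x : Cube n) (hx : ∀ i : Fin n, x i = ω (σ.flips + i)) :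
    Run f ω sample σ fun τ => ∃ R', Step f R x R' ∧ Flags R' τ.mem ∧ Lists R' τ.mem ∧
      τ.reg 5 = σ.reg 5 + (n + 1) ∧ τ.reg 6 = R'.card ∧
      (∀ z < 8, z ≠ 5 → z ≠ 6 → τ.reg z = σ.reg z) ∧
      (∀ a, 3 * n ≤ a → a < σ.reg 5 → τ.mem a = σ.mem a) ∧
      (∀ i : Fin n, τ.mem (σ.reg 5 + i) = (x i).toNat) ∧
      τ.mem (σ.reg 5 + n) = (f x).toNat ∧ τ.flips = σ.flips + n ∧
      τ.queries + R.card * Nat.clog 2 n ≤ σ.queries + 2 + R'.card * Nat.clog 2 n ∧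
      τ.time + R.card * ((Nat.clog 2 n + 2) * (80 * n)) ≤
        σ.time + 120 * n + R'.card * ((Nat.clog 2 n + 2) * (80 * n)) := by
  unfold sample
  simp only [run_seq, run_set]
  refine run_loop (fun k τ => k ≤ n ∧ τ.reg 8 = k ∧
    (∀ i : Fin n, (i : ℕ) < k → τ.mem (σ.reg 5 + i) = (x i).toNat) ∧
    (∀ z < 8, τ.reg z = σ.reg z) ∧ (∀ a < σ.reg 5, τ.mem a = σ.mem a) ∧
      τ.flips = σ.flips + k ∧ τ.queries = σ.queries ∧ τ.time ≤ σ.time + 2 + 14 * k) n ?_ ?_ ?_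
  · simp [Expr.eval, Expr.cost]
    intro z hz
    simp [show z ≠ 8 by omega]
  · rintro k τ ⟨hk, h8, hm, hz, ha, hf, hq, ht⟩ he
    have r0 : τ.reg 0 = n := (hz 0 (by decide)).trans h0
    have r5 := hz 5 (by decide)
    simp only [Expr.eval, r0, h8] at he
    have hkn : k < n := by omega
    refine ⟨hkn, ?_⟩
    simp only [run_seq, run_set, run_flip, run_store]
    simp [Expr.eval, Expr.cost, h8, hf, hq, r5]
    refine ⟨by omega, ?_, ?_, ?_, by omega, by omega⟩
    · intro i hi
      by_cases hik : (i : ℕ) = k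
      · obtain rfl : i = ⟨k, hkn⟩ := Fin.ext hik
        simp [hx]
      · simp [hik, hm i (by omega)]
    · intro z hz8
      simp [show z ≠ 8 by omega, show z ≠ 9 by omega, hz z hz8]
    · intro a ha'
      simp [show a ≠ σ.reg 5 + k by omega, ha a ha']
  · rintro k τ ⟨hk, h8, hm, hz, ha, hf, hq, ht⟩ he
    have r0 : τ.reg 0 = n := (hz 0 (by decide)).trans h0
    have r5 := hz 5 (by decide)
    simp only [Expr.eval, r0, h8] at he
    obtain rfl : k = n := by omega
    have hp : τ.point k (σ.reg 5) = x := by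
      funext i
      simp [State.point, hm i i.2]
    simp only [run_query, run_store]
    have hp' : (τ.tick ((sub (reg 0) (reg 8)).cost + 1)).point k
      ((reg 5).eval (τ.tick ((sub (reg 0) (reg 8)).cost + 1))) = x := by
      rw [← hp]
      simp only [Expr.eval, State.tick_reg, r5]
      rfl
    rw [hp']
    refine (run_ask (R := R) (x := x) _ ?_ ?_ ?_ ?_).mono ?_
    · simp [r0]
    · simpa [r5] using h5
    · rw [← hp]
      funext i
      simp [State.point, Expr.eval, r5, r0, show (i : ℕ) ≠ k by omega]
    · intro i
      simp [Expr.eval, r5, r0, show k + (i : ℕ) ≠ σ.reg 5 + k by omega]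
      rw [ha _ (by omega)]
      exact hR i
    rintro τ₁ ⟨h13, hz1, ha1, hf1, hq1, ht1⟩
    simp [Expr.eval, Expr.cost, hybrid_zero, r5, r0] at h13 hz1 ha1 hf1 hq1 ht1
    have hz1' : ∀ z < 8, τ₁.reg z = σ.reg z := fun z hz8 => by
      rw [hz1 z (by omega) (by omega), if_neg (by omega), if_neg (by omega), hz z hz8]
    have h12 : τ₁.reg 12 = (f x).toNat := by simp [hz1]
    have hR1 : Flags R τ₁.mem := by
      intro i
      rw [ha1 _ (by omega), if_neg (by omega), ha _ (by omega)]
      exact hR i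
    have ham : ∀ a, k ≤ a → a < σ.reg 5 → τ₁.mem a = σ.mem a := fun a h1 h2 => by
      rw [ha1 _ h1, if_neg (by omega), ha _ h2]
    have hxm : ∀ i : Fin k, τ₁.mem (σ.reg 5 + i) = (x i).toNat := fun i => by
      rw [ha1 _ (by omega), if_neg (by omega), hm i i.2]
    have hym : τ₁.mem (σ.reg 5 + k) = (f x).toNat := by
      rw [ha1 _ (by omega), if_pos rfl]
    rw [run_cond]
    simp only [Expr.eval, h12, h13, toNat_eval_ne, Expr.cost]
    constructor
    · intro hne
      rw [run_seq]
      refine (run_search (R := R) (x := x) _ (by simpa using (hz1' 0 (by decide)).trans h0) hn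
        (by simpa [hz1' 5 (by decide)] using h5) ?_ (by simpa using hR1) (by simpa using h12)
        hne.symm).mono ?_
      · rw [← hp]
        funext i
        simp [State.point, hz1' 5 (by decide), hxm, hm]
      rintro τ₂ ⟨⟨i, hiR, hrel, h10⟩, hz2, ha2, hf2, hq2, ht2⟩
      simp only [State.tick_reg, State.tick_mem, State.tick_flips, State.tick_queries,
        State.tick_time] at hz2 ha2 hf2 hq2 ht2
      have hcard := card_lt_of_notMem hiR
      have q0 := (hz2 0 (by decide)).trans ((hz1' 0 (by decide)).trans h0)
      have q5 := (hz2 5 (by decide)).trans (hz1' 5 (by decide))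
      have q6 := (hz2 6 (by decide)).trans ((hz1' 6 (by decide)).trans h6)
      simp only [run_seq, run_set, run_store]
      simp [Expr.eval, Expr.cost, h10, q0, q5, q6]
      refine ⟨insert i R, Or.inr ⟨hne.symm, i, hiR, hrel, rfl⟩, ?_, ?_, ?_, ?_, ?_, ?_, ?_, ?_, ?_,
        ?_⟩
      · refine hR1.insert i ?_ fun j hj => ?_
        · simp [show ¬ k + (i : ℕ) = k + k + R.card by omega]
        · have : (j : ℕ) ≠ i := fun h => hj (Fin.ext h)
          simp [show ¬ k + (j : ℕ) = k + k + R.card by omega, this, ha2]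
      · refine hL.insert i hiR ?_ fun v hv => ?_
        · simp [two_mul]
        · simp only [two_mul, State.setMem_mem, State.tick_mem]
          rw [if_neg (by omega), if_neg (by omega), ha2 _ (by omega), ham _ (by omega) (by omega)]
      · rw [Finset.card_insert_of_notMem hiR]
      · intro z hz8 hz5 hz6
        simp [hz5, hz6, hz2 z hz8, hz1' z hz8]
      · intro a h1 h2
        rw [if_neg (by omega), if_neg (by omega), ha2 _ (by omega), ham _ (by omega) (by omega)]
      · intro j
        rw [if_neg (by omega), if_neg (by omega), ha2 _ (by omega), hxm]
      · rw [if_neg (by omega), if_neg (by omega), ha2 _ (by omega), hym]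
      · omega
      · rw [Finset.card_insert_of_notMem hiR]
        have : (R.card + 1) * Nat.clog 2 k = R.card * Nat.clog 2 k + Nat.clog 2 k := by ring
        omega
      · rw [Finset.card_insert_of_notMem hiR]
        have e1 : (R.card + 1) * ((Nat.clog 2 k + 2) * (80 * k)) =
          R.card * ((Nat.clog 2 k + 2) * (80 * k)) + (Nat.clog 2 k + 1) * (80 * k) + 80 * k := by
          ring
        omega
    · intro he
      have heq : f (project R x) = f x := by
        by_contra h
        exact (toNat_eval_ne _ _).2 (Ne.symm h) he
      have q0 := (hz1' 0 (by decide)).trans h0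
      have q5 := (hz1' 5 (by decide))
      have q6 := (hz1' 6 (by decide)).trans h6
      simp only [run_skip]
      simp [Expr.eval, Expr.cost, q0, q5, q6]
      refine ⟨R, Or.inl ⟨heq, rfl⟩, hR1, ?_, ?_, ?_, ?_, hxm, hym, ?_, by omega, by omega⟩
      · refine ⟨fun v hv => ?_, fun i hi => ?_⟩
        · obtain ⟨i, hi, hi'⟩ := hL.1 v hv
          refine ⟨i, hi, ?_⟩
          have : R.card ≤ k := by simpa using Finset.card_le_univ R
          rw [ham _ (by omega) (by omega), hi']
        · obtain ⟨v, hv, hv'⟩ := hL.2 i hi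
          refine ⟨v, hv, ?_⟩
          have : R.card ≤ k := by simpa using Finset.card_le_univ R
          rw [ham _ (by omega) (by omega), hv']
      · rfl
      · intro z hz8 hz5 hz6
        simp [hz5, hz1' z hz8]
      · intro a h1 h2
        rw [ham _ (by omega) (by omega)]
      · omega

/-- The `t`-th sample drawn with the coins `ω`. -/
def drawn (n : ℕ) (ω : ℕ → Bool) (t : ℕ) : Cube n := fun i => ω (t * n + i)

theorem run_sampling {M : ℕ} (σ : State) (h0 : σ.reg 0 = n) (hn : 1 ≤ n) (h4 : σ.reg 4 = M)
    (h5 : σ.reg 5 = 3 * n) (h6 : σ.reg 6 = 0) (hm : σ.mem = fun _ => 0) (hf : σ.flips = 0)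
    (hq : σ.queries = 0) :
    Run f ω sampling σ fun τ => ∃ Rs : ℕ → Finset (Fin n), Rs 0 = ∅ ∧
      (∀ t < M, Step f (Rs t) (drawn n ω t) (Rs (t + 1))) ∧ Lists (Rs M) τ.mem ∧
      τ.reg 5 = 3 * n + M * (n + 1) ∧ τ.reg 6 = (Rs M).card ∧
      (∀ z < 5, τ.reg z = σ.reg z) ∧
      (∀ t < M, (∀ i : Fin n, τ.mem (3 * n + t * (n + 1) + i) = (drawn n ω t i).toNat) ∧
        τ.mem (3 * n + t * (n + 1) + n) = (f (drawn n ω t)).toNat) ∧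
      τ.queries ≤ 2 * M + (Rs M).card * Nat.clog 2 n ∧
      τ.time ≤ σ.time + 10 + M * (140 * n) + (Rs M).card * ((Nat.clog 2 n + 2) * (80 * n)) := by
  unfold sampling
  simp only [run_seq, run_set]
  refine run_loop (fun k τ => k ≤ M ∧ τ.reg 7 = k ∧ ∃ Rs : ℕ → Finset (Fin n), Rs 0 = ∅ ∧
      (∀ t < k, Step f (Rs t) (drawn n ω t) (Rs (t + 1))) ∧ Flags (Rs k) τ.mem ∧
      Lists (Rs k) τ.mem ∧
      τ.reg 5 = 3 * n + k * (n + 1) ∧ τ.reg 6 = (Rs k).card ∧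
      (∀ z < 5, τ.reg z = σ.reg z) ∧
      (∀ t < k, (∀ i : Fin n, τ.mem (3 * n + t * (n + 1) + i) = (drawn n ω t i).toNat) ∧
        τ.mem (3 * n + t * (n + 1) + n) = (f (drawn n ω t)).toNat) ∧
      τ.flips = k * n ∧
      τ.queries ≤ 2 * k + (Rs k).card * Nat.clog 2 n ∧
      τ.time ≤ σ.time + 2 + k * (140 * n) + (Rs k).card * ((Nat.clog 2 n + 2) * (80 * n)))
      M ?_ ?_ ?_
  · simp [Expr.eval, Expr.cost, h5, h6, hm, hf, hq]
    refine ⟨fun _ => ∅, rfl, ?_, ?_, by simp, ?_⟩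
    · intro i
      simp
    · simp [Lists]
    · intro z hz
      simp [show z ≠ 7 by omega]
  · rintro k τ ⟨hk, h7, Rs, hR0, hstep, hF, hL, r5, r6, hz, hX, hf, hq, ht⟩ he
    have r0 := (hz 0 (by decide)).trans h0
    have r4 := (hz 4 (by decide)).trans h4
    simp only [Expr.eval, h7, r4] at he
    refine ⟨by omega, ?_⟩
    rw [run_seq]
    refine (run_sample (R := Rs k) _ (by simpa using r0) hn (by simp; omega) (by simpa using r6)
      (by simpa using hF) (by simpa using hL) (drawn n ω k) (by simp [hf, drawn])).mono ?_
    rintro τ₁ ⟨R', hs, hF', hL', q5, q6, hz1, ha, hx, hy, hf1, hq1, ht1⟩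
    simp only [State.tick_reg, State.tick_mem, State.tick_flips, State.tick_queries,
        State.tick_time, Expr.cost] at q5 hz1 ha hx hy hf1 hq1 ht1
    have q7 := hz1 7 (by decide) (by decide) (by decide)
    rw [run_set]
    simp only [State.tick_reg, State.tick_mem, State.tick_flips, State.tick_queries,
        State.tick_time, Expr.cost, State.setReg_reg, State.setReg_mem, State.setReg_flips,
        State.setReg_queries, State.setReg_time, Expr.eval, if_true, q7, h7]
    refine ⟨by omega, trivial, fun t => if t ≤ k then Rs t else R', by simpa using hR0, ?_, ?_⟩
    · intro t htk
      by_cases htk' : t = k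
      · subst htk'
        simpa using hs
      · simp only [show t ≤ k by omega, show t + 1 ≤ k by omega, if_true]
        exact hstep t (by omega)
    · simp only [show ¬ (k + 1 ≤ k) by omega, if_false]
      have e1 : 3 * n + (k + 1) * (n + 1) = 3 * n + k * (n + 1) + (n + 1) := by ring
      refine ⟨hF', hL', by simp; omega, by simpa using q6, ?_, ?_, ?_, by omega, ?_⟩
      · intro z hz'
        rw [if_neg (by omega), hz1 z (by omega) (by omega) (by omega), hz z hz']
      · intro t htk
        by_cases htk' : t = k
        · subst htk'
          rw [r5] at hx hy
          exact ⟨hx, hy⟩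
        · have : (t + 1) * (n + 1) ≤ k * (n + 1) := Nat.mul_le_mul_right _ (by omega)
          have e2 : (t + 1) * (n + 1) = t * (n + 1) + (n + 1) := by ring
          obtain ⟨h1, h2⟩ := hX t (by omega)
          refine ⟨fun i => ?_, ?_⟩
          · rw [ha _ (by omega) (by omega), h1]
          · rw [ha _ (by omega) (by omega), h2]
      · rw [hf1, hf]
        ring
      · have : (k + 1) * (140 * n) = k * (140 * n) + 140 * n := by ring
        omega
  · rintro k τ ⟨hk, h7, Rs, hR0, hstep, hF, hL, r5, r6, hz, hX, hf, hq, ht⟩ he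
    have r4 := (hz 4 (by decide)).trans h4
    simp only [Expr.eval, h7, r4] at he
    obtain rfl : k = M := by omega
    exact ⟨Rs, hR0, hstep, hL, r5, r6, hz, hX, hq, by simp [Expr.cost]; omega⟩

end DTLearn

namespace DTLearn

open DTLearn.Expr DTLearn.Prog

/-! ### The search for a consistent tree: splitting the samples -/

/-- The number of nodes with fewer than `k` edges above them in the complete tree in which every
node has `2 * r` children. -/
def internal (r : ℕ) : ℕ → ℕ
  | 0 => 0
  | k + 1 => 2 * r * internal r k + 1

/-- The address of the `j`-th record: an output tree node in three cells, the size of the tree, and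
the `M` cells that mark the samples that reach the node. -/
def recAddr (M B j : ℕ) : ℕ := B + j * (M + 4)

/-- The address of the `t`-th sample. -/
def sampleAddr (n t : ℕ) : ℕ := 3 * n + t * (n + 1)

theorem recAddr_zero (M B : ℕ) : recAddr M B 0 = B := by simp [recAddr]

theorem recAddr_succ (M B j : ℕ) : recAddr M B (j + 1) = recAddr M B j + (M + 4) := by
  simp only [recAddr]
  ring

theorem recAddr_le {M B i j : ℕ} (h : i < j) : recAddr M B i + (M + 4) ≤ recAddr M B j := by
  rw [← recAddr_succ]
  exact Nat.add_le_add_left (Nat.mul_le_mul_right _ h) _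

theorem le_recAddr (M B j : ℕ) : B ≤ recAddr M B j := Nat.le_add_right _ _

theorem sampleAddr_succ (n t : ℕ) : sampleAddr n (t + 1) = sampleAddr n t + (n + 1) := by
  simp only [sampleAddr]
  ring

theorem sampleAddr_lt {n t M : ℕ} (h : t < M) : sampleAddr n t + n < sampleAddr n M := by
  have : (t + 1) * (n + 1) ≤ M * (n + 1) := Nat.mul_le_mul_right _ h
  have e : (t + 1) * (n + 1) = t * (n + 1) + (n + 1) := by ring
  simp only [sampleAddr]
  omega

/-- Register `7` becomes the number of internal nodes. -/
def countInternal : Prog :=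
  .set 7 (lit 0) ;; .set 8 (lit 0) ;;
  .loop (sub (reg 1) (reg 8)) (.set 9 (lit 1) ;; .set 10 (lit 0) ;;
    -- The product in the recursion for `internal` is formed by repeated addition.
    .loop (sub (reg 6) (reg 10))
      (.set 9 (add (reg 9) (add (reg 7) (reg 7))) ;; .set 10 (add (reg 10) (lit 1))) ;;
    .set 7 (reg 9) ;; .set 8 (add (reg 8) (lit 1)))

/-- Split the samples at the node with record address in register `9` according to the variable in
position `12` of the list; the records of the children start at the address in register `10`. -/
def split : Prog :=
  .set 13 (load (add (add (reg 0) (reg 0)) (reg 12))) ;; .set 14 (lit 0) ;;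
  .set 15 (add (reg 0) (add (reg 0) (reg 0))) ;;
  .loop (sub (reg 4) (reg 14))
    -- Marks and coordinates are bits, so truncated subtraction acts as a conjunction: mark minus
    -- $x_i$ says that the sample reaches the node and has $x_i = 0$; the second store does the same
    -- for $x_i = 1$.
    (.store (add (add (reg 10) (lit 4)) (reg 14))
      (sub (load (add (add (reg 9) (lit 4)) (reg 14))) (load (add (reg 15) (reg 13)))) ;;
    .store (add (add (add (reg 10) (reg 8)) (lit 4)) (reg 14))
      (sub (load (add (add (reg 9) (lit 4)) (reg 14)))
        (sub (lit 1) (load (add (reg 15) (reg 13))))) ;;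
    .set 15 (add (reg 15) (add (reg 0) (lit 1))) ;;
    .set 14 (add (reg 14) (lit 1)))

/-- Split the samples at one node according to all variables. -/
def expand : Prog :=
  .set 12 (lit 0) ;;
  .loop (sub (reg 6) (reg 12))
    (split ;; .set 10 (add (reg 10) (add (reg 8) (reg 8))) ;; .set 12 (add (reg 12) (lit 1)))

/-- Mark for every node the samples that reach it. -/
def splitting : Prog :=
  .set 8 (add (reg 4) (lit 4)) ;; .set 14 (lit 0) ;;
  .loop (sub (reg 4) (reg 14))
    (.store (add (add (reg 5) (lit 4)) (reg 14)) (lit 1) ;; .set 14 (add (reg 14) (lit 1))) ;;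
  .set 9 (reg 5) ;; .set 10 (add (reg 5) (reg 8)) ;; .set 11 (lit 0) ;;
  .loop (sub (reg 7) (reg 11))
    (expand ;; .set 9 (add (reg 9) (reg 8)) ;; .set 11 (add (reg 11) (lit 1)))

/-- The samples at the record address `p` are split by the variable in position `v` of the list
among the two records from the address `c` on. -/
def SplitAt (n M : ℕ) (mem : ℕ → ℕ) (p c v : ℕ) : Prop :=
  ∀ t < M,
    mem (c + 4 + t) = mem (p + 4 + t) - mem (sampleAddr n t + mem (2 * n + v)) ∧
    mem (c + (M + 4) + 4 + t) =
      mem (p + 4 + t) - (1 - mem (sampleAddr n t + mem (2 * n + v)))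

variable {n : ℕ} {f : Cube n → Bool} {ω : ℕ → Bool} {M B d s r : ℕ}

/-- All cells that the condition reads lie below `a`, while the splits made afterwards write only at
or above `a`. -/
theorem SplitAt.congr {mem mem' : ℕ → ℕ} {p c v a : ℕ} (h : SplitAt n M mem p c v)
    (hm : ∀ b < a, mem' b = mem b) (hp : p + (M + 4) ≤ a) (hc : c + 2 * (M + 4) ≤ a)
    (hv : 2 * n + v < a) (hx : sampleAddr n M ≤ a) (hV : mem (2 * n + v) < n) :
    SplitAt n M mem' p c v := by
  intro t ht
  have := sampleAddr_lt (n := n) ht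
  obtain ⟨h1, h2⟩ := h t ht
  rw [hm _ hv, hm _ (by omega), hm _ (by omega), hm _ (by omega), hm _ (by omega)]
  exact ⟨h1, h2⟩

theorem run_countInternal (σ : State) (h1 : σ.reg 1 = d) (h6 : σ.reg 6 = r) :
    Run f ω countInternal σ fun τ => τ.reg 7 = internal r d ∧
      (∀ z < 7, τ.reg z = σ.reg z) ∧ τ.mem = σ.mem ∧ τ.queries = σ.queries ∧
      τ.time ≤ σ.time + 10 + d * (20 + 20 * r) := by
  unfold countInternal
  simp only [run_seq, run_set]
  refine run_loop (fun k τ => k ≤ d ∧ τ.reg 8 = k ∧ τ.reg 7 = internal r k ∧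
    (∀ z < 7, τ.reg z = σ.reg z) ∧ τ.mem = σ.mem ∧ τ.queries = σ.queries ∧
      τ.time ≤ σ.time + 4 + k * (20 + 20 * r)) d ?_ ?_ ?_
  · simp [Expr.eval, Expr.cost, internal]
    intro z hz
    simp [show z ≠ 8 by omega, show z ≠ 7 by omega]
  · rintro k τ ⟨hk, h8, h7, hz, hm, hq, ht⟩ he
    have r1 := (hz 1 (by decide)).trans h1
    simp only [Expr.eval, r1, h8] at he
    refine ⟨by omega, ?_⟩
    simp only [run_seq, run_set]
    refine run_loop (fun i τ => i ≤ r ∧ τ.reg 8 = k ∧ τ.reg 7 = internal r k ∧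
      τ.reg 10 = i ∧ τ.reg 9 = 2 * i * internal r k + 1 ∧
      (∀ z < 7, τ.reg z = σ.reg z) ∧ τ.mem = σ.mem ∧ τ.queries = σ.queries ∧
      τ.time ≤ σ.time + 12 + k * (20 + 20 * r) + i * 14) r ?_ ?_ ?_
    · simp [Expr.eval, Expr.cost, h8, h7, hm, hq]
      refine ⟨fun z hz' => ?_, by omega⟩
      simp [show z ≠ 10 by omega, show z ≠ 9 by omega, hz z hz']
    · rintro i τ ⟨hi, h8, h7, h10, h9, hz, hm, hq, ht⟩ he
      have r6 := (hz 6 (by decide)).trans h6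
      simp only [Expr.eval, r6, h10] at he
      refine ⟨by omega, ?_⟩
      simp only [run_seq, run_set]
      simp [Expr.eval, Expr.cost, h8, h7, h9, h10, hm, hq]
      refine ⟨by omega, by ring, fun z hz' => ?_, by omega⟩
      simp [show z ≠ 10 by omega, show z ≠ 9 by omega, hz z hz']
    · rintro i τ ⟨hi, h8, h7, h10, h9, hz, hm, hq, ht⟩ he
      have r6 := (hz 6 (by decide)).trans h6
      simp only [Expr.eval, r6, h10] at he
      obtain rfl : i = r := by omega
      simp [Expr.eval, Expr.cost, h8, h9, hm, hq, internal]
      have : (k + 1) * (20 + 20 * i) = k * (20 + 20 * i) + 20 + 20 * i := by ring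
      refine ⟨by omega, fun z hz' => ?_, by omega⟩
      simp [show z ≠ 7 by omega, show z ≠ 8 by omega, hz z hz']
  · rintro k τ ⟨hk, h8, h7, hz, hm, hq, ht⟩ he
    have r1 := (hz 1 (by decide)).trans h1
    simp only [Expr.eval, r1, h8] at he
    obtain rfl : k = d := by omega
    exact ⟨h7, hz, hm, hq, by simp [Expr.cost]; omega⟩

theorem run_split {p c v : ℕ} (σ : State) (h0 : σ.reg 0 = n) (h4 : σ.reg 4 = M)
    (h8 : σ.reg 8 = M + 4) (h9 : σ.reg 9 = p) (h10 : σ.reg 10 = c) (h12 : σ.reg 12 = v)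
    (hp : sampleAddr n M ≤ p) (hc : p + (M + 4) ≤ c) (hv : v < n) (hV : σ.mem (2 * n + v) < n) :
    Run f ω split σ fun τ => SplitAt n M τ.mem p c v ∧
      (∀ z < 13, τ.reg z = σ.reg z) ∧ (∀ a < c, τ.mem a = σ.mem a) ∧ τ.queries = σ.queries ∧
      τ.time ≤ σ.time + 20 + M * 60 := by
  have hS0 : 3 * n ≤ sampleAddr n M := Nat.le_add_right _ _
  unfold split
  simp only [run_seq, run_set]
  generalize hVe : σ.mem (2 * n + v) = V at hV
  refine run_loop (fun k τ => k ≤ M ∧ τ.reg 13 = V ∧ τ.reg 14 = k ∧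
    τ.reg 15 = sampleAddr n k ∧
    (∀ t < k, τ.mem (c + 4 + t) = σ.mem (p + 4 + t) - σ.mem (sampleAddr n t + V) ∧
      τ.mem (c + (M + 4) + 4 + t) = σ.mem (p + 4 + t) - (1 - σ.mem (sampleAddr n t + V))) ∧
    (∀ z < 13, τ.reg z = σ.reg z) ∧ (∀ a < c, τ.mem a = σ.mem a) ∧ τ.queries = σ.queries ∧
      τ.time ≤ σ.time + 15 + k * 60) M ?_ ?_ ?_
  · simp [Expr.eval, Expr.cost, h0, h12, sampleAddr]
    refine ⟨by rw [← hVe, two_mul], by ring, fun z hz => ?_⟩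
    simp [show z ≠ 13 by omega, show z ≠ 14 by omega, show z ≠ 15 by omega]
  · rintro k τ ⟨hk, q13, q14, q15, hs, hz, hm, hq, ht⟩ he
    have q0 := (hz 0 (by decide)).trans h0
    have q4 := (hz 4 (by decide)).trans h4
    have q8 := (hz 8 (by decide)).trans h8
    have q9 := (hz 9 (by decide)).trans h9
    have q10 := (hz 10 (by decide)).trans h10
    simp only [Expr.eval, q4, q14] at he
    have hkM : k < M := by omega
    refine ⟨hkM, ?_⟩
    have hkS := sampleAddr_lt (n := n) hkM
    simp only [run_seq, run_set, run_store]
    simp only [Expr.eval, Expr.cost, State.tick_reg, State.tick_mem, State.setReg_reg,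
      State.setReg_mem, State.setMem_reg, State.setMem_mem, State.tick_time, State.setReg_time,
      State.setMem_time, State.tick_queries, State.setReg_queries, State.setMem_queries,
      q0, q8, q9, q10, q13, q14, q15, if_true]
    simp only [show (13 : ℕ) ≠ 14 by decide, show (13 : ℕ) ≠ 15 by decide,
      show (14 : ℕ) ≠ 15 by decide, show (15 : ℕ) ≠ 14 by decide, if_false, sampleAddr_succ]
    refine ⟨by omega, trivial, trivial, trivial, ?_, ?_, ?_, hq, by omega⟩
    · intro t htk
      rw [if_neg (show sampleAddr n k + V ≠ c + 4 + k by omega),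
        if_neg (show p + 4 + k ≠ c + 4 + k by omega), hm (p + 4 + k) (by omega),
        hm (sampleAddr n k + V) (by omega)]
      by_cases htk' : t = k
      · subst htk'
        rw [if_neg (by omega), if_pos rfl, if_pos rfl]
        exact ⟨rfl, rfl⟩
      · obtain ⟨e1, e2⟩ := hs t (by omega)
        rw [if_neg (by omega), if_neg (by omega), if_neg (by omega), if_neg (by omega)]
        exact ⟨e1, e2⟩
    · intro z hz13
      rw [if_neg (by omega), if_neg (by omega), hz z hz13]
    · intro a ha
      rw [if_neg (by omega), if_neg (by omega), hm a ha]
  · rintro k τ ⟨hk, q13, q14, q15, hs, hz, hm, hq, ht⟩ he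
    have q4 := (hz 4 (by decide)).trans h4
    simp only [Expr.eval, q4, q14] at he
    obtain rfl : k = M := by omega
    refine ⟨?_, hz, hm, hq, by simp [Expr.cost]; omega⟩
    intro t htk
    have hkS := sampleAddr_lt (n := n) htk
    simp only [State.tick_mem]
    rw [hm (2 * n + v) (by omega), hVe, hm (p + 4 + t) (by omega),
      hm (sampleAddr n t + V) (by omega)]
    exact hs t htk

theorem run_expand {p c : ℕ} (σ : State) (h0 : σ.reg 0 = n) (h4 : σ.reg 4 = M)
    (h6 : σ.reg 6 = r) (h8 : σ.reg 8 = M + 4) (h9 : σ.reg 9 = p) (h10 : σ.reg 10 = c)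
    -- If the list is empty, no child is written, and `c` need not lie beyond `p`.
    (hp : sampleAddr n M ≤ p) (hc : 0 < r → p + (M + 4) ≤ c) (hr : r ≤ n)
    (hV : ∀ v < r, σ.mem (2 * n + v) < n) :
    Run f ω expand σ fun τ => (∀ v < r, SplitAt n M τ.mem p (c + 2 * v * (M + 4)) v) ∧
      τ.reg 10 = c + 2 * r * (M + 4) ∧
      (∀ z < 12, z ≠ 10 → τ.reg z = σ.reg z) ∧ (∀ a < c, τ.mem a = σ.mem a) ∧
      τ.queries = σ.queries ∧ τ.time ≤ σ.time + 10 + r * (40 + M * 60) := by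
  have hS0 : 3 * n ≤ sampleAddr n M := Nat.le_add_right _ _
  unfold expand
  simp only [run_seq, run_set]
  refine run_loop (fun k τ => k ≤ r ∧ τ.reg 12 = k ∧
    (∀ v < k, SplitAt n M τ.mem p (c + 2 * v * (M + 4)) v) ∧
      τ.reg 10 = c + 2 * k * (M + 4) ∧
      (∀ z < 12, z ≠ 10 → τ.reg z = σ.reg z) ∧ (∀ a < c, τ.mem a = σ.mem a) ∧
      τ.queries = σ.queries ∧ τ.time ≤ σ.time + 4 + k * (40 + M * 60)) r ?_ ?_ ?_
  · simp [Expr.eval, Expr.cost, h10]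
    intro z hz _
    simp [show z ≠ 12 by omega]
  · rintro k τ ⟨hk, q12, hs, q10, hz, hm, hq, ht⟩ he
    have q6 := (hz 6 (by decide) (by decide)).trans h6
    simp only [Expr.eval, q6, q12] at he
    refine ⟨by omega, ?_⟩
    have hc := hc (by omega)
    rw [run_seq]
    refine (run_split (n := n) (M := M) (p := p) (c := c + 2 * k * (M + 4)) (v := k)
      (τ.tick ((sub (reg 6) (reg 12)).cost + 1))
      ((hz 0 (by decide) (by decide)).trans h0) ((hz 4 (by decide) (by decide)).trans h4)
      ((hz 8 (by decide) (by decide)).trans h8) ((hz 9 (by decide) (by decide)).trans h9)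
      q10 q12 hp (by omega) (by omega) ?_).mono ?_
    · simpa [hm (2 * n + k) (by omega)] using hV k (by omega)
    rintro τ₁ ⟨hs1, hz1, hm1, hq1, ht1⟩
    simp only [State.tick_reg, State.tick_mem, State.tick_queries, State.tick_time, Expr.cost]
      at hz1 hm1 hq1 ht1
    have q0 := (hz1 0 (by decide)).trans ((hz 0 (by decide) (by decide)).trans h0)
    have q8 := (hz1 8 (by decide)).trans ((hz 8 (by decide) (by decide)).trans h8)
    have q10' := (hz1 10 (by decide)).trans q10
    have q12' := (hz1 12 (by decide)).trans q12
    have e1 : 2 * (k + 1) * (M + 4) = 2 * k * (M + 4) + 2 * (M + 4) := by ring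
    simp only [run_seq, run_set]
    simp only [Expr.eval, Expr.cost, State.tick_reg, State.tick_mem, State.setReg_reg,
      State.setReg_mem, State.tick_time, State.setReg_time, State.tick_queries,
      State.setReg_queries, q8, q10', q12', if_true]
    simp only [show (10 : ℕ) ≠ 12 by decide, show (12 : ℕ) ≠ 10 by decide, if_false]
    refine ⟨by omega, trivial, ?_, by omega, ?_, ?_, hq1.trans hq, ?_⟩
    · intro v hv
      by_cases hvk : v = k
      · subst hvk
        exact hs1
      · have : 2 * (v + 1) * (M + 4) ≤ 2 * k * (M + 4) := Nat.mul_le_mul_right _ (by omega)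
        have e2 : 2 * (v + 1) * (M + 4) = 2 * v * (M + 4) + 2 * (M + 4) := by ring
        exact (hs v (by omega)).congr hm1 (by omega) (by omega) (by omega) (by omega)
          (by simpa [hm (2 * n + v) (by omega)] using hV v (by omega))
    · intro z hz12 hz10
      rw [if_neg (by omega), if_neg hz10, hz1 z (by omega), hz z hz12 hz10]
    · intro a ha
      rw [hm1 a (by omega), hm a ha]
    · have : (k + 1) * (40 + M * 60) = k * (40 + M * 60) + 40 + M * 60 := by ring
      omega
  · rintro k τ ⟨hk, q12, hs, q10, hz, hm, hq, ht⟩ he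
    have q6 := (hz 6 (by decide) (by decide)).trans h6
    simp only [Expr.eval, q6, q12] at he
    obtain rfl : k = r := by omega
    exact ⟨hs, q10, hz, hm, hq, by simp [Expr.cost]; omega⟩

/-- The samples at all nodes `j < I` are split among their children. -/
def SplitBelow (n M r : ℕ) (mem : ℕ → ℕ) (I : ℕ) : Prop :=
  ∀ j < I, ∀ v < r, SplitAt n M mem (recAddr M (sampleAddr n M) j)
    (recAddr M (sampleAddr n M) (2 * r * j + 1 + 2 * v)) v

theorem run_splitting {I : ℕ} (σ : State) (h0 : σ.reg 0 = n) (h4 : σ.reg 4 = M)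
    (h5 : σ.reg 5 = sampleAddr n M) (h6 : σ.reg 6 = r) (h7 : σ.reg 7 = I)
    (hr : r ≤ n) (hV : ∀ v < r, σ.mem (2 * n + v) < n) :
    Run f ω splitting σ fun τ => (∀ t < M, τ.mem (sampleAddr n M + 4 + t) = 1) ∧
      SplitBelow n M r τ.mem I ∧ τ.reg 8 = M + 4 ∧ τ.reg 9 = recAddr M (sampleAddr n M) I ∧
      τ.reg 10 = recAddr M (sampleAddr n M) (2 * r * I + 1) ∧
      (∀ z < 8, τ.reg z = σ.reg z) ∧ (∀ a < sampleAddr n M, τ.mem a = σ.mem a) ∧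
      τ.queries = σ.queries ∧
      τ.time ≤ σ.time + 40 + M * 20 + I * (40 + r * (40 + M * 60)) := by
  have hS0 : 3 * n ≤ sampleAddr n M := Nat.le_add_right _ _
  unfold splitting
  simp only [run_seq, run_set]
  refine run_loop (fun k τ => k ≤ M ∧ τ.reg 8 = M + 4 ∧ τ.reg 14 = k ∧
    (∀ t < k, τ.mem (sampleAddr n M + 4 + t) = 1) ∧
    (∀ z < 8, τ.reg z = σ.reg z) ∧ (∀ a < sampleAddr n M, τ.mem a = σ.mem a) ∧
      τ.queries = σ.queries ∧ τ.time ≤ σ.time + 6 + k * 20) M ?_ ?_ ?_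
  · simp [Expr.eval, Expr.cost, h4]
    intro z hz
    simp [show z ≠ 8 by omega, show z ≠ 14 by omega]
  · rintro k τ ⟨hk, q8, q14, hs, hz, hm, hq, ht⟩ he
    have q4 := (hz 4 (by decide)).trans h4
    have q5 := (hz 5 (by decide)).trans h5
    simp only [Expr.eval, q4, q14] at he
    refine ⟨by omega, ?_⟩
    simp only [run_seq, run_set, run_store]
    simp [Expr.eval, Expr.cost, q5, q8, q14, hq]
    refine ⟨by omega, ?_, ?_, ?_, by omega⟩
    · intro t htk
      by_cases htk' : t = k
      · simp [htk']
      · simp [htk', hs t (by omega)]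
    · intro z hz8
      simp [show z ≠ 14 by omega, hz z hz8]
    · intro a ha
      simp [show a ≠ sampleAddr n M + 4 + k by omega, hm a ha]
  rintro k τ ⟨hk, q8, q14, hs, hz, hm, hq, ht⟩ he
  have q4 := (hz 4 (by decide)).trans h4
  have q5 := (hz 5 (by decide)).trans h5
  simp only [Expr.eval, q4, q14] at he
  obtain rfl : k = M := by omega
  refine run_loop (fun j τ => j ≤ I ∧ τ.reg 8 = k + 4 ∧ τ.reg 11 = j ∧
    τ.reg 9 = recAddr k (sampleAddr n k) j ∧
    τ.reg 10 = recAddr k (sampleAddr n k) (2 * r * j + 1) ∧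
    (∀ t < k, τ.mem (sampleAddr n k + 4 + t) = 1) ∧ SplitBelow n k r τ.mem j ∧
    (∀ z < 8, τ.reg z = σ.reg z) ∧ (∀ a < sampleAddr n k, τ.mem a = σ.mem a) ∧
      τ.queries = σ.queries ∧
      τ.time ≤ σ.time + 30 + k * 20 + j * (40 + r * (40 + k * 60))) I ?_ ?_ ?_
  · simp [Expr.eval, Expr.cost, q5, q8, hq, recAddr, SplitBelow]
    refine ⟨hs, fun z hz8 => ?_, hm, by omega⟩
    simp [show z ≠ 9 by omega, show z ≠ 10 by omega, show z ≠ 11 by omega, hz z hz8]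
  · rintro j τ ⟨hj, q8, q11, q9, q10, h1, hs, hz, hm, hq, ht⟩ he
    have q7 := (hz 7 (by decide)).trans h7
    simp only [Expr.eval, q7, q11] at he
    refine ⟨by omega, ?_⟩
    rw [run_seq]
    have hlt : ∀ i ≤ j, 0 < r → recAddr k (sampleAddr n k) i + (k + 4) ≤
        recAddr k (sampleAddr n k) (2 * r * j + 1) := by
      intro i hi h
      refine recAddr_le ?_
      have : 1 * j ≤ 2 * r * j := Nat.mul_le_mul_right _ (by omega)
      omega
    have hB := le_recAddr k (sampleAddr n k)
    have hVτ : ∀ v < r, τ.mem (2 * n + v) < n := fun v hv => by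
      rw [hm _ (by omega)]
      exact hV v hv
    refine (run_expand (n := n) (M := k) (r := r) (p := recAddr k (sampleAddr n k) j)
      (c := recAddr k (sampleAddr n k) (2 * r * j + 1))
      (τ.tick ((sub (reg 7) (reg 11)).cost + 1)) ((hz 0 (by decide)).trans h0)
      ((hz 4 (by decide)).trans h4) ((hz 6 (by decide)).trans h6) q8 q9 q10 (hB j) (hlt j le_rfl)
      hr hVτ).mono ?_
    rintro τ₁ ⟨hs1, p10, hz1, hm1, hq1, ht1⟩
    simp only [State.tick_reg, State.tick_mem, State.tick_queries, State.tick_time, Expr.cost]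
      at hz1 hm1 hq1 ht1
    have p8 := (hz1 8 (by decide) (by decide)).trans q8
    have p9 := (hz1 9 (by decide) (by decide)).trans q9
    have p11 := (hz1 11 (by decide) (by decide)).trans q11
    simp only [run_seq, run_set]
    simp only [Expr.eval, Expr.cost, State.tick_reg, State.tick_mem, State.setReg_reg,
      State.setReg_mem, State.tick_time, State.setReg_time, State.tick_queries,
      State.setReg_queries, p8, p9, p11, if_true]
    simp only [show (8 : ℕ) ≠ 9 by decide, show (8 : ℕ) ≠ 11 by decide,
      show (9 : ℕ) ≠ 11 by decide, show (10 : ℕ) ≠ 9 by decide, show (10 : ℕ) ≠ 11 by decide,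
      show (11 : ℕ) ≠ 9 by decide, if_false, p10, recAddr_succ]
    refine ⟨by omega, trivial, trivial, trivial, ?_, ?_, ?_, ?_, ?_, hq1.trans hq, ?_⟩
    · simp only [recAddr]
      ring
    · intro t ht
      have := hB (2 * r * j)
      rw [hm1 _ (by rw [recAddr_succ]; omega), h1 t ht]
    · intro i hi v hv
      by_cases hij : i = j
      · subst hij
        have := hs1 v hv
        rwa [show recAddr k (sampleAddr n k) (2 * r * i + 1) + 2 * v * (k + 4) =
          recAddr k (sampleAddr n k) (2 * r * i + 1 + 2 * v) by simp only [recAddr]; ring] at this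
      · have e1 : 2 * r * (i + 1) ≤ 2 * r * j := Nat.mul_le_mul_left _ (by omega)
        have e2 : 2 * r * (i + 1) = 2 * r * i + 2 * r := by ring
        have e3 := recAddr_le (M := k) (B := sampleAddr n k)
          (show 2 * r * i + 1 + 2 * v + 1 < 2 * r * j + 1 by omega)
        rw [recAddr_succ] at e3
        have e4 := hB (2 * r * j + 1)
        exact (hs i (by omega) v hv).congr hm1 (hlt i (by omega) (by omega)) (by omega)
          (by omega) e4 (hVτ v hv)
    · intro z hz8
      rw [if_neg (by omega), if_neg (by omega), hz1 z (by omega) (by omega), hz z hz8]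
    · intro a ha
      have := hB (2 * r * j + 1)
      rw [hm1 a (by omega), hm a ha]
    · have : (j + 1) * (40 + r * (40 + k * 60)) =
        j * (40 + r * (40 + k * 60)) + 40 + r * (40 + k * 60) := by ring
      omega
  · rintro j τ ⟨hj, q8, q11, q9, q10, h1, hs, hz, hm, hq, ht⟩ he
    have q7 := (hz 7 (by decide)).trans h7
    simp only [Expr.eval, q7, q11] at he
    obtain rfl : j = I := by omega
    exact ⟨h1, hs, q8, q9, q10, hz, hm, hq, by simp [Expr.cost]; omega⟩

end DTLearn

namespace DTLearn

open DTLearn.Expr DTLearn.Prog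

/-! ### The search for a consistent tree: choosing the trees -/

/-- Decide whether the samples at the record address in register `11` have a common label. -/
def leaf : Prog :=
  .set 12 (lit 0) ;; .set 13 (lit 0) ;; .set 14 (lit 0) ;;
  .set 15 (add (reg 0) (add (reg 0) (reg 0))) ;;
  .loop (sub (reg 4) (reg 14))
    (.cond (load (add (add (reg 11) (lit 4)) (reg 14)))
      (.cond (load (add (reg 15) (reg 0))) (.set 13 (lit 1)) (.set 12 (lit 1))) .skip ;;
    .set 15 (add (reg 15) (add (reg 0) (lit 1))) ;;
    .set 14 (add (reg 14) (lit 1))) ;;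
  -- Registers 12 and 13 tell whether label `0` and label `1` occur among the marked samples. If
  -- both occur, the bit stored here is meaningless, and the size $s+1$ written below plays the role
  -- of infinity.
  .store (reg 11) (sub (lit 1) (reg 12)) ;;
  .cond (reg 12)
    (.cond (reg 13) (.store (add (reg 11) (lit 3)) (add (reg 2) (lit 1)))
      (.store (add (reg 11) (lit 3)) (lit 1)))
    (.store (add (reg 11) (lit 3)) (lit 1))

/-- Do so at every node. -/
def leaves : Prog :=
  .set 11 (reg 5) ;;
  .loop (sub (reg 10) (reg 11)) (leaf ;; .set 11 (add (reg 11) (reg 8)))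

/-- Choose the best variable for the root of the tree at the record address in register `9`. -/
def improve : Prog :=
  .set 12 (reg 6) ;;
  .loop (reg 12)
    (.set 12 (sub (reg 12) (lit 1)) ;;
    .set 10 (sub (reg 10) (add (reg 8) (reg 8))) ;;
    .set 13 (add (load (add (reg 10) (lit 3))) (load (add (add (reg 10) (reg 8)) (lit 3)))) ;;
    .cond (sub (load (add (reg 9) (lit 3))) (reg 13))
      (.store (reg 9) (add (load (add (add (reg 0) (reg 0)) (reg 12))) (lit 2)) ;;
      .store (add (reg 9) (lit 1)) (reg 10) ;;
      .store (add (reg 9) (lit 2)) (add (reg 10) (reg 8)) ;;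
      .store (add (reg 9) (lit 3)) (reg 13))
      .skip)

/-- Do so at every internal node, from the last to the first, and output the tree at the root. -/
def choosing : Prog :=
  .loop (sub (reg 9) (reg 5)) (.set 9 (sub (reg 9) (reg 8)) ;; improve) ;;
  .set 0 (reg 5)

/-- All samples at the record address `p` have the label `b`. -/
def Pure (n M : ℕ) (mem : ℕ → ℕ) (p : ℕ) (b : Bool) : Prop :=
  ∀ t < M, mem (p + 4 + t) ≠ 0 → mem (sampleAddr n t + n) = b.toNat

/-- The record at address `p` holds a leaf if its samples have a common label. -/
def LeafAt (n M s : ℕ) (mem : ℕ → ℕ) (p : ℕ) : Prop :=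
  (mem (p + 3) = 1 ∧ ∃ b : Bool, mem p = b.toNat ∧ Pure n M mem p b) ∨
    (mem (p + 3) = s + 1 ∧ ∀ b, ¬ Pure n M mem p b)

variable {n : ℕ} {f : Cube n → Bool} {ω : ℕ → Bool} {M B d s r : ℕ}

theorem Pure.congr {mem mem' : ℕ → ℕ} {p : ℕ} {b : Bool} (h : Pure n M mem p b)
    (hm : ∀ t < M, mem' (p + 4 + t) = mem (p + 4 + t))
    (hy : ∀ t < M, mem' (sampleAddr n t + n) = mem (sampleAddr n t + n)) :
    Pure n M mem' p b := by
  intro t ht h1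
  rw [hy t ht]
  rw [hm t ht] at h1
  exact h t ht h1

theorem LeafAt.congr {mem mem' : ℕ → ℕ} {p : ℕ} (h : LeafAt n M s mem p)
    (hm : ∀ i < M + 4, mem' (p + i) = mem (p + i))
    (hy : ∀ t < M, mem' (sampleAddr n t + n) = mem (sampleAddr n t + n)) :
    LeafAt n M s mem' p := by
  have hm' : ∀ t < M, mem' (p + 4 + t) = mem (p + 4 + t) := fun t ht => by
    simpa [add_assoc] using hm (4 + t) (by omega)
  have h0 : mem' p = mem p := hm 0 (by omega)
  unfold LeafAt
  rw [h0, hm 3 (by omega)]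
  rcases h with ⟨h1, b, h2, h3⟩ | ⟨h1, h2⟩
  · exact Or.inl ⟨h1, b, h2, h3.congr hm' hy⟩
  · exact Or.inr ⟨h1, fun b hb => h2 b
      (hb.congr (fun t ht => (hm' t ht).symm) fun t ht => (hy t ht).symm)⟩

theorem run_leaf {p : ℕ} (σ : State) (h0 : σ.reg 0 = n) (h2 : σ.reg 2 = s) (h4 : σ.reg 4 = M)
    (h11 : σ.reg 11 = p) (hp : sampleAddr n M ≤ p)
    (hy : ∀ t < M, σ.mem (sampleAddr n t + n) ≤ 1) :
    Run f ω leaf σ fun τ => LeafAt n M s τ.mem p ∧ (∀ z < 12, τ.reg z = σ.reg z) ∧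
      (∀ a, a ≠ p → a ≠ p + 3 → τ.mem a = σ.mem a) ∧ τ.queries = σ.queries ∧
      τ.time ≤ σ.time + 50 + M * 40 := by
  have hS0 : 3 * n ≤ sampleAddr n M := Nat.le_add_right _ _
  unfold leaf
  simp only [run_seq, run_set]
  refine run_loop (fun k τ => k ≤ M ∧ τ.reg 14 = k ∧ τ.reg 15 = sampleAddr n k ∧
    ((τ.reg 12 = 0 ∧ ∀ t < k, σ.mem (p + 4 + t) ≠ 0 → σ.mem (sampleAddr n t + n) ≠ 0) ∨
      (τ.reg 12 = 1 ∧ ∃ t < k, σ.mem (p + 4 + t) ≠ 0 ∧ σ.mem (sampleAddr n t + n) = 0)) ∧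
    ((τ.reg 13 = 0 ∧ ∀ t < k, σ.mem (p + 4 + t) ≠ 0 → σ.mem (sampleAddr n t + n) = 0) ∨
      (τ.reg 13 = 1 ∧ ∃ t < k, σ.mem (p + 4 + t) ≠ 0 ∧ σ.mem (sampleAddr n t + n) ≠ 0)) ∧
    (∀ z < 12, τ.reg z = σ.reg z) ∧ τ.mem = σ.mem ∧ τ.queries = σ.queries ∧
      τ.time ≤ σ.time + 15 + k * 40) M ?_ ?_ ?_
  · simp [Expr.eval, Expr.cost, h0, sampleAddr]
    refine ⟨by ring, fun z hz => ?_⟩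
    simp [show z ≠ 12 by omega, show z ≠ 13 by omega, show z ≠ 14 by omega, show z ≠ 15 by omega]
  · rintro k τ ⟨hk, q14, q15, q12, q13, hz, hm, hq, ht⟩ he
    have q0 := (hz 0 (by decide)).trans h0
    have q4 := (hz 4 (by decide)).trans h4
    have q11 := (hz 11 (by decide)).trans h11
    simp only [Expr.eval, q4, q14] at he
    have hkM : k < M := by omega
    refine ⟨hkM, ?_⟩
    have hstep : ∀ {P : ℕ → Prop}, (∀ t < k, P t) → P k → ∀ t < k + 1, P t := by
      intro P h1 h2 t ht
      rcases Nat.lt_succ_iff_lt_or_eq.1 ht with h | rfl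
      · exact h1 t h
      · exact h2
    have hex : ∀ {P : ℕ → Prop}, (∃ t < k, P t) → ∃ t < k + 1, P t := by
      rintro P ⟨t, h1, h2⟩
      exact ⟨t, by omega, h2⟩
    simp only [run_seq, run_set, run_cond, run_skip]
    simp only [Expr.eval, Expr.cost, State.tick_reg, State.tick_mem, State.setReg_reg,
      State.setReg_mem, State.tick_time, State.setReg_time, State.tick_queries,
      State.setReg_queries, q0, q11, q14, q15, hm, if_true]
    norm_num only [q0, q14, q15, sampleAddr_succ, if_true, if_false]
    refine ⟨fun h1 => ⟨fun h2 => ⟨by omega, trivial, trivial, ?_, ?_, ?_, trivial, hq, by omega⟩,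
      fun h2 => ⟨by omega, trivial, trivial, ?_, ?_, ?_, trivial, hq, by omega⟩⟩,
      fun h1 => ⟨by omega, trivial, trivial, ?_, ?_, ?_, trivial, hq, by omega⟩⟩
    · exact q12.imp (fun h => ⟨h.1, hstep h.2 fun _ => h2⟩) fun h => ⟨h.1, hex h.2⟩
    · exact Or.inr ⟨trivial, k, by omega, h1, h2⟩
    · intro z hz12
      rw [if_neg (by omega), if_neg (by omega), if_neg (by omega), hz z hz12]
    · exact Or.inr ⟨trivial, k, by omega, h1, h2⟩
    · exact q13.imp (fun h => ⟨h.1, hstep h.2 fun _ => h2⟩) fun h => ⟨h.1, hex h.2⟩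
    · intro z hz12
      rw [if_neg (by omega), if_neg (by omega), if_neg (by omega), hz z hz12]
    · exact q12.imp (fun h => ⟨h.1, hstep h.2 fun h' => absurd h1 h'⟩) fun h => ⟨h.1, hex h.2⟩
    · exact q13.imp (fun h => ⟨h.1, hstep h.2 fun h' => absurd h1 h'⟩) fun h => ⟨h.1, hex h.2⟩
    · intro z hz12
      rw [if_neg (by omega), if_neg (by omega), hz z hz12]
  · rintro k τ ⟨hk, q14, q15, q12, q13, hz, hm, hq, ht⟩ he
    have q2 := (hz 2 (by decide)).trans h2
    have q4 := (hz 4 (by decide)).trans h4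
    have q11 := (hz 11 (by decide)).trans h11
    simp only [Expr.eval, q4, q14] at he
    obtain rfl : k = M := by omega
    -- All branches overwrite only the cells `p` and `p + 3`; the marks start at `p + 4` and the
    -- labels lie before `p`.
    have hframe : ∀ u v : ℕ,
        let mem' := fun a => if a = p + 3 then v else if a = p then u else σ.mem a
        (∀ t < k, mem' (p + 4 + t) = σ.mem (p + 4 + t)) ∧
        (∀ t < k, mem' (sampleAddr n t + n) = σ.mem (sampleAddr n t + n)) ∧
        (∀ a, a ≠ p → a ≠ p + 3 → mem' a = σ.mem a) := by
      intro u v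
      refine ⟨fun t ht => ?_, fun t ht => ?_, fun a h1 h2 => ?_⟩
      · simp only []
        rw [if_neg (by omega), if_neg (by omega)]
      · have := sampleAddr_lt (n := n) ht
        simp only []
        rw [if_neg (by omega), if_neg (by omega)]
      · simp [h1, h2]
    simp only [run_store, run_cond]
    simp only [Expr.eval, Expr.cost, State.tick_reg, State.tick_mem, State.setMem_reg,
      State.tick_time, State.setMem_time, State.tick_queries, State.setMem_queries, q11, q2]
    have hval : ∀ u v : ℕ, ((u = 1 ∧ Pure n k σ.mem p true ∧ v = 1) ∨
        (u = 0 ∧ Pure n k σ.mem p false ∧ v = 1) ∨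
        (v = s + 1 ∧ ∀ b, ¬ Pure n k σ.mem p b)) →
        LeafAt n k s (fun a => if a = p + 3 then v else if a = p then u else σ.mem a) p := by
      intro u v h
      obtain ⟨f1, f2, -⟩ := hframe u v
      rcases h with ⟨hu, hP, hv⟩ | ⟨hu, hP, hv⟩ | ⟨hv, hP⟩
      · exact Or.inl ⟨by simpa using hv, true, by simpa using hu, hP.congr f1 f2⟩
      · exact Or.inl ⟨by simpa using hv, false, by simpa using hu, hP.congr f1 f2⟩
      · exact Or.inr ⟨by simpa using hv, fun b hb => hP b
          (hb.congr (fun t ht => (f1 t ht).symm) fun t ht => (f2 t ht).symm)⟩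
    have hpure1 : τ.reg 12 = 0 → Pure n k σ.mem p true := by
      intro h t ht h1
      rcases q12 with ⟨-, h3⟩ | ⟨h3, -⟩
      · have := h3 t ht h1
        have := hy t ht
        simp
        omega
      · omega
    have hpure0 : τ.reg 13 = 0 → Pure n k σ.mem p false := by
      intro h t ht h1
      rcases q13 with ⟨-, h3⟩ | ⟨h3, -⟩
      · exact h3 t ht h1
      · omega
    have hnot1 : τ.reg 12 ≠ 0 → ¬ Pure n k σ.mem p true := by
      intro h hP
      rcases q12 with ⟨h3, -⟩ | ⟨-, t, ht, h3, h4⟩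
      · exact h h3
      · have := hP t ht h3
        simp [h4] at this
    have hnot0 : τ.reg 13 ≠ 0 → ¬ Pure n k σ.mem p false := by
      intro h hP
      rcases q13 with ⟨h3, -⟩ | ⟨-, t, ht, h3, h4⟩
      · exact h h3
      · exact h4 (hP t ht h3)
    have hres : ∀ v, ((τ.reg 12 = 0 ∧ v = 1) ∨ (τ.reg 12 ≠ 0 ∧ τ.reg 13 = 0 ∧ v = 1) ∨
        (τ.reg 12 ≠ 0 ∧ τ.reg 13 ≠ 0 ∧ v = s + 1)) →
        LeafAt n k s
          (fun a => if a = p + 3 then v else if a = p then 1 - τ.reg 12 else σ.mem a) p := by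
      intro v h
      apply hval
      rcases h with ⟨h1, h2⟩ | ⟨h1, h2, h3⟩ | ⟨h1, h2, h3⟩
      · exact Or.inl ⟨by omega, hpure1 h1, h2⟩
      · exact Or.inr (Or.inl ⟨by omega, hpure0 h2, h3⟩)
      · refine Or.inr (Or.inr ⟨h3, fun b => ?_⟩)
        cases b
        · exact hnot0 h2
        · exact hnot1 h1
    have hfin : ∀ (μ : ℕ → ℕ) v T, (∀ a, μ a =
        if a = p + 3 then v else if a = p then 1 - τ.reg 12 else σ.mem a) →
        ((τ.reg 12 = 0 ∧ v = 1) ∨ (τ.reg 12 ≠ 0 ∧ τ.reg 13 = 0 ∧ v = 1) ∨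
        (τ.reg 12 ≠ 0 ∧ τ.reg 13 ≠ 0 ∧ v = s + 1)) → T ≤ τ.time + 30 →
        LeafAt n k s μ p ∧ (∀ z < 12, τ.reg z = σ.reg z) ∧
      (∀ a, a ≠ p → a ≠ p + 3 → μ a = σ.mem a) ∧ τ.queries = σ.queries ∧
      T ≤ σ.time + 50 + k * 40 := by
      intro μ v T h1 h2 h5
      refine ⟨?_, hz, fun a ha ha' => by rw [h1, if_neg ha', if_neg ha], hq, by omega⟩
      rw [show μ = _ from funext h1]
      exact hres v h2
    refine ⟨fun h1 => ⟨fun h2 => hfin _ (s + 1) _ (fun a => ?_) ?_ ?_,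
      fun h2 => hfin _ 1 _ (fun a => ?_) ?_ ?_⟩, fun h1 => hfin _ 1 _ (fun a => ?_) ?_ ?_⟩
    · simp [hm]
    · exact Or.inr (Or.inr ⟨h1, h2, rfl⟩)
    · omega
    · simp [hm]
    · exact Or.inr (Or.inl ⟨h1, h2, rfl⟩)
    · omega
    · simp [hm]
    · exact Or.inl ⟨h1, rfl⟩
    · omega

theorem run_leaves {J : ℕ} (σ : State) (h0 : σ.reg 0 = n) (h2 : σ.reg 2 = s) (h4 : σ.reg 4 = M)
    (h5 : σ.reg 5 = sampleAddr n M) (h8 : σ.reg 8 = M + 4)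
    (h10 : σ.reg 10 = recAddr M (sampleAddr n M) J)
    (hy : ∀ t < M, σ.mem (sampleAddr n t + n) ≤ 1) :
    Run f ω leaves σ fun τ =>
      (∀ j < J, LeafAt n M s τ.mem (recAddr M (sampleAddr n M) j)) ∧
      (∀ z < 11, τ.reg z = σ.reg z) ∧ (∀ a < sampleAddr n M, τ.mem a = σ.mem a) ∧
      (∀ j i, i < M → τ.mem (recAddr M (sampleAddr n M) j + 4 + i) =
        σ.mem (recAddr M (sampleAddr n M) j + 4 + i)) ∧
      τ.queries = σ.queries ∧ τ.time ≤ σ.time + 10 + J * (60 + M * 40) := by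
  have hB := le_recAddr M (sampleAddr n M)
  unfold leaves
  simp only [run_seq, run_set]
  refine run_loop (fun k τ => k ≤ J ∧ τ.reg 11 = recAddr M (sampleAddr n M) k ∧
      (∀ j < k, LeafAt n M s τ.mem (recAddr M (sampleAddr n M) j)) ∧
      (∀ z < 11, τ.reg z = σ.reg z) ∧ (∀ a < sampleAddr n M, τ.mem a = σ.mem a) ∧
      (∀ j i, i < M → τ.mem (recAddr M (sampleAddr n M) j + 4 + i) =
        σ.mem (recAddr M (sampleAddr n M) j + 4 + i)) ∧
      τ.queries = σ.queries ∧ τ.time ≤ σ.time + 4 + k * (60 + M * 40)) J ?_ ?_ ?_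
  · simp [Expr.eval, Expr.cost, h5, recAddr_zero]
    intro z hz
    simp [show z ≠ 11 by omega]
  · rintro k τ ⟨hk, q11, hl, hz, hm, hmask, hq, ht⟩ he
    have q10 := (hz 10 (by decide)).trans h10
    simp only [Expr.eval, q10, q11] at he
    have hkJ : k < J := by
      rcases hk.lt_or_eq with h | rfl
      · exact h
      · omega
    refine ⟨hkJ, ?_⟩
    have hyτ : ∀ t < M, τ.mem (sampleAddr n t + n) ≤ 1 := fun t ht => by
      rw [hm _ (sampleAddr_lt ht)]
      exact hy t ht
    rw [run_seq]
    refine (run_leaf (s := s) (τ.tick ((sub (reg 10) (reg 11)).cost + 1))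
      ((hz 0 (by decide)).trans h0) ((hz 2 (by decide)).trans h2) ((hz 4 (by decide)).trans h4)
      q11 (hB k) hyτ).mono ?_
    rintro τ₁ ⟨hl1, hz1, hm1, hq1, ht1⟩
    simp only [State.tick_reg, State.tick_mem, State.tick_queries, State.tick_time, Expr.cost]
      at hz1 hm1 hq1 ht1
    have p11 := (hz1 11 (by decide)).trans q11
    have p8 := (hz1 8 (by decide)).trans ((hz 8 (by decide)).trans h8)
    -- Only the cells with offsets 0 and 3 of record `k` have changed, so the other records and all
    -- marks are intact.
    have hoff : ∀ j i, i < M + 4 → (j = k → 4 ≤ i) →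
        τ₁.mem (recAddr M (sampleAddr n M) j + i) = τ.mem (recAddr M (sampleAddr n M) j + i) := by
      intro j i hi hji
      apply hm1
      all_goals
        rcases lt_trichotomy j k with h | h | h
        · have := recAddr_le (M := M) (B := sampleAddr n M) h
          omega
        · have := hji h
          subst h
          omega
        · have := recAddr_le (M := M) (B := sampleAddr n M) h
          omega
    rw [run_set]
    simp only [Expr.eval, Expr.cost, State.tick_reg, State.tick_mem, State.setReg_reg,
      State.setReg_mem, State.tick_time, State.setReg_time, State.tick_queries,
      State.setReg_queries, p8, p11, if_true, recAddr_succ]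
    refine ⟨by omega, trivial, ?_, ?_, ?_, ?_, hq1.trans hq, ?_⟩
    · intro j hj
      by_cases hjk : j = k
      · subst hjk
        exact hl1
      · refine (hl j (by omega)).congr (fun i hi => hoff j i hi fun h => absurd h hjk) ?_
        intro t ht
        have := sampleAddr_lt (n := n) ht
        have := hB k
        exact hm1 _ (by omega) (by omega)
    · intro z hz11
      rw [if_neg (by omega), hz1 z (by omega), hz z hz11]
    · intro a ha
      have := hB k
      rw [hm1 a (by omega) (by omega), hm a ha]
    · intro j i hi
      rw [add_assoc, hoff j (4 + i) (by omega) (by omega), ← add_assoc, hmask j i hi]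
    · have : (k + 1) * (60 + M * 40) = k * (60 + M * 40) + 60 + M * 40 := by ring
      omega
  · rintro k τ ⟨hk, q11, hl, hz, hm, hmask, hq, ht⟩ he
    have q10 := (hz 10 (by decide)).trans h10
    simp only [Expr.eval, q10, q11] at he
    obtain rfl : k = J := by
      rcases hk.lt_or_eq with h | rfl
      · have := recAddr_le (M := M) (B := sampleAddr n M) h
        omega
      · rfl
    exact ⟨hl, hz, hm, hmask, hq, by simp [Expr.cost]; omega⟩

end DTLearn

/-! ### Choosing the best variable at every node -/

namespace DTLearn

open DTLearn.Expr DTLearn.Prog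

/-- The record at address `p` holds a node labeled with the variable in position `v` of the list,
whose children are the records at address `c` and the next one. -/
def ChoiceAt (n M : ℕ) (mem : ℕ → ℕ) (p c v : ℕ) : Prop :=
  mem p = mem (2 * n + v) + 2 ∧ mem (p + 1) = c ∧ mem (p + 2) = c + (M + 4) ∧
    mem (p + 3) = mem (c + 3) + mem (c + (M + 4) + 3)

/-- The record at address `p` holds the best tree that can be made of the trees in the records from
address `c` on. -/
def NodeAt (n M s r : ℕ) (mem : ℕ → ℕ) (p c : ℕ) : Prop :=
  (LeafAt n M s mem p ∨ ∃ v < r, ChoiceAt n M mem p (c + 2 * v * (M + 4)) v) ∧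
    (∀ b, Pure n M mem p b → mem (p + 3) ≤ 1) ∧
    ∀ v < r, mem (p + 3) ≤
      mem (c + 2 * v * (M + 4) + 3) + mem (c + 2 * v * (M + 4) + (M + 4) + 3)

variable {n : ℕ} {f : Cube n → Bool} {ω : ℕ → Bool} {M B d s r : ℕ}

theorem LeafAt.pure_size {mem : ℕ → ℕ} {p : ℕ} (h : LeafAt n M s mem p) (b : Bool)
    (hb : Pure n M mem p b) : mem (p + 3) ≤ 1 := by
  rcases h with ⟨h, -⟩ | ⟨-, h⟩
  · exact h.le
  · exact absurd hb (h b)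

/-- Nodes are finished from the last to the first, so later writes fall between the samples and `p`,
whereas the record and its children lie at or after `p`. -/
theorem NodeAt.congr {mem mem' : ℕ → ℕ} {p c : ℕ} (h : NodeAt n M s r mem p c)
    (hm : ∀ a, a < sampleAddr n M ∨ p ≤ a → mem' a = mem a) (hr : r ≤ n) (hc : 0 < r → p ≤ c) :
    NodeAt n M s r mem' p c := by
  have hS0 : 3 * n ≤ sampleAddr n M := Nat.le_add_right _ _
  obtain ⟨h1, h2, h3⟩ := h
  have hy : ∀ t < M, mem' (sampleAddr n t + n) = mem (sampleAddr n t + n) := fun t ht =>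
    hm _ (Or.inl (sampleAddr_lt ht))
  refine ⟨?_, fun b hb => ?_, fun v hv => ?_⟩
  · rcases h1 with h1 | ⟨v, hv, e1, e2, e3, e4⟩
    · exact Or.inl (h1.congr (fun i hi => hm _ (by omega)) hy)
    · have := hc (by omega)
      refine Or.inr ⟨v, hv, ?_⟩
      unfold ChoiceAt
      rw [hm p (by omega), hm (2 * n + v) (by omega), hm (p + 1) (by omega), hm (p + 2) (by omega),
        hm (p + 3) (by omega), hm _ (by omega), hm _ (by omega)]
      exact ⟨e1, e2, e3, e4⟩
  · rw [hm _ (by omega)]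
    exact h2 b (hb.congr (fun t ht => (hm _ (by omega)).symm) fun t ht => (hy t ht).symm)
  · have := hc (by omega)
    rw [hm (p + 3) (by omega), hm _ (by omega), hm _ (by omega)]
    exact h3 v hv

theorem SplitBelow.congr {mem mem' : ℕ → ℕ} {I : ℕ} (h : SplitBelow n M r mem I)
    (hm : ∀ a < sampleAddr n M, mem' a = mem a)
    (hmask : ∀ j i, i < M → mem' (recAddr M (sampleAddr n M) j + 4 + i) =
      mem (recAddr M (sampleAddr n M) j + 4 + i)) (hr : r ≤ n)
    (hV : ∀ v < r, mem (2 * n + v) < n) :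
    SplitBelow n M r mem' I := by
  have hS0 : 3 * n ≤ sampleAddr n M := Nat.le_add_right _ _
  intro j hj v hv t ht
  have := sampleAddr_lt (n := n) ht
  have := hV v hv
  have h2 := hmask (2 * r * j + 1 + 2 * v + 1) t ht
  rw [recAddr_succ] at h2
  rw [hm (2 * n + v) (by omega), hm (sampleAddr n t + mem (2 * n + v)) (by omega), hmask _ _ ht,
    hmask _ _ ht, h2]
  exact h j hj v hv t ht

/-- Register 10 walks backwards through the children and stops at `c`, which is just where the
children of the preceding node end. So the variables are tried in decreasing order, and after `k`
rounds the minimum covers those with `r - k ≤ v`. -/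
theorem run_improve {p c : ℕ} (σ : State) (h0 : σ.reg 0 = n) (h6 : σ.reg 6 = r)
    (h8 : σ.reg 8 = M + 4) (h9 : σ.reg 9 = p) (h10 : σ.reg 10 = c + 2 * r * (M + 4))
    (hp : sampleAddr n M ≤ p) (hc : 0 < r → p + (M + 4) ≤ c) (hr : r ≤ n)
    (hl : LeafAt n M s σ.mem p) :
    Run f ω improve σ fun τ => NodeAt n M s r τ.mem p c ∧ τ.reg 10 = c ∧
      (∀ z < 12, z ≠ 10 → τ.reg z = σ.reg z) ∧
      (∀ a, a < p ∨ p + 4 ≤ a → τ.mem a = σ.mem a) ∧ τ.queries = σ.queries ∧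
      τ.time ≤ σ.time + 10 + r * 80 := by
  have hS0 : 3 * n ≤ sampleAddr n M := Nat.le_add_right _ _
  unfold improve
  simp only [run_seq, run_set]
  refine run_loop (fun k τ => k ≤ r ∧ τ.reg 12 = r - k ∧ τ.reg 10 = c + 2 * (r - k) * (M + 4) ∧
    (LeafAt n M s τ.mem p ∨ ∃ v < r, ChoiceAt n M τ.mem p (c + 2 * v * (M + 4)) v) ∧
    τ.mem (p + 3) ≤ σ.mem (p + 3) ∧
    (∀ v < r, r - k ≤ v → τ.mem (p + 3) ≤
      σ.mem (c + 2 * v * (M + 4) + 3) + σ.mem (c + 2 * v * (M + 4) + (M + 4) + 3)) ∧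
    (∀ z < 12, z ≠ 10 → τ.reg z = σ.reg z) ∧
    (∀ a, a < p ∨ p + 4 ≤ a → τ.mem a = σ.mem a) ∧ τ.queries = σ.queries ∧
    τ.time ≤ σ.time + 4 + k * 80) r ?_ ?_ ?_
  · simp [Expr.eval, Expr.cost, h6, h10]
    refine ⟨Or.inl hl, fun v h1 h2 => by omega, fun z hz _ => ?_⟩
    simp [show z ≠ 12 by omega]
  · rintro k τ ⟨hk, q12, q10, hch, hle, hmin, hz, hm, hq, ht⟩ he
    have q0 := (hz 0 (by decide) (by decide)).trans h0
    have q8 := (hz 8 (by decide) (by decide)).trans h8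
    have q9 := (hz 9 (by decide) (by decide)).trans h9
    simp only [Expr.eval, q12] at he
    have hkr : k < r := by omega
    refine ⟨hkr, ?_⟩
    have hc := hc (by omega)
    obtain ⟨v, hv⟩ : ∃ v, r - k = v + 1 := ⟨r - k - 1, by omega⟩
    rw [hv] at q12 q10
    have e1 : c + 2 * (v + 1) * (M + 4) - (M + 4 + (M + 4)) = c + 2 * v * (M + 4) := by
      rw [show c + 2 * (v + 1) * (M + 4) = c + 2 * v * (M + 4) + (M + 4 + (M + 4)) by ring]
      omega
    have e2 : r - (k + 1) = v := by omega
    generalize hcv : c + 2 * v * (M + 4) = cv at e1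
    have hccv : c ≤ cv := by omega
    simp only [run_seq, run_set, run_cond, run_skip, run_store]
    simp only [Expr.eval, Expr.cost, State.tick_reg, State.tick_mem, State.setReg_reg,
      State.setReg_mem, State.setMem_reg, State.tick_time, State.setReg_time, State.setMem_time,
      State.tick_queries,
      State.setReg_queries, State.setMem_queries, State.setMem_mem, q0, q8, q9, q10, q12, if_true]
    norm_num only [q0, q8, q9, q10, q12, if_true, if_false, e1, e2]
    simp only [Nat.add_sub_cancel, hm (cv + 3) (by omega), hm (cv + (M + 4) + 3) (by omega)]
    have hvr : v < r := by omega
    have hzz : ∀ a b, ∀ z < 12, z ≠ 10 →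
        (if z = 13 then a else if z = 10 then cv else if z = 12 then b else τ.reg z) = σ.reg z := by
      intro a b z h1 h2
      rw [if_neg (by omega), if_neg h2, if_neg (by omega), hz z h1 h2]
    have hcase : ∀ μ : ℕ, μ ≤ τ.mem (p + 3) →
        μ ≤ σ.mem (cv + 3) + σ.mem (cv + (M + 4) + 3) →
        ∀ w < r, v ≤ w → μ ≤
      σ.mem (c + 2 * w * (M + 4) + 3) + σ.mem (c + 2 * w * (M + 4) + (M + 4) + 3) := by
      intro μ h1 h2 w h3 h4
      rcases h4.eq_or_lt with rfl | h4
      · rw [hcv]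
        exact h2
      · exact h1.trans (hmin w h3 (by omega))
    have hne1 : ∀ a, a < p ∨ p + 4 ≤ a → ∀ u1 u2 u3 u4 : ℕ,
        (if a = p + 3 then u4 else if a = p + 2 then u3 else if a = p + 1 then u2 else
          if a = p then u1 else τ.mem a) = σ.mem a := by
      intro a ha u1 u2 u3 u4
      rw [if_neg (by omega), if_neg (by omega), if_neg (by omega), if_neg (by omega), hm a ha]
    constructor
    · intro hlt
      have hlt' : σ.mem (cv + 3) + σ.mem (cv + (M + 4) + 3) < τ.mem (p + 3) := by omega
      refine ⟨by omega, trivial, hcv.symm, Or.inr ⟨v, hvr, ?_⟩, ?_, hcase _ ?_ ?_, hzz _ _, ?_, hq,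
        by omega⟩
      · rw [hcv]
        simp only [ChoiceAt, State.setMem_mem, State.tick_mem, State.setReg_mem]
        rw [hne1 _ (by omega), hne1 _ (by omega), hne1 _ (by omega), hm _ (by omega)]
        simp [two_mul]
      · omega
      · omega
      · exact le_rfl
      · intro a ha
        exact hne1 a ha _ _ _ _
    · intro hge
      exact ⟨by omega, trivial, hcv.symm, hch, hle, hcase _ le_rfl (by omega), hzz _ _, hm, hq,
        by omega⟩
  · rintro k τ ⟨hk, q12, q10, hch, hle, hmin, hz, hm, hq, ht⟩ he
    simp only [Expr.eval, q12] at he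
    obtain rfl : k = r := by omega
    refine ⟨⟨hch, fun b hb => ?_, fun v hv => ?_⟩, by simpa using q10, hz, hm, hq,
      by simp [Expr.cost]; omega⟩
    · refine hle.trans (hl.pure_size b (Pure.congr hb (fun t ht => ?_) fun t ht => ?_))
      · exact (hm _ (by omega)).symm
      · have := sampleAddr_lt (n := n) ht
        exact (hm _ (by omega)).symm
    · have := hc (by omega)
      simp only [State.tick_mem]
      rw [hm (c + 2 * v * (M + 4) + 3) (by omega),
        hm (c + 2 * v * (M + 4) + (M + 4) + 3) (by omega)]
      exact hmin v hv (by omega)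

/-- For `0 < r` children have larger numbers than their parents, so in decreasing order every node
finds the best sizes of its children settled. The records from `I` on keep the leaves they received
before. -/
theorem run_choosing {I : ℕ} (σ : State) (h0 : σ.reg 0 = n) (h5 : σ.reg 5 = sampleAddr n M)
    (h6 : σ.reg 6 = r) (h8 : σ.reg 8 = M + 4) (h9 : σ.reg 9 = recAddr M (sampleAddr n M) I)
    (h10 : σ.reg 10 = recAddr M (sampleAddr n M) (2 * r * I + 1)) (hr : r ≤ n)
    -- The `2 * r * I + 1` records must contain the `I` internal ones; for `r = 0` this is not
    -- automatic.
    (hI : r = 0 → I ≤ 1)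
    (hl : ∀ j < 2 * r * I + 1, LeafAt n M s σ.mem (recAddr M (sampleAddr n M) j)) :
    Run f ω choosing σ fun τ =>
      (∀ j < I, NodeAt n M s r τ.mem (recAddr M (sampleAddr n M) j)
        (recAddr M (sampleAddr n M) (2 * r * j + 1))) ∧
      (∀ j < 2 * r * I + 1, I ≤ j → LeafAt n M s τ.mem (recAddr M (sampleAddr n M) j)) ∧
      τ.reg 0 = sampleAddr n M ∧ (∀ a < sampleAddr n M, τ.mem a = σ.mem a) ∧
      (∀ j i, i < M → τ.mem (recAddr M (sampleAddr n M) j + 4 + i) =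
        σ.mem (recAddr M (sampleAddr n M) j + 4 + i)) ∧
      τ.queries = σ.queries ∧ τ.time ≤ σ.time + 10 + I * (30 + r * 80) := by
  have hB := le_recAddr M (sampleAddr n M)
  unfold choosing
  rw [run_seq]
  refine run_loop (fun k τ => k ≤ I ∧ τ.reg 9 = recAddr M (sampleAddr n M) (I - k) ∧
      τ.reg 10 = recAddr M (sampleAddr n M) (2 * r * (I - k) + 1) ∧
      (∀ j < I, I - k ≤ j → NodeAt n M s r τ.mem (recAddr M (sampleAddr n M) j)
        (recAddr M (sampleAddr n M) (2 * r * j + 1))) ∧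
      (∀ j < 2 * r * I + 1, j < I - k ∨ I ≤ j →
        LeafAt n M s τ.mem (recAddr M (sampleAddr n M) j)) ∧
      (∀ z < 9, τ.reg z = σ.reg z) ∧ (∀ a < sampleAddr n M, τ.mem a = σ.mem a) ∧
      (∀ j i, i < M → τ.mem (recAddr M (sampleAddr n M) j + 4 + i) =
        σ.mem (recAddr M (sampleAddr n M) j + 4 + i)) ∧
      τ.queries = σ.queries ∧ τ.time ≤ σ.time + k * (30 + r * 80)) I ?_ ?_ ?_
  · refine ⟨by omega, h9, h10, fun j h1 h2 => by omega, fun j h1 _ => hl j h1, fun _ _ => rfl,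
      fun _ _ => rfl, fun _ _ _ => rfl, rfl, by omega⟩
  · rintro k τ ⟨hk, q9, q10, hnode, hleaf, hz, hm, hmask, hq, ht⟩ he
    have q0 := (hz 0 (by decide)).trans h0
    have q5 := (hz 5 (by decide)).trans h5
    have q6 := (hz 6 (by decide)).trans h6
    have q8 := (hz 8 (by decide)).trans h8
    simp only [Expr.eval, q9, q5] at he
    have hkI : k < I := by
      rcases hk.lt_or_eq with h | rfl
      · exact h
      · simp [recAddr_zero] at he
    refine ⟨hkI, ?_⟩
    obtain ⟨j, hj⟩ : ∃ j, I - k = j + 1 := ⟨I - k - 1, by omega⟩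
    have hj' : I - (k + 1) = j := by omega
    rw [hj] at q9 q10 hnode hleaf
    rw [recAddr_succ] at q9
    have hjJ : j < 2 * r * I + 1 := by
      rcases Nat.eq_zero_or_pos r with h | h
      · have := hI h
        omega
      · have : 1 * I ≤ 2 * r * I := Nat.mul_le_mul_right _ (by omega)
        omega
    have hlt : ∀ i, 0 < r → recAddr M (sampleAddr n M) i + (M + 4) ≤
        recAddr M (sampleAddr n M) (2 * r * i + 1) := by
      intro i h
      refine recAddr_le ?_
      have : 1 * i ≤ 2 * r * i := Nat.mul_le_mul_right _ (by omega)
      omega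
    simp only [run_seq, run_set]
    refine (run_improve (n := n) (M := M) (s := s) (r := r) (p := recAddr M (sampleAddr n M) j)
      (c := recAddr M (sampleAddr n M) (2 * r * j + 1)) _ (by simpa using q0) (by simpa using q6)
      (by simpa using q8) (by simp [Expr.eval, q9, q8]) ?_ (hB j) (hlt j) hr
      (by simpa using hleaf j hjJ (by omega))).mono ?_
    · simp only [State.tick_reg, State.setReg_reg]
      rw [if_neg (by decide), q10]
      simp only [recAddr]
      ring
    rintro τ₁ ⟨hn1, p10, hz1, hm1, hq1, ht1⟩
    simp only [State.tick_reg, State.tick_mem, State.tick_queries, State.tick_time, Expr.cost,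
      State.setReg_reg, State.setReg_mem, State.setReg_queries, State.setReg_time, Expr.eval]
      at hz1 hm1 hq1 ht1
    have p9 := hz1 9 (by decide) (by decide)
    rw [if_pos rfl, q9, q8, Nat.add_sub_cancel] at p9
    rw [hj']
    refine ⟨by omega, p9, p10, ?_, ?_, ?_, ?_, ?_, hq1.trans hq, ?_⟩
    · intro i hiI hi
      rcases hi.eq_or_lt with rfl | hi
      · exact hn1
      · have := recAddr_le (M := M) (B := sampleAddr n M) hi
        have := hB j
        refine (hnode i hiI hi).congr (fun a ha => hm1 a (by omega)) hr fun h => ?_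
        have := hlt i h
        omega
    · intro i hiJ hi
      refine (hleaf i hiJ (by omega)).congr (fun a ha => hm1 _ ?_) fun t ht => hm1 _ ?_
      · rcases lt_trichotomy i j with h | h | h
        · have := recAddr_le (M := M) (B := sampleAddr n M) h
          omega
        · omega
        · have := recAddr_le (M := M) (B := sampleAddr n M) h
          omega
      · have := sampleAddr_lt (n := n) ht
        have := hB j
        omega
    · intro z hz9
      rw [hz1 z (by omega) (by omega), if_neg (by omega), hz z hz9]
    · intro a ha
      have := hB j
      rw [hm1 a (by omega), hm a ha]
    · intro i t ht
      rw [hm1 _ _, hmask i t ht]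
      rcases lt_trichotomy i j with h | h | h
      · have := recAddr_le (M := M) (B := sampleAddr n M) h
        omega
      · subst h
        omega
      · have := recAddr_le (M := M) (B := sampleAddr n M) h
        omega
    · have : (k + 1) * (30 + r * 80) = k * (30 + r * 80) + 30 + r * 80 := by ring
      omega
  · rintro k τ ⟨hk, q9, q10, hnode, hleaf, hz, hm, hmask, hq, ht⟩ he
    have q5 := (hz 5 (by decide)).trans h5
    simp only [Expr.eval, q9, q5] at he
    obtain rfl : k = I := by
      rcases hk.lt_or_eq with h | rfl
      · have := recAddr_le (M := M) (B := sampleAddr n M) (show 0 < I - k by omega)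
        rw [recAddr_zero] at this
        omega
      · rfl
    rw [run_set]
    refine ⟨fun j hj => hnode j hj (by omega), fun j hj hj' => hleaf j hj (Or.inr hj'), ?_, hm,
      hmask, hq, by simp [Expr.cost]; omega⟩
    simp [Expr.eval, q5]

end DTLearn

namespace DTLearn

/-! ### Correctness of the search for a consistent tree -/

variable {n : ℕ}

/-- The variables that label the nodes of a tree. -/
def DTree.vars : DTree n → Finset (Fin n)
  | leaf _ => ∅
  | node i l r => insert i (l.vars ∪ r.vars)

theorem internal_mono (r : ℕ) : Monotone (internal r) := by
  refine monotone_nat_of_le_succ fun k => ?_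
  induction k with
  | zero => simp [internal]
  | succ k ih =>
    simp only [internal] at ih ⊢
    exact Nat.succ_le_succ (Nat.mul_le_mul_left _ ih)

/-- What the memory holds at the end of the search. -/
structure Solved (d s M : ℕ) (R : Finset (Fin n)) (x : ℕ → Cube n) (y : ℕ → Bool)
    (mem : ℕ → ℕ) : Prop where
  lists : Lists R mem
  point : ∀ t < M, ∀ i : Fin n, mem (sampleAddr n t + i) = (x t i).toNat
  label : ∀ t < M, mem (sampleAddr n t + n) = (y t).toNat
  root : ∀ t < M, mem (sampleAddr n M + 4 + t) = 1
  splits : SplitBelow n M R.card mem (internal R.card d)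
  nodes : ∀ j < internal R.card d, NodeAt n M s R.card mem (recAddr M (sampleAddr n M) j)
        (recAddr M (sampleAddr n M) (2 * R.card * j + 1))
  leaves : ∀ j < internal R.card (d + 1), internal R.card d ≤ j →
    LeafAt n M s mem (recAddr M (sampleAddr n M) j)

namespace Solved

variable {d s M : ℕ} {R : Finset (Fin n)} {x : ℕ → Cube n} {y : ℕ → Bool} {mem : ℕ → ℕ}

theorem split_mask (h : Solved d s M R x y mem) {j v : ℕ} (hj : j < internal R.card d)
    (hv : v < R.card) {i : Fin n} (hi : mem (2 * n + v) = i) {t : ℕ} (ht : t < M)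
    (h1 : mem (recAddr M (sampleAddr n M) j + 4 + t) ≤ 1) :
    (mem (recAddr M (sampleAddr n M) (2 * R.card * j + 1 + 2 * v) + 4 + t) ≤ 1 ∧
      (mem (recAddr M (sampleAddr n M) (2 * R.card * j + 1 + 2 * v) + 4 + t) ≠ 0 ↔
        mem (recAddr M (sampleAddr n M) j + 4 + t) ≠ 0 ∧ x t i = false)) ∧
    (mem (recAddr M (sampleAddr n M) (2 * R.card * j + 1 + 2 * v + 1) + 4 + t) ≤ 1 ∧
      (mem (recAddr M (sampleAddr n M) (2 * R.card * j + 1 + 2 * v + 1) + 4 + t) ≠ 0 ↔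
        mem (recAddr M (sampleAddr n M) j + 4 + t) ≠ 0 ∧ x t i = true)) := by
  obtain ⟨e1, e2⟩ := h.splits j hj v hv t ht
  rw [hi, h.point t ht] at e1 e2
  rw [recAddr_succ, e1, e2]
  cases x t i <;> simp <;> omega

/-- In the level-by-level numbering the children of `j` are $2rj+1,\dots,2rj+2r$, and level $l$
consists of the numbers from `internal r l` up to `internal r (l + 1)`, exclusive. With `a = l` and
`b = l + 1` the claim is that children lie one level deeper. -/
theorem child_lt {r j v a b : ℕ} (ha : internal r a ≤ j) (hb : j < internal r b) (hv : v < r) :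
    internal r (a + 1) ≤ 2 * r * j + 1 + 2 * v ∧
      2 * r * j + 1 + 2 * v + 1 < internal r (b + 1) := by
  have h1 : 2 * r * internal r a ≤ 2 * r * j := Nat.mul_le_mul_left _ ha
  have h2 : 2 * r * (j + 1) ≤ 2 * r * internal r b := Nat.mul_le_mul_left _ hb
  have h3 : 2 * r * (j + 1) = 2 * r * j + 2 * r := by ring
  simp only [internal]
  omega

/-- Induction on the depth `k` that remains below level `l`. A stored size of at most `s` excludes
the sentinel $s+1$, and if a sum is at most `s`, so are both summands; hence all records that the
tree uses are genuine. -/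
theorem sound (h : Solved d s M R x y mem) : ∀ k l j, l + k = d → internal R.card l ≤ j →
    j < internal R.card (l + 1) →
    (∀ t < M, mem (recAddr M (sampleAddr n M) j + 4 + t) ≤ 1) →
    mem (recAddr M (sampleAddr n M) j + 3) ≤ s →
    ∃ T : DTree n, T.depth ≤ k ∧ T.size = mem (recAddr M (sampleAddr n M) j + 3) ∧ T.vars ⊆ R ∧
      T.StoredAt mem (recAddr M (sampleAddr n M) j) ∧
      ∀ t < M, mem (recAddr M (sampleAddr n M) j + 4 + t) ≠ 0 → T.eval (x t) = y t := by
  have leafCase : ∀ p, LeafAt n M s mem p → mem (p + 3) ≤ s → ∀ k,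
      ∃ T : DTree n, T.depth ≤ k ∧ T.size = mem (p + 3) ∧ T.vars ⊆ R ∧
      T.StoredAt mem p ∧ ∀ t < M, mem (p + 4 + t) ≠ 0 → T.eval (x t) = y t := by
    rintro p (⟨h1, b, h2, h3⟩ | ⟨h1, -⟩) hs k
    · refine ⟨.leaf b, by simp [DTree.depth], by simp [DTree.size, h1], by simp [DTree.vars], h2,
        fun t ht hm => ?_⟩
      have := h3 t ht hm
      rw [h.label t ht] at this
      simp only [DTree.eval]
      revert this
      cases b <;> cases y t <;> simp
    · omega
  intro k
  induction k with
  | zero =>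
    intro l j hl h1 h2 hm hs
    obtain rfl : l = d := by omega
    exact leafCase _ (h.leaves j h2 h1) hs 0
  | succ k ih =>
    intro l j hl h1 h2 hm hs
    have hj : j < internal R.card d := h2.trans_le (internal_mono _ (by omega))
    obtain ⟨h3 | ⟨v, hv, e1, e2, e3, e4⟩, -, -⟩ := h.nodes j hj
    · exact leafCase _ h3 hs _
    · obtain ⟨i, hiR, hi⟩ := h.lists.1 v hv
      have ec : recAddr M (sampleAddr n M) (2 * R.card * j + 1) + 2 * v * (M + 4) =
          recAddr M (sampleAddr n M) (2 * R.card * j + 1 + 2 * v) := by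
        simp only [recAddr]
        ring
      rw [ec] at e2 e3 e4
      rw [← recAddr_succ] at e3 e4
      obtain ⟨c1, c2⟩ := child_lt h1 h2 hv
      have hmask := fun t ht => h.split_mask hj hv hi ht (hm t ht)
      obtain ⟨T₀, t1, t2, t3, t4, t5⟩ := ih (l + 1) _ (by omega) c1 (by omega)
        (fun t ht => (hmask t ht).1.1) (by omega)
      obtain ⟨T₁, u1, u2, u3, u4, u5⟩ := ih (l + 1) _ (by omega) (by omega) c2
        (fun t ht => (hmask t ht).2.1) (by omega)
      refine ⟨.node i T₀ T₁, ?_, ?_, ?_, ⟨?_, ?_, ?_⟩, ?_⟩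
      · simp [DTree.depth, t1, u1]
      · simp [DTree.size, t2, u2, e4]
      · exact Finset.insert_subset hiR (Finset.union_subset t3 u3)
      · rw [e1, hi]
      · rwa [e2]
      · rwa [e3]
      · intro t ht h0
        cases hx : x t i
        · simpa [DTree.eval, hx] using t5 t ht ((hmask t ht).1.2.2 ⟨h0, hx⟩)
        · simpa [DTree.eval, hx] using u5 t ht ((hmask t ht).2.2.2 ⟨h0, hx⟩)

/-- Induction on the competitor. If it is a leaf, the samples at the node have a common label, so
the stored size is at most one. If it is a node, its variable is among those tried, and its two
subtrees compete at the corresponding children. -/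
theorem optimal (h : Solved d s M R x y mem) (T : DTree n) : ∀ k l j, l + k = d →
    internal R.card l ≤ j → j < internal R.card (l + 1) →
    (∀ t < M, mem (recAddr M (sampleAddr n M) j + 4 + t) ≤ 1) → T.depth ≤ k → T.vars ⊆ R →
    (∀ t < M, mem (recAddr M (sampleAddr n M) j + 4 + t) ≠ 0 → T.eval (x t) = y t) →
    mem (recAddr M (sampleAddr n M) j + 3) ≤ T.size := by
  induction T with
  | leaf b =>
    intro k l j hl h1 h2 hm hd hR hT
    have hP : Pure n M mem (recAddr M (sampleAddr n M) j) b := by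
      intro t ht h0
      rw [h.label t ht, ← hT t ht h0]
      rfl
    rcases Nat.lt_or_ge j (internal R.card d) with hj | hj
    · exact (h.nodes j hj).2.1 b hP
    · exact (h.leaves j (h2.trans_le (internal_mono _ (by omega))) hj).pure_size b hP
  | node i T₀ T₁ ih0 ih1 =>
    intro k l j hl h1 h2 hm hd hR hT
    simp only [DTree.depth] at hd
    have hj : j < internal R.card d := h2.trans_le (internal_mono _ (by omega))
    simp only [DTree.vars, Finset.insert_subset_iff, Finset.union_subset_iff] at hR
    obtain ⟨v, hv, hi⟩ := h.lists.2 i hR.1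
    have hle := (h.nodes j hj).2.2 v hv
    have ec : recAddr M (sampleAddr n M) (2 * R.card * j + 1) + 2 * v * (M + 4) =
        recAddr M (sampleAddr n M) (2 * R.card * j + 1 + 2 * v) := by
      simp only [recAddr]
      ring
    rw [ec, ← recAddr_succ] at hle
    obtain ⟨c1, c2⟩ := child_lt h1 h2 hv
    have hmask := fun t ht => h.split_mask hj hv hi ht (hm t ht)
    have b0 := ih0 (k - 1) (l + 1) _ (by omega) c1 (by omega) (fun t ht => (hmask t ht).1.1)
      (by omega) hR.2.1 fun t ht h0 => by
        obtain ⟨h3, h4⟩ := (hmask t ht).1.2.1 h0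
        simpa [DTree.eval, h4] using hT t ht h3
    have b1 := ih1 (k - 1) (l + 1) _ (by omega) (by omega) c2
      (fun t ht => (hmask t ht).2.1)
      (by omega) hR.2.2 fun t ht h0 => by
        obtain ⟨h3, h4⟩ := (hmask t ht).2.2.1 h0
        simpa [DTree.eval, h4] using hT t ht h3
    simp only [DTree.size]
    omega

theorem exists_tree (h : Solved d s M R x y mem) (T : DTree n) (hd : T.depth ≤ d)
    (hs : T.size ≤ s) (hR : T.vars ⊆ R) (hT : ∀ t < M, T.eval (x t) = y t) :
    ∃ T' : DTree n, T'.depth ≤ d ∧ T'.size ≤ s ∧ T'.vars ⊆ R ∧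
      T'.StoredAt mem (sampleAddr n M) ∧ ∀ t < M, T'.eval (x t) = y t := by
  have hroot : ∀ t < M, mem (recAddr M (sampleAddr n M) 0 + 4 + t) = 1 := by
    rw [recAddr_zero]
    exact h.root
  have h1 := h.optimal T d 0 0 (by omega) (by simp [internal]) (by simp [internal])
    (fun t ht => (hroot t ht).le) hd hR fun t ht _ => hT t ht
  obtain ⟨T', t1, t2, t3, t4, t5⟩ := h.sound d 0 0 (by omega) (by simp [internal])
    (by simp [internal]) (fun t ht => (hroot t ht).le) (h1.trans hs)
  rw [recAddr_zero] at t4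
  exact ⟨T', t1, by omega, t3, t4, fun t ht => t5 t ht (by rw [hroot t ht]; decide)⟩

end Solved

end DTLearn

namespace DTLearn

variable {n : ℕ} {f : Cube n → Bool} {ω : ℕ → Bool}

/-! ### The whole program -/

/-- The learning algorithm. -/
def learner : Prog :=
  setup ;; sampling ;; countInternal ;; splitting ;; leaves ;; choosing

theorem internal_zero_le (k : ℕ) : internal 0 k ≤ 1 := by
  cases k <;> simp [internal]

/-- The number of steps of the search for a tree. -/
def searchTime (d M r : ℕ) : ℕ :=
  internal r (d + 1) * (200 + 200 * r + 200 * M + 60 * (r * M)) + d * (20 + 20 * r)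

/-- Identifies the exponents found by the set-up with those fixed beforehand, so that the number of
samples is the same for all targets and coins. -/
theorem binary_length_unique {s k k' : ℕ} (h1 : s < 2 ^ k) (h2 : 2 ^ k ≤ 2 * s) (h3 : s < 2 ^ k')
    (h4 : 2 ^ k' ≤ 2 * s) : k = k' := by
  have e1 : 2 ^ k < 2 ^ (k' + 1) := by
    rw [pow_succ]
    omega
  have e2 : 2 ^ k' < 2 ^ (k + 1) := by
    rw [pow_succ]
    omega
  have := (Nat.pow_lt_pow_iff_right (by norm_num)).1 e1
  have := (Nat.pow_lt_pow_iff_right (by norm_num)).1 e2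
  omega

theorem run_learner {d s N k l M : ℕ} (hn : 1 ≤ n) (hs : 0 < s) (hN : 0 < N) (hk : s < 2 ^ k)
    (hk' : 2 ^ k ≤ 2 * s) (hl : N < 2 ^ l) (hl' : 2 ^ l ≤ 2 * N)
    (hM : M = 2 ^ (d + 1) * (2 * s * (k + 1) + l + 1)) :
    Run f ω learner (State.init n d s N) fun τ => ∃ Rs : ℕ → Finset (Fin n), Rs 0 = ∅ ∧
      (∀ t < M, Step f (Rs t) (drawn n ω t) (Rs (t + 1))) ∧
      Solved d s M (Rs M) (drawn n ω) (fun t => f (drawn n ω t)) τ.mem ∧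
      τ.reg 0 = sampleAddr n M ∧
      τ.queries ≤ 2 * M + (Rs M).card * Nat.clog 2 n ∧
      τ.time ≤ 300 * (M * n) + (Rs M).card * ((Nat.clog 2 n + 2) * (80 * n)) +
        searchTime d M (Rs M).card := by
  unfold learner
  rw [run_seq]
  refine (run_setup hs hN).mono ?_
  rintro σ ⟨⟨k', l', hk1, hk1', hl1, hl1', h4⟩, h0, h1, h2, h5, h6, hm, hf, hq, ht⟩
  obtain rfl := binary_length_unique hk hk' hk1 hk1'
  obtain rfl := binary_length_unique hl hl' hl1 hl1'
  rw [← hM] at h4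
  rw [h4] at ht
  rw [run_seq]
  refine (run_sampling σ h0 hn h4 h5 h6 hm hf hq).mono ?_
  rintro σ₁ ⟨Rs, hR0, hstep, hL, s5, s6, hz1, hx, hq1, ht1⟩
  have s0 := (hz1 0 (by decide)).trans h0
  have s1 := (hz1 1 (by decide)).trans h1
  have s2 := (hz1 2 (by decide)).trans h2
  have s4 := (hz1 4 (by decide)).trans h4
  change σ₁.reg 5 = sampleAddr n M at s5
  generalize hr : (Rs M).card = r at *
  have hrn : r ≤ n := by
    rw [← hr]
    simpa using Finset.card_le_univ (Rs M)
  have hV : ∀ v < r, σ₁.mem (2 * n + v) < n := fun v hv => by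
    obtain ⟨i, -, hi⟩ := hL.1 v (hr ▸ hv)
    rw [hi]
    exact i.2
  rw [run_seq]
  refine (run_countInternal σ₁ s1 s6).mono ?_
  rintro σ₂ ⟨c7, hz2, hm2, hq2, ht2⟩
  rw [run_seq]
  refine (run_splitting (M := M) σ₂ ((hz2 0 (by decide)).trans s0) ((hz2 4 (by decide)).trans s4)
    ((hz2 5 (by decide)).trans s5) ((hz2 6 (by decide)).trans s6) c7 hrn
    (by rwa [hm2])).mono ?_
  rintro σ₃ ⟨hroot, hsplit, d8, d9, d10, hz3, hm3, hq3, ht3⟩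
  have e0 := (hz3 0 (by decide)).trans ((hz2 0 (by decide)).trans s0)
  have e2 := (hz3 2 (by decide)).trans ((hz2 2 (by decide)).trans s2)
  have e4 := (hz3 4 (by decide)).trans ((hz2 4 (by decide)).trans s4)
  have e5 := (hz3 5 (by decide)).trans ((hz2 5 (by decide)).trans s5)
  have e6 := (hz3 6 (by decide)).trans ((hz2 6 (by decide)).trans s6)
  rw [hm2] at hm3
  have hS0 : 3 * n ≤ sampleAddr n M := Nat.le_add_right _ _
  have hV3 : ∀ v < r, σ₃.mem (2 * n + v) < n := fun v hv => by
    rw [hm3 _ (by omega)]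
    exact hV v hv
  rw [run_seq]
  refine (run_leaves (s := s) σ₃ e0 e2 e4 e5 d8 d10 ?_).mono ?_
  · intro t ht
    rw [hm3 _ (sampleAddr_lt ht)]
    have := (hx t ht).2
    change σ₁.mem (sampleAddr n t + n) = _ at this
    rw [this]
    cases f (drawn n ω t) <;> simp
  rintro σ₄ ⟨hleaf, hz4, hm4, hmask4, hq4, ht4⟩
  have hV4 : ∀ v < r, σ₄.mem (2 * n + v) < n := fun v hv => by
    rw [hm4 _ (by omega)]
    exact hV3 v hv
  refine (run_choosing (s := s) σ₄ ((hz4 0 (by decide)).trans e0) ((hz4 5 (by decide)).trans e5)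
    ((hz4 6 (by decide)).trans e6) ((hz4 8 (by decide)).trans d8) ((hz4 9 (by decide)).trans d9)
    ((hz4 10 (by decide)).trans d10) hrn (fun h => h ▸ internal_zero_le d) hleaf).mono ?_
  rintro τ ⟨hnode, hleaf', t0, hm5, hmask5, hq5, ht5⟩
  have hmem : ∀ a < sampleAddr n M, τ.mem a = σ₁.mem a := fun a ha => by
    rw [hm5 a ha, hm4 a ha, hm3 a ha]
  have hroot' : ∀ t < M, τ.mem (recAddr M (sampleAddr n M) 0 + 4 + t) = 1 := fun t ht => by
    rw [hmask5 0 t ht, hmask4 0 t ht, recAddr_zero, hroot t ht]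
  rw [recAddr_zero] at hroot'
  refine ⟨Rs, hR0, hstep, ?_, t0, by rw [hr]; omega, ?_⟩
  · subst hr
    constructor
    · refine ⟨fun v hv => ?_, fun i hi => ?_⟩
      · rw [hmem _ (by omega)]
        exact hL.1 v hv
      · obtain ⟨v, hv, hv'⟩ := hL.2 i hi
        exact ⟨v, hv, by rw [hmem _ (by omega), hv']⟩
    · intro t ht i
      have := sampleAddr_lt (n := n) ht
      rw [hmem _ (by omega)]
      exact (hx t ht).1 i
    · intro t ht
      rw [hmem _ (sampleAddr_lt ht)]
      exact (hx t ht).2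
    · exact hroot'
    · exact (hsplit.congr hm4 hmask4 hrn hV3).congr hm5 hmask5 hrn hV4
    · exact hnode
    · exact hleaf'
  · rw [hr]
    have hMn : M ≤ M * n := Nat.le_mul_of_pos_right _ hn
    have hM1 : 1 ≤ M := by
      rw [hM]
      exact Nat.mul_pos (by positivity) (by omega)
    have hI : internal r (d + 1) = 2 * r * internal r d + 1 := rfl
    have hI' : internal r d ≤ internal r (d + 1) := internal_mono r (Nat.le_succ d)
    have a1 : internal r d * (40 + r * (40 + M * 60)) ≤
      internal r (d + 1) * (40 + r * (40 + M * 60)) := Nat.mul_le_mul_right _ hI'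
    have a2 : internal r d * (30 + r * 80) ≤ internal r (d + 1) * (30 + r * 80) :=
      Nat.mul_le_mul_right _ hI'
    have a3 : internal r (d + 1) * (200 + 200 * r + 200 * M + 60 * (r * M)) =
      internal r (d + 1) * (40 + r * (40 + M * 60)) + internal r (d + 1) * (30 + r * 80) +
      internal r (d + 1) * (60 + M * 40) +
      internal r (d + 1) * (70 + 80 * r + 160 * M) := by ring
    have a4 : M * (140 * n) = 140 * (M * n) := by ring
    have a5 : 1 ≤ internal r (d + 1) := by omega
    have a6 : 1 * 70 ≤ internal r (d + 1) * (70 + 80 * r + 160 * M) :=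
      Nat.mul_le_mul a5 (by omega)
    rw [← hI] at ht4
    unfold searchTime
    omega

end DTLearn

namespace DTLearn

/-! ### Boolean functions of bounded degree -/

/-- `HasDegree d g`: the polynomial over the field with two elements that represents `g` has degree
at most `d`. -/
def HasDegree : {n : ℕ} → ℕ → (Cube n → Bool) → Prop
  | 0, _, _ => True
  -- With slices $g_0, g_1$ in the first variable, $g = g_0 + x_0(g_0+g_1)$. So $g_0$ may have
  -- degree $d$ and $g_0+g_1$ degree $d-1$; for $d = 0$ the latter must vanish.
  | _ + 1, d, g => HasDegree d (fun x => g (Fin.cons false x)) ∧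
      match d with
      | 0 => ∀ x, g (Fin.cons false x) = g (Fin.cons true x)
      | d + 1 => HasDegree d (fun x => xor (g (Fin.cons false x)) (g (Fin.cons true x)))

theorem hasDegree_succ_succ {n d : ℕ} (g : Cube (n + 1) → Bool) :
    HasDegree (d + 1) g ↔ HasDegree (d + 1) (fun x => g (Fin.cons false x)) ∧
      HasDegree d (fun x => xor (g (Fin.cons false x)) (g (Fin.cons true x))) := Iff.rfl

theorem hasDegree_const {n : ℕ} (d : ℕ) (b : Bool) : HasDegree d (fun _ : Cube n => b) := by
  induction n generalizing d b with
  | zero => trivial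
  | succ n ih =>
    cases d with
    | zero => exact ⟨ih 0 b, fun _ => rfl⟩
    | succ d => exact ⟨ih _ b, ih d (xor b b)⟩

theorem HasDegree.xor {n d : ℕ} {g h : Cube n → Bool} (hg : HasDegree d g) (hh : HasDegree d h) :
    HasDegree d (fun x => xor (g x) (h x)) := by
  induction n generalizing d with
  | zero => trivial
  | succ n ih =>
    cases d with
    | zero => exact ⟨ih hg.1 hh.1, fun x => congrArg₂ _ (hg.2 x) (hh.2 x)⟩
    | succ d =>
      refine ⟨ih hg.1 hh.1, ?_⟩
      convert ih hg.2 hh.2 using 2 with x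
      simp only [Bool.xor_assoc, Bool.xor_left_comm, Bool.xor_comm]

theorem HasDegree.succ {n d : ℕ} {g : Cube n → Bool} (hg : HasDegree d g) :
    HasDegree (d + 1) g := by
  induction n generalizing d with
  | zero => trivial
  | succ n ih =>
    refine ⟨ih hg.1, ?_⟩
    cases d with
    | zero =>
      convert hasDegree_const 0 false using 2 with x
      rw [hg.2 x, Bool.xor_self]
    | succ d => exact ih hg.2

/-- For the slice at `true`, $g_1 = g_0 + (g_0 + g_1)$. -/
theorem HasDegree.slice {n d : ℕ} {g : Cube (n + 1) → Bool} (hg : HasDegree d g) (b : Bool) :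
    HasDegree d (fun x => g (Fin.cons b x)) := by
  cases b with
  | false => exact hg.1
  | true =>
    cases d with
    | zero =>
      convert hg.1 using 2 with x
      exact (hg.2 x).symm
    | succ d =>
      convert hg.1.xor (HasDegree.succ hg.2) using 2 with x
      simp

/-- If `i` is the first variable, the slices of the product are $0$ and $g_1$. Otherwise
multiplication by $x_i$ commutes with slicing and with sums of slices. -/
theorem HasDegree.coord_and {n d : ℕ} {g : Cube n → Bool} (hg : HasDegree d g) (i : Fin n) :
    HasDegree (d + 1) (fun x => x i && g x) := by
  induction n generalizing d with
  | zero => exact i.elim0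
  | succ n ih =>
    rw [hasDegree_succ_succ]
    refine Fin.cases ?_ (fun j => ?_) i
    · simp only [Fin.cons_zero, Bool.false_and, Bool.true_and, Bool.false_xor]
      exact ⟨hasDegree_const _ _, hg.slice true⟩
    · simp only [Fin.cons_succ]
      refine ⟨ih (hg.slice false) j, ?_⟩
      cases d with
      | zero =>
        convert hasDegree_const 0 false using 2 with x
        rw [hg.2 x, Bool.xor_self]
      | succ d =>
        convert ih hg.2 j using 2 with x
        cases x j <;> simp

/-- A node computes $l + x_i(l + r)$ over the field with two elements. -/
theorem DTree.hasDegree_eval {n : ℕ} (T : DTree n) (d : ℕ) (hd : T.depth ≤ d) :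
    HasDegree d T.eval := by
  induction T generalizing d with
  | leaf b => exact hasDegree_const d b
  | node i l r ihl ihr =>
    simp only [DTree.depth] at hd
    obtain ⟨d, rfl⟩ : ∃ e, d = e + 1 := ⟨d - 1, by omega⟩
    have h1 := ihl d (by omega)
    have h2 := ihr d (by omega)
    convert h1.succ.xor ((h1.xor h2).coord_and i) using 2 with x
    simp only [DTree.eval]
    cases x i <;> simp

theorem card_cube_succ {n : ℕ} (g : Cube (n + 1) → Bool) :
    (Finset.univ.filter fun x => g x = true).card =
      (Finset.univ.filter fun x => g (Fin.cons false x) = true).card +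
        (Finset.univ.filter fun x => g (Fin.cons true x) = true).card := by
  have key : (Finset.univ.filter fun x => g x = true) =
      ((Finset.univ.filter fun x : Cube n => g (Fin.cons false x) = true).image
        (Fin.cons (α := fun _ => Bool) false)) ∪
      ((Finset.univ.filter fun x : Cube n => g (Fin.cons true x) = true).image
        (Fin.cons (α := fun _ => Bool) true)) := by
    ext x
    simp only [Finset.mem_filter, Finset.mem_univ, true_and, Finset.mem_union, Finset.mem_image]
    constructor
    · intro h
      rw [← Fin.cons_self_tail x] at h
      cases hx : x 0
      · rw [hx] at h
        exact Or.inl ⟨Fin.tail x, h, by rw [← hx, Fin.cons_self_tail]⟩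
      · rw [hx] at h
        exact Or.inr ⟨Fin.tail x, h, by rw [← hx, Fin.cons_self_tail]⟩
    · rintro (⟨y, h, rfl⟩ | ⟨y, h, rfl⟩) <;> exact h
  rw [key, Finset.card_union_of_disjoint, Finset.card_image_of_injective _ (Fin.cons_right_injective _),
    Finset.card_image_of_injective _ (Fin.cons_right_injective _)]
  rw [Finset.disjoint_left]
  simp only [Finset.mem_image]
  rintro _ ⟨y, -, rfl⟩ ⟨z, -, h⟩
  have := congrFun h 0
  simp at this

/-- A function of degree at most `d` that does not vanish is nonzero on a fraction of at least
`2 ^ (-d)` of the cube. -/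
theorem HasDegree.two_pow_le {n d : ℕ} {g : Cube n → Bool} (hg : HasDegree d g)
    (hx : ∃ x, g x = true) : 2 ^ n ≤ 2 ^ d * (Finset.univ.filter fun x => g x = true).card := by
  induction n generalizing d with
  | zero =>
    have : 0 < (Finset.univ.filter fun x => g x = true).card := by
      obtain ⟨x, hx⟩ := hx
      exact Finset.card_pos.2 ⟨x, Finset.mem_filter.2 ⟨Finset.mem_univ _, hx⟩⟩
    rw [pow_zero]
    exact Nat.mul_pos (Nat.two_pow_pos d) this
  | succ n ih =>
    rw [card_cube_succ, pow_succ, Nat.mul_add]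
    have ih' : ∀ b, (∃ x, g (Fin.cons b x) = true) → 2 ^ n ≤ 2 ^ d *
        (Finset.univ.filter fun x => g (Fin.cons b x) = true).card :=
      fun b h => ih (hg.slice b) h
    obtain ⟨x, hx⟩ := hx
    rw [← Fin.cons_self_tail x] at hx
    have hb : ∃ b, ∃ y, g (Fin.cons b y) = true := ⟨_, _, hx⟩
    by_cases h0 : ∃ y, g (Fin.cons false y) = true
    · by_cases h1 : ∃ y, g (Fin.cons true y) = true
      · have := ih' _ h0
        have := ih' _ h1
        omega
      -- Here $g_1 = 0$, so $g_0 = g_0 + g_1$ has degree one less. Its support is twice as dense in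
      -- its half of the cube, which makes up for the empty half.
      · push Not at h1
        cases d with
        | zero =>
          obtain ⟨y, hy⟩ := h0
          rw [hg.2 y] at hy
          exact absurd hy (h1 y)
        | succ d =>
          have h2 := ih hg.2 (by
            obtain ⟨y, hy⟩ := h0
            exact ⟨y, by simpa [hy] using h1 y⟩)
          have h3 : ∀ x, g (Fin.cons true x) = false := fun x => by simpa using h1 x
          have h4 : 2 ^ n ≤ 2 ^ d *
              (Finset.univ.filter fun x => g (Fin.cons false x) = true).card := by
            simpa only [h3, Bool.xor_false] using h2
          have : 2 ^ (d + 1) * (Finset.univ.filter fun x => g (Fin.cons false x) = true).card =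
            2 * (2 ^ d * (Finset.univ.filter fun x => g (Fin.cons false x) = true).card) := by ring
          omega
    · have h1 : ∃ y, g (Fin.cons true y) = true := by
        obtain ⟨b, hb⟩ := hb
        cases b
        · exact absurd hb h0
        · exact hb
      push Not at h0
      cases d with
      | zero =>
        obtain ⟨y, hy⟩ := h1
        rw [← hg.2 y] at hy
        exact absurd hy (h0 y)
      | succ d =>
        have h2 := ih hg.2 (by
          obtain ⟨y, hy⟩ := h1
          exact ⟨y, by simpa [hy] using h0 y⟩)
        have h3 : ∀ x, g (Fin.cons false x) = false := fun x => by simpa using h0 x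
        have h4 : 2 ^ n ≤ 2 ^ d *
            (Finset.univ.filter fun x => g (Fin.cons true x) = true).card := by
          simpa only [h3, Bool.false_xor] using h2
        have : 2 ^ (d + 1) * (Finset.univ.filter fun x => g (Fin.cons true x) = true).card =
          2 * (2 ^ d * (Finset.univ.filter fun x => g (Fin.cons true x) = true).card) := by ring
        omega

/-- Two different functions that are computed by trees of depth at most `d` differ on a fraction
of at least `2 ^ (-d)` of the cube. -/
theorem DTree.two_pow_le_card_ne {n d : ℕ} {T T' : DTree n} (hT : T.depth ≤ d)
    (hT' : T'.depth ≤ d) (h : T.eval ≠ T'.eval) :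
    2 ^ n ≤ 2 ^ d * (Finset.univ.filter fun x => T.eval x ≠ T'.eval x).card := by
  have := ((T.hasDegree_eval d hT).xor (T'.hasDegree_eval d hT')).two_pow_le (by
    obtain ⟨x, hx⟩ := Function.ne_iff.1 h
    exact ⟨x, by simpa using hx⟩)
  simpa using this

end DTLearn

namespace DTLearn

/-! ### Restricting and counting trees -/

namespace DTree

variable {n : ℕ}

/-- The tree in which the variables outside `R` are replaced by `0`. -/
def restrict (R : Finset (Fin n)) : DTree n → DTree n
  | leaf b => leaf b
  | node i l r => if i ∈ R then node i (l.restrict R) (r.restrict R) else l.restrict R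

theorem eval_restrict (R : Finset (Fin n)) (T : DTree n) (x : Cube n) :
    (T.restrict R).eval x = T.eval (project R x) := by
  induction T with
  | leaf b => rfl
  | node i l r ihl ihr =>
    by_cases hi : i ∈ R
    · simp [restrict, eval, hi, ihl, ihr, project]
    · simp [restrict, eval, hi, ihl, project]

theorem vars_restrict (R : Finset (Fin n)) (T : DTree n) : (T.restrict R).vars ⊆ R := by
  induction T with
  | leaf b => simp [restrict, vars]
  | node i l r ihl ihr =>
    by_cases hi : i ∈ R
    · simp only [restrict, hi, if_true, vars]
      exact Finset.insert_subset hi (Finset.union_subset ihl ihr)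
    · simpa [restrict, hi] using ihl

theorem size_restrict (R : Finset (Fin n)) (T : DTree n) : (T.restrict R).size ≤ T.size := by
  induction T with
  | leaf b => exact le_rfl
  | node i l r ihl ihr =>
    by_cases hi : i ∈ R
    · simp only [restrict, hi, if_true, size]
      omega
    · simp only [restrict, hi, if_false, size]
      omega

theorem depth_restrict (R : Finset (Fin n)) (T : DTree n) : (T.restrict R).depth ≤ T.depth := by
  induction T with
  | leaf b => exact le_rfl
  | node i l r ihl ihr =>
    by_cases hi : i ∈ R
    · simp only [restrict, hi, if_true, depth]
      omega
    · simp only [restrict, hi, if_false, depth]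
      omega

/-- A binary tree with $s$ leaves has $s-1$ internal nodes. -/
theorem card_vars_lt (T : DTree n) : T.vars.card < T.size := by
  induction T with
  | leaf b => simp [vars, size]
  | node i l r ihl ihr =>
    have h1 := Finset.card_insert_le i (l.vars ∪ r.vars)
    have h2 := Finset.card_union_le l.vars r.vars
    simp only [vars, size]
    omega

theorem eval_congr (T : DTree n) {x y : Cube n} (h : ∀ i ∈ T.vars, x i = y i) :
    T.eval x = T.eval y := by
  induction T with
  | leaf b => rfl
  | node i l r ihl ihr =>
    simp only [vars, Finset.mem_insert, Finset.mem_union] at h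
    simp only [eval, h i (Or.inl rfl), ihl fun j hj => h j (Or.inr (Or.inl hj)),
      ihr fun j hj => h j (Or.inr (Or.inr hj))]

theorem mem_vars_of_relevant (T : DTree n) {i : Fin n} (h : Relevant T.eval i) : i ∈ T.vars := by
  obtain ⟨x, y, hxy, hne⟩ := h
  by_contra hi
  exact hne (T.eval_congr fun j hj => hxy j fun h => hi (h ▸ hj))

/-- The labels of a tree in preorder. -/
def code : DTree n → List (Fin n ⊕ Bool)
  | leaf b => [.inr b]
  | node i l r => .inl i :: (l.code ++ r.code)

/-- The preorder code is prefix-free. The arbitrary tails `u`, `u'` let the induction handle the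
concatenated codes of the two children. -/
theorem code_append_inj (T : DTree n) : ∀ (T' : DTree n) (u u' : List (Fin n ⊕ Bool)),
    T.code ++ u = T'.code ++ u' → T = T' ∧ u = u' := by
  induction T with
  | leaf b =>
    rintro (b' | ⟨i, l, r⟩) u u' h
    · simpa [code] using h
    · simp [code] at h
  | node i l r ihl ihr =>
    rintro (b' | ⟨i', l', r'⟩) u u' h
    · simp [code] at h
    · simp only [code, List.cons_append, List.append_assoc, List.cons.injEq, Sum.inl.injEq] at h
      obtain ⟨h1, h2⟩ := ihl _ _ _ h.2
      obtain ⟨h3, h4⟩ := ihr _ _ _ h2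
      exact ⟨by rw [h.1, h1, h3], h4⟩

theorem code_injective : Function.Injective (code : DTree n → _) := fun T T' h =>
  (T.code_append_inj T' [] [] (by rw [h])).1

theorem length_code (T : DTree n) : T.code.length + 1 = 2 * T.size := by
  induction T with
  | leaf b => rfl
  | node i l r ihl ihr =>
    simp only [code, size, List.length_cons, List.length_append]
    omega

theorem mem_code (T : DTree n) {a : Fin n ⊕ Bool} (h : a ∈ T.code) :
    a ∈ T.vars.disjSum Finset.univ := by
  induction T with
  | leaf b =>
    simp only [code, List.mem_singleton] at h
    simp [h]
  | node i l r ihl ihr =>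
    simp only [code, List.mem_cons, List.mem_append] at h
    rcases h with rfl | h | h
    · simp [vars]
    · have := ihl h
      revert this
      cases a <;> (simp [vars]; try tauto)
    · have := ihr h
      revert this
      cases a <;> (simp [vars]; try tauto)

/-- There are at most `(|V| + 3) ^ (2 * s)` trees of size at most `s` with variables in `V`. -/
theorem exists_code (V : Finset (Fin n)) (s : ℕ) :
    ∃ (W : Finset (Fin (2 * s) → Option (Fin n ⊕ Bool)))
      (c : DTree n → Fin (2 * s) → Option (Fin n ⊕ Bool)), W.card = (V.card + 3) ^ (2 * s) ∧
      (∀ T : DTree n, T.vars ⊆ V → c T ∈ W) ∧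
      ∀ T T' : DTree n, T.size ≤ s → T'.size ≤ s → c T = c T' → T = T' := by
  -- A code has length `2 * T.size - 1` and is padded with `none` to length `2 * s`. The symbols are
  -- the variables in `V`, two bits and `none`.
  refine ⟨Fintype.piFinset fun _ => Finset.insertNone (V.disjSum Finset.univ),
    fun T i => T.code[(i : ℕ)]?, ?_, ?_, ?_⟩
  · simp [Fintype.card_piFinset, add_assoc]
  · intro T hT
    rw [Fintype.mem_piFinset]
    intro i
    rw [Finset.mem_insertNone]
    intro a ha
    have := T.mem_code (List.mem_of_getElem? ha)
    exact Finset.disjSum_mono hT le_rfl this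
  · intro T T' hT hT' h
    apply code_injective
    apply List.ext_getElem?
    intro i
    by_cases hi : i < 2 * s
    · exact congrFun h ⟨i, hi⟩
    · have := T.length_code
      have := T'.length_code
      rw [List.getElem?_eq_none (by omega), List.getElem?_eq_none (by omega)]

end DTree

end DTLearn

namespace DTLearn

/-! ### Counting the bad sequences of samples -/

variable {n : ℕ}

/-- The set `R` contains all the variables on which `f` depends. -/
def Covers (f : Cube n → Bool) (R : Finset (Fin n)) : Prop := ∀ x, f (project R x) = f x

/-- The samples `X` may lead from `R` to a set that does not cover `f`. -/
def Misses (f : Cube n → Bool) (t : ℕ) (R : Finset (Fin n)) (X : Fin t → Cube n) : Prop :=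
  ∃ Rs : ℕ → Finset (Fin n), Rs 0 = R ∧ (∀ k : Fin t, Step f (Rs k) (X k) (Rs (k + 1))) ∧
    ¬ Covers f (Rs t)

theorem not_misses_of_covers {f : Cube n → Bool} {R : Finset (Fin n)} (h : Covers f R) {t : ℕ}
    (X : Fin t → Cube n) : ¬ Misses f t R X := by
  rintro ⟨Rs, h0, hs, hc⟩
  have key : ∀ k ≤ t, Rs k = R := by
    intro k
    induction k with
    | zero => exact fun _ => h0
    | succ k ih =>
      intro hk
      have := hs ⟨k, by omega⟩
      simp only [ih (by omega)] at this
      rcases this with ⟨-, h1⟩ | ⟨h1, -⟩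
      · exact h1
      · exact absurd (h _) h1
  rw [key t le_rfl] at hc
  exact hc h

theorem misses_succ {f : Cube n → Bool} {R : Finset (Fin n)} {t : ℕ} {x : Cube n}
    {X : Fin t → Cube n} (h : Misses f (t + 1) R (Fin.cons x X)) :
    ∃ R', Step f R x R' ∧ Misses f t R' X := by
  obtain ⟨Rs, h0, hs, hc⟩ := h
  refine ⟨Rs 1, ?_, fun k => Rs (k + 1), rfl, fun k => ?_, hc⟩
  · simpa [h0] using hs 0
  · simpa using hs k.succ

open Classical in
/-- The number of sequences of `t` samples that may lead from `R` to a set that does not cover `f`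
decreases exponentially in `t`. -/
theorem card_misses_le {s d : ℕ} (T : DTree n) (hd : T.depth ≤ d) (hs : T.size ≤ s) (t : ℕ)
    (R : Finset (Fin n)) :
    ((Finset.univ.filter (Misses T.eval t R)).card : ℝ) ≤
      (2 * s) ^ (T.vars \ R).card * (2 ^ n * (1 - 1 / 2 ^ (d + 1))) ^ t := by
  have hs1 : 1 ≤ s := by
    have := T.card_vars_lt
    omega
  have hsR : (1 : ℝ) ≤ s := by exact_mod_cast hs1
  have hq : (0 : ℝ) ≤ 1 - 1 / 2 ^ (d + 1) := by
    rw [sub_nonneg, div_le_one (by positivity)]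
    exact one_le_pow₀ (by norm_num)
  induction t generalizing R with
  | zero =>
    rw [pow_zero, mul_one]
    calc ((Finset.univ.filter (Misses T.eval 0 R)).card : ℝ) ≤ 1 := by
          exact_mod_cast (Finset.card_filter_le _ _).trans (by simp)
      _ ≤ _ := one_le_pow₀ (by linarith)
  | succ t ih =>
    by_cases hR : Covers T.eval R
    · rw [Finset.filter_false_of_mem fun X _ => not_misses_of_covers hR X]
      simp only [Finset.card_empty, Nat.cast_zero]
      positivity
    set D := Finset.univ.filter fun x => T.eval x ≠ (T.restrict R).eval x with hD
    set A := Finset.univ.filter fun x => ¬ (T.eval x ≠ (T.restrict R).eval x) with hA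
    have hDA : (D.card : ℝ) + A.card = 2 ^ n := by
      have := Finset.card_filter_add_card_filter_not (s := (Finset.univ : Finset (Cube n)))
        (fun x => T.eval x ≠ (T.restrict R).eval x)
      rw [← hD, ← hA] at this
      rw [← Nat.cast_add, this]
      simp
    have hDle : (2 : ℝ) ^ n ≤ 2 ^ d * D.card := by
      have := DTree.two_pow_le_card_ne hd ((T.depth_restrict R).trans hd) (fun h => hR fun x => by
        rw [← T.eval_restrict, ← h])
      rw [hD]
      exact_mod_cast this
    set W := T.vars \ R with hW
    -- A first sample in `A` leaves `R` unchanged; one in `D` adds a variable of `W`. Which one is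
    -- up to the search, so the union over all of `W` is taken.
    have hsub : Finset.univ.filter (Misses T.eval (t + 1) R) ⊆
        ((A ×ˢ Finset.univ.filter (Misses T.eval t R)) ∪
          (D ×ˢ W.biUnion fun i => Finset.univ.filter (Misses T.eval t (insert i R)))).image
          (fun p => (Fin.cons p.1 p.2 : Fin (t + 1) → Cube n)) := by
      intro X hX
      rw [Finset.mem_filter, ← Fin.cons_self_tail X] at hX
      obtain ⟨R', hstep, hm⟩ := misses_succ hX.2
      refine Finset.mem_image.2 ⟨(X 0, Fin.tail X), ?_, Fin.cons_self_tail X⟩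
      rcases hstep with ⟨h1, rfl⟩ | ⟨h1, i, hi, hrel, rfl⟩
      · refine Finset.mem_union_left _ (Finset.mem_product.2 ⟨?_, ?_⟩)
        · simp only [hA, Finset.mem_filter, Finset.mem_univ, true_and, not_not, T.eval_restrict]
          exact h1.symm
        · simpa using hm
      · refine Finset.mem_union_right _ (Finset.mem_product.2 ⟨?_, ?_⟩)
        · simp only [hD, Finset.mem_filter, Finset.mem_univ, true_and, T.eval_restrict]
          exact h1.symm
        · refine Finset.mem_biUnion.2 ⟨i, ?_, by simpa using hm⟩
          exact Finset.mem_sdiff.2 ⟨T.mem_vars_of_relevant hrel, hi⟩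
    set Q : ℝ := (2 ^ n * (1 - 1 / 2 ^ (d + 1))) ^ t with hQ
    have hQ0 : 0 ≤ Q := by positivity
    have hins : ∀ i ∈ W, ((Finset.univ.filter (Misses T.eval t (insert i R))).card : ℝ) ≤
        (2 * s) ^ (W.card - 1) * Q := by
      intro i hi
      refine (ih (insert i R)).trans (le_of_eq ?_)
      rw [Finset.sdiff_insert, Finset.card_erase_of_mem hi]
    -- The union has at most `s` members, and enlarging `R` saves a factor `2 * s`. The base `2 * s`
    -- is chosen to gain a factor $1/2$ here.
    have hsum : ((W.biUnion fun i => Finset.univ.filter (Misses T.eval t (insert i R))).card : ℝ) ≤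
        (2 * s) ^ W.card / 2 * Q := by
      calc ((W.biUnion fun i => Finset.univ.filter (Misses T.eval t (insert i R))).card : ℝ)
          ≤ ∑ i ∈ W, ((Finset.univ.filter (Misses T.eval t (insert i R))).card : ℝ) := by
            exact_mod_cast Finset.card_biUnion_le
        _ ≤ W.card • ((2 * s) ^ (W.card - 1) * Q) := Finset.sum_le_card_nsmul _ _ _ hins
        _ ≤ (2 * s) ^ W.card / 2 * Q := by
            rw [nsmul_eq_mul]
            rcases Nat.eq_zero_or_pos W.card with h0 | h0
            · rw [h0]
              simp only [Nat.cast_zero, zero_mul]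
              positivity
            · have h1 : (W.card : ℝ) ≤ s := by
                have := T.card_vars_lt
                have : W.card ≤ T.vars.card := Finset.card_le_card (hW ▸ Finset.sdiff_subset)
                exact_mod_cast (by omega : W.card ≤ s)
              obtain ⟨m, hm⟩ : ∃ m, W.card = m + 1 := ⟨W.card - 1, by omega⟩
              rw [hm] at h1 ⊢
              rw [Nat.add_sub_cancel, pow_succ]
              have : 0 ≤ (2 * (s : ℝ)) ^ m * Q := by positivity
              nlinarith
    have hcard : ((Finset.univ.filter (Misses T.eval (t + 1) R)).card : ℝ) ≤
        A.card * ((2 * s) ^ W.card * Q) + D.card * ((2 * s) ^ W.card / 2 * Q) := by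
      calc ((Finset.univ.filter (Misses T.eval (t + 1) R)).card : ℝ)
          ≤ ((A.card * (Finset.univ.filter (Misses T.eval t R)).card + D.card *
            (W.biUnion fun i => Finset.univ.filter (Misses T.eval t (insert i R))).card : ℕ) : ℝ) := by
            rw [← Finset.card_product, ← Finset.card_product]
            exact_mod_cast (Finset.card_le_card hsub).trans
              (Finset.card_image_le.trans (Finset.card_union_le _ _))
        _ ≤ _ := by
            push_cast
            gcongr
            exact ih R
    refine hcard.trans ?_
    rw [pow_succ, ← hQ]
    -- The left side is $2^n - |D|/2$, and $|D| \ge 2^{n-d}$ because `T` and its restriction are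
    -- different functions of depth at most `d`.
    have hfin : (A.card : ℝ) + D.card / 2 ≤ 2 ^ n * (1 - 1 / 2 ^ (d + 1)) := by
      have : (2 : ℝ) ^ n * (1 / 2 ^ (d + 1)) ≤ D.card / 2 := by
        rw [mul_one_div, div_le_iff₀ (by positivity), pow_succ]
        linarith
      linarith
    have hK : 0 ≤ (2 * (s : ℝ)) ^ W.card * Q := by positivity
    calc (A.card : ℝ) * ((2 * s) ^ W.card * Q) + D.card * ((2 * s) ^ W.card / 2 * Q)
        = ((2 * s) ^ W.card * Q) * (A.card + D.card / 2) := by ring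
      _ ≤ ((2 * s) ^ W.card * Q) * (2 ^ n * (1 - 1 / 2 ^ (d + 1))) :=
          mul_le_mul_of_nonneg_left hfin hK
      _ = _ := by ring

/-- A tree other than `f` in the class, with variables in `V`, is consistent with the samples. -/
def Fools (f : Cube n → Bool) (d s : ℕ) (V : Finset (Fin n)) (t : ℕ) (X : Fin t → Cube n) : Prop :=
  ∃ T : DTree n, T.depth ≤ d ∧ T.size ≤ s ∧ T.vars ⊆ V ∧ T.eval ≠ f ∧
    ∀ k, T.eval (X k) = f (X k)

open Classical in
theorem card_fools_le {s d : ℕ} (T : DTree n) (hd : T.depth ≤ d) (V : Finset (Fin n)) (t : ℕ) :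
    ((Finset.univ.filter (Fools T.eval d s V t)).card : ℝ) ≤
      (V.card + 3) ^ (2 * s) * (2 ^ n * (1 - 1 / 2 ^ (d + 1))) ^ t := by
  obtain ⟨W, c, hW, hmem, hinj⟩ := DTree.exists_code V s
  have hq : (0 : ℝ) ≤ 1 - 1 / 2 ^ (d + 1) := by
    rw [sub_nonneg, div_le_one (by positivity)]
    exact one_le_pow₀ (by norm_num)
  let P : DTree n → (Fin t → Cube n) → Prop := fun T' X =>
    T'.depth ≤ d ∧ T'.size ≤ s ∧ T'.vars ⊆ V ∧ T'.eval ≠ T.eval ∧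
    ∀ k, T'.eval (X k) = T.eval (X k)
  have hsub : Finset.univ.filter (Fools T.eval d s V t) ⊆
      W.biUnion fun w => Finset.univ.filter fun X => ∃ T', c T' = w ∧ P T' X := by
    intro X hX
    obtain ⟨T', h1, h2, h3, h4⟩ := (Finset.mem_filter.1 hX).2
    exact Finset.mem_biUnion.2 ⟨c T', hmem T' h3, Finset.mem_filter.2 ⟨Finset.mem_univ _, T', rfl,
      h1, h2, h3, h4⟩⟩
  -- At most one tree of size at most `s` has the code `w`, and every sample must lie in the set `A`
  -- where it agrees with the target.
  have hone : ∀ w ∈ W, ((Finset.univ.filter fun X => ∃ T', c T' = w ∧ P T' X).card : ℝ) ≤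
      (2 ^ n * (1 - 1 / 2 ^ (d + 1))) ^ t := by
    intro w _
    by_cases hex : ∃ T' X, c T' = w ∧ P T' X
    · obtain ⟨T', -, rfl, h1, h2, h3, h4, -⟩ := hex
      set A := Finset.univ.filter fun x => ¬ (T'.eval x ≠ T.eval x) with hA
      have hAsub : (Finset.univ.filter fun X => ∃ T'', c T'' = c T' ∧ P T'' X) ⊆
          Fintype.piFinset fun _ : Fin t => A := by
        intro X hX
        obtain ⟨T'', h5, h6, h7, -, -, h8⟩ := (Finset.mem_filter.1 hX).2
        obtain rfl := hinj _ _ h7 h2 h5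
        rw [Fintype.mem_piFinset]
        intro k
        simpa [hA] using h8 k
      have hAle : (A.card : ℝ) ≤ 2 ^ n * (1 - 1 / 2 ^ (d + 1)) := by
        have h9 := Finset.card_filter_add_card_filter_not (s := (Finset.univ : Finset (Cube n)))
          (fun x => T'.eval x ≠ T.eval x)
        have h10 := DTree.two_pow_le_card_ne h1 hd h4
        rw [← hA] at h9
        have h11 : ((Finset.univ.filter fun x => T'.eval x ≠ T.eval x).card : ℝ) + A.card =
            2 ^ n := by
          rw [← Nat.cast_add, h9]
          simp
        have h12 : (2 : ℝ) ^ n ≤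
            2 ^ d * (Finset.univ.filter fun x => T'.eval x ≠ T.eval x).card := by
          exact_mod_cast h10
        -- Half of the available rate $2^{-d}$ is given up, so that the bound has the same base as
        -- `card_misses_le`.
        have : (2 : ℝ) ^ n * (1 / 2 ^ (d + 1)) ≤
            (Finset.univ.filter fun x => T'.eval x ≠ T.eval x).card := by
          rw [mul_one_div, div_le_iff₀ (by positivity), pow_succ]
          have : (0 : ℝ) ≤ 2 ^ n := by positivity
          linarith
        linarith
      calc ((Finset.univ.filter fun X => ∃ T'', c T'' = c T' ∧ P T'' X).card : ℝ)
          ≤ ((Fintype.piFinset fun _ : Fin t => A).card : ℝ) := by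
            exact_mod_cast Finset.card_le_card hAsub
        _ = (A.card : ℝ) ^ t := by simp [Fintype.card_piFinset]
        _ ≤ _ := by gcongr
    · rw [Finset.filter_false_of_mem fun X _ h => hex (by
        obtain ⟨T', h⟩ := h
        exact ⟨T', X, h⟩)]
      simp only [Finset.card_empty, Nat.cast_zero]
      positivity
  calc ((Finset.univ.filter (Fools T.eval d s V t)).card : ℝ)
      ≤ ∑ w ∈ W, ((Finset.univ.filter fun X => ∃ T', c T' = w ∧ P T' X).card : ℝ) := by
        exact_mod_cast (Finset.card_le_card hsub).trans Finset.card_biUnion_le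
    _ ≤ W.card • (2 ^ n * (1 - 1 / 2 ^ (d + 1))) ^ t := Finset.sum_le_card_nsmul _ _ _ hone
    _ = _ := by
        rw [hW, nsmul_eq_mul]
        push_cast
        rfl

end DTLearn

namespace DTLearn

/-! ### The probability of failure -/

open MeasureTheory

variable {n : ℕ}

instance : IsProbabilityMeasure coins := by
  unfold coins
  infer_instance

theorem coins_prefix (N : ℕ) (w : ℕ → Bool) : coins {ω | ∀ k < N, ω k = w k} = 2⁻¹ ^ N := by
  have : {ω : ℕ → Bool | ∀ k < N, ω k = w k} =
      Set.pi (Finset.range N : Set ℕ) fun k => {w k} := by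
    ext ω
    simp
  rw [this, coins, Measure.infinitePi_pi _ fun k _ => MeasurableSet.singleton _]
  simp

/-- Coin `k` is coordinate `k % n` of sample `k / n`, so a value of all samples determines the first
`M * n` coins. Only upper bounds are needed, so counting sequences suffices and no event has to be
shown measurable. -/
theorem coins_drawn_le (hn : 0 < n) {M : ℕ} (B : Finset (Fin M → Cube n)) :
    coins.real {ω | (fun t : Fin M => drawn n ω t) ∈ B} ≤ B.card * (1 / 2) ^ (M * n) := by
  have hone : ∀ X : Fin M → Cube n,
      coins.real {ω | (fun t : Fin M => drawn n ω t) = X} ≤ (1 / 2) ^ (M * n) := by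
    intro X
    let w : ℕ → Bool := fun k => if h : k / n < M then X ⟨k / n, h⟩ ⟨k % n, Nat.mod_lt _ hn⟩
      else false
    have hsub : {ω | (fun t : Fin M => drawn n ω t) = X} ⊆ {ω | ∀ k < M * n, ω k = w k} := by
      rintro ω rfl k hk
      have h : k / n < M := (Nat.div_lt_iff_lt_mul hn).2 hk
      simp only [w, h, dif_pos, drawn]
      rw [mul_comm, Nat.div_add_mod]
    refine (measureReal_mono hsub).trans (le_of_eq ?_)
    rw [measureReal_def, coins_prefix]
    simp
  have hU : {ω | (fun t : Fin M => drawn n ω t) ∈ B} ⊆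
      ⋃ X ∈ B, {ω | (fun t : Fin M => drawn n ω t) = X} := by
    intro ω hω
    simp only [Set.mem_iUnion]
    exact ⟨_, hω, rfl⟩
  calc coins.real {ω | (fun t : Fin M => drawn n ω t) ∈ B}
      ≤ coins.real (⋃ X ∈ B, {ω | (fun t : Fin M => drawn n ω t) = X}) := measureReal_mono hU (measure_ne_top _ _)
    _ ≤ ∑ X ∈ B, coins.real {ω | (fun t : Fin M => drawn n ω t) = X} :=
        measureReal_biUnion_finset_le _ _
    _ ≤ B.card • (1 / 2 : ℝ) ^ (M * n) := Finset.sum_le_card_nsmul _ _ _ fun X _ => hone X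
    _ = _ := by rw [nsmul_eq_mul]

/-- $(1-1/Q)^Q \le e^{-1} \le 1/2$. -/
theorem one_sub_inv_pow_le (Q E : ℕ) (hQ : 0 < Q) :
    (1 - 1 / (Q : ℝ)) ^ (Q * E) ≤ (1 / 2) ^ E := by
  have hQ' : (0 : ℝ) < Q := by exact_mod_cast hQ
  rw [pow_mul]
  have h0 : (0 : ℝ) ≤ 1 - 1 / Q := by
    rw [sub_nonneg, div_le_one hQ']
    exact_mod_cast hQ
  refine pow_le_pow_left₀ (by positivity) ?_ E
  calc (1 - 1 / (Q : ℝ)) ^ Q ≤ Real.exp (-(1 / Q)) ^ Q :=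
        pow_le_pow_left₀ h0 (Real.one_sub_le_exp_neg _) Q
    _ = Real.exp (-1) := by
        rw [← Real.exp_nat_mul]
        congr 1
        field_simp
    _ ≤ 1 / 2 := by
        rw [Real.exp_neg, one_div]
        refine inv_anti₀ (by norm_num) ?_
        have := Real.add_one_le_exp 1
        linarith

/-- With high probability the samples lead to all relevant variables, and they distinguish the
target from all other trees. -/
theorem coins_bad_le {d s k l M : ℕ} (hn : 0 < n) (T : DTree n) (hd : T.depth ≤ d)
    (hs : T.size ≤ s) (hk : s < 2 ^ k) (hM : M = 2 ^ (d + 1) * (2 * s * (k + 1) + l + 1)) :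
    coins.real {ω | Misses T.eval M ∅ (fun t => drawn n ω t) ∨
      Fools T.eval d s T.vars M (fun t => drawn n ω t)} ≤ (1 / 2) ^ l := by
  classical
  have hV := T.card_vars_lt
  set B := Finset.univ.filter (Misses T.eval M ∅) ∪
    Finset.univ.filter (Fools T.eval d s T.vars M) with hB
  have h1 := coins_drawn_le hn B
  have h2 : {ω | Misses T.eval M ∅ (fun t => drawn n ω t) ∨
      Fools T.eval d s T.vars M (fun t => drawn n ω t)} ⊆
      {ω | (fun t : Fin M => drawn n ω t) ∈ B} := by
    intro ω hω
    simpa [hB] using hω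
  refine (measureReal_mono h2).trans (h1.trans ?_)
  set q : ℝ := 1 - 1 / 2 ^ (d + 1) with hq
  have hq0 : 0 ≤ q := by
    rw [hq, sub_nonneg, div_le_one (by positivity)]
    exact one_le_pow₀ (by norm_num)
  -- The tree has fewer than `s` variables, so $|V| + 3 \le s + 2$. Both union bounds thus have a
  -- base of at most $2^{k+1}$.
  have hk2 : s + 2 ≤ 2 ^ (k + 1) := by
    rw [pow_succ]
    omega
  have hk2' : 2 * s ≤ 2 ^ (k + 1) := by
    rw [pow_succ]
    omega
  have b1 : ((2 : ℝ) * s) ^ (T.vars \ ∅).card ≤ (2 ^ (k + 1)) ^ (2 * s) := by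
    have h3 : (1 : ℝ) ≤ 2 ^ (k + 1) := one_le_pow₀ (by norm_num)
    calc ((2 : ℝ) * s) ^ (T.vars \ ∅).card ≤ (2 ^ (k + 1)) ^ (T.vars \ ∅).card := by
          refine pow_le_pow_left₀ (by positivity) ?_ _
          exact_mod_cast hk2'
      _ ≤ _ := pow_le_pow_right₀ h3 (by rw [Finset.sdiff_empty]; omega)
  have b2 : ((T.vars.card : ℝ) + 3) ^ (2 * s) ≤ (2 ^ (k + 1)) ^ (2 * s) := by
    refine pow_le_pow_left₀ (by positivity) ?_ _
    exact_mod_cast (by omega : T.vars.card + 3 ≤ 2 ^ (k + 1))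
  have hcard : (B.card : ℝ) ≤ 2 * (2 ^ (k + 1)) ^ (2 * s) * (2 ^ n * q) ^ M := by
    have h3 := card_misses_le T hd hs M ∅
    have h4 := card_fools_le (s := s) T hd T.vars M
    have h5 : (B.card : ℝ) ≤ (Finset.univ.filter (Misses T.eval M ∅)).card +
        (Finset.univ.filter (Fools T.eval d s T.vars M)).card := by
      exact_mod_cast Finset.card_union_le _ _
    have h6 : 0 ≤ (2 ^ n * q) ^ M := by positivity
    have h7 := mul_le_mul_of_nonneg_right b1 h6
    have h8 := mul_le_mul_of_nonneg_right b2 h6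
    linarith
  have hpow : q ^ M ≤ (1 / 2) ^ (2 * s * (k + 1) + l + 1) := by
    have := one_sub_inv_pow_le (2 ^ (d + 1)) (2 * s * (k + 1) + l + 1) (by positivity)
    rw [hM, hq]
    exact_mod_cast this
  -- In the exponent $2s(k+1)+l+1$ the first term cancels the number of cases, the $1$ cancels the
  -- factor two for the two kinds of failure, and $l$ remains.
  calc (B.card : ℝ) * (1 / 2) ^ (M * n)
      ≤ (2 * (2 ^ (k + 1)) ^ (2 * s) * (2 ^ n * q) ^ M) * (1 / 2) ^ (M * n) := by gcongr
    _ = 2 * (2 ^ (k + 1)) ^ (2 * s) * q ^ M := by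
        rw [mul_pow, mul_comm M n, pow_mul (1 / 2) n M, one_div, inv_pow, inv_pow]
        field_simp
    _ ≤ 2 * (2 ^ (k + 1)) ^ (2 * s) * (1 / 2) ^ (2 * s * (k + 1) + l + 1) := by gcongr
    _ = (1 / 2) ^ l := by
        rw [← pow_mul, pow_succ, pow_add, show (k + 1) * (2 * s) = 2 * s * (k + 1) by ring]
        generalize 2 * s * (k + 1) = a
        rw [one_div, inv_pow, inv_pow]
        field_simp

end DTLearn

namespace DTLearn

/-! ### The bounds -/

open MeasureTheory

variable {n : ℕ}

theorem internal_succ_le (r d : ℕ) : internal r (d + 1) ≤ (2 * r + 1) ^ d := by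
  induction d with
  | zero => simp [internal]
  | succ d ih =>
    have h1 : 1 ≤ (2 * r + 1) ^ d := Nat.one_le_pow _ _ (by omega)
    have h2 := Nat.mul_le_mul_left (2 * r) ih
    rw [pow_succ, internal]
    have : (2 * r + 1) ^ d * (2 * r + 1) = 2 * r * (2 * r + 1) ^ d + (2 * r + 1) ^ d := by ring
    omega

/-- Without variables the search has a single record. This case is separate because for $d = 0$ or
$s = 1$ the power of $s$ cannot absorb a factor $M$; the cost is charged to the term $mn$. -/
theorem searchTime_zero_le {d M : ℕ} (hd : d < M) : searchTime d M 0 ≤ 420 * M := by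
  have h := internal_succ_le 0 d
  have h1 : internal 0 (d + 1) * (200 + 200 * 0 + 200 * M + 60 * (0 * M)) ≤
      1 * (200 + 200 * 0 + 200 * M + 60 * (0 * M)) := Nat.mul_le_mul_right _ (by simpa using h)
  unfold searchTime
  omega

theorem searchTime_le {d M r s : ℕ} (hr : r < s) (hs : 2 ≤ s) (hd : d < M) :
    searchTime d M r ≤ 680 * ((2 * s) ^ d * (s * M)) := by
  have h1 : internal r (d + 1) ≤ (2 * s) ^ d :=
    (internal_succ_le r d).trans (Nat.pow_le_pow_left (by omega) d)
  have h2 : r * M ≤ s * M := Nat.mul_le_mul_right _ hr.le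
  have h3 : s * 1 ≤ s * M := Nat.mul_le_mul_left _ (by omega)
  have h4 : 1 * M ≤ s * M := Nat.mul_le_mul_right _ (by omega)
  have h5 : internal r (d + 1) * (200 + 200 * r + 200 * M + 60 * (r * M)) ≤
      (2 * s) ^ d * (660 * (s * M)) := Nat.mul_le_mul h1 (by omega)
  have h6 : d * (20 + 20 * r) ≤ (2 * s) ^ d * (20 * (s * M)) := by
    have h7 : 1 ≤ (2 * s) ^ d := Nat.one_le_pow _ _ (by omega)
    calc d * (20 + 20 * r) ≤ M * (20 * s) := Nat.mul_le_mul hd.le (by omega)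
      _ = 1 * (20 * (s * M)) := by ring
      _ ≤ _ := Nat.mul_le_mul_right _ h7
  have h8 : 680 * ((2 * s) ^ d * (s * M)) =
    (2 * s) ^ d * (660 * (s * M)) + (2 * s) ^ d * (20 * (s * M)) := by ring
  unfold searchTime
  omega

theorem le_logb_of_pow_le {k : ℕ} {x : ℝ} (h : (2 : ℝ) ^ k ≤ x) : (k : ℝ) ≤ Real.logb 2 x := by
  rw [Real.le_logb_iff_rpow_le (by norm_num) (lt_of_lt_of_le (by positivity) h), Real.rpow_natCast]
  exact h

theorem clog_le_logb {n : ℕ} (hn : 1 ≤ n) : (Nat.clog 2 n : ℝ) ≤ Real.logb 2 n + 1 := by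
  have hn' : (0 : ℝ) < n := by exact_mod_cast hn
  rcases hn.eq_or_lt with rfl | h
  · simp
  · have h1 := (Nat.pow_pred_clog_lt_self (b := 2) (by norm_num) h).le
    have h2 : (2 : ℝ) ^ (Nat.clog 2 n).pred ≤ n := by exact_mod_cast h1
    have h3 := le_logb_of_pow_le h2
    have h4 : Nat.clog 2 n ≤ (Nat.clog 2 n).pred + 1 := by
      rw [Nat.pred_eq_sub_one]
      omega
    have h5 : (Nat.clog 2 n : ℝ) ≤ (Nat.clog 2 n).pred + 1 := by exact_mod_cast h4
    linarith

theorem logb_le_self {s : ℕ} (hs : 1 ≤ s) : Real.logb 2 s ≤ s := by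
  have hs' : (0 : ℝ) < s := by exact_mod_cast hs
  rw [Real.logb_le_iff_le_rpow (by norm_num) hs', Real.rpow_natCast]
  exact_mod_cast (Nat.lt_two_pow_self (n := s)).le

theorem step_subset {T : DTree n} {x : Cube n} {R R' V : Finset (Fin n)}
    (h : Step T.eval R x R') (hR : R ⊆ V) (hV : T.vars ⊆ V) : R' ⊆ V := by
  rcases h with ⟨-, rfl⟩ | ⟨-, i, -, hi, rfl⟩
  · exact hR
  · exact Finset.insert_subset (hV (T.mem_vars_of_relevant hi)) hR

/-- Only relevant variables are collected, and they occur in every tree for the target. This makes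
the union bound over outputs independent of `n`. -/
theorem chain_subset {T : DTree n} {M : ℕ} {x : ℕ → Cube n} {Rs : ℕ → Finset (Fin n)}
    (h0 : Rs 0 = ∅) (hs : ∀ t < M, Step T.eval (Rs t) (x t) (Rs (t + 1))) : Rs M ⊆ T.vars := by
  have key : ∀ t ≤ M, Rs t ⊆ T.vars := by
    intro t
    induction t with
    | zero => simp [h0]
    | succ t ih => exact fun ht => step_subset (hs t (by omega)) (ih (by omega)) le_rfl
  exact key M le_rfl

/-- The samples suffice for a correct output. -/
theorem outputsTree_of_not_bad {d s M : ℕ} {T : DTree n} {x : ℕ → Cube n}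
    (hd : T.depth ≤ d) (hs : T.size ≤ s) {Rs : ℕ → Finset (Fin n)}
    (h0 : Rs 0 = ∅) (hstep : ∀ t < M, Step T.eval (Rs t) (x t) (Rs (t + 1))) {τ : State}
    (hτ : Solved d s M (Rs M) x (fun t => T.eval (x t)) τ.mem) (hreg : τ.reg 0 = sampleAddr n M)
    (hm : ¬ Misses T.eval M ∅ (fun t => x t)) (hf : ¬ Fools T.eval d s T.vars M (fun t => x t)) :
    OutputsTree d s T.eval τ := by
  have hcov : Covers T.eval (Rs M) := by
    by_contra h
    exact hm ⟨Rs, h0, fun k => hstep k k.2, h⟩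
  -- Since the found variables cover the target, the restricted target tree is a consistent
  -- competitor over them.
  obtain ⟨T', h1, h2, h3, h4, h5⟩ := hτ.exists_tree (T.restrict (Rs M))
    ((T.depth_restrict _).trans hd) ((T.size_restrict _).trans hs) (T.vars_restrict _)
    fun t _ => by rw [T.eval_restrict, hcov]
  refine ⟨T', h1, h2, by rwa [hreg], ?_⟩
  by_contra h
  exact hf ⟨T', h1, h2, h3.trans (chain_subset h0 hstep), h, fun k => h5 k k.2⟩

/-- The number of samples is small. -/
theorem samples_le {d s k l M : ℕ} {δ : ℝ} (hs : 1 ≤ s) (hδ : 0 < δ) (hδ' : δ ≤ 1 / 2)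
    (hk : 2 ^ k ≤ 2 * s) (hl : 2 ^ l ≤ 2 * ⌈1 / δ⌉₊)
    (hM : M = 2 ^ (d + 1) * (2 * s * (k + 1) + l + 1)) :
    (M : ℝ) ≤ 18 * (s * (2 ^ d * (Real.logb 2 s + Real.logb 2 (1 / δ)))) := by
  have hs' : (1 : ℝ) ≤ s := by exact_mod_cast hs
  have hls : 0 ≤ Real.logb 2 s := Real.logb_nonneg (by norm_num) hs'
  have h2δ : 2 ≤ 1 / δ := by
    rw [le_div_iff₀ hδ]
    linarith
  have hL : 1 ≤ Real.logb 2 (1 / δ) := by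
    have := le_logb_of_pow_le (k := 1) (x := 1 / δ) (by simpa using h2δ)
    simpa using this
  have hk' : (k : ℝ) ≤ Real.logb 2 s + 1 := by
    have h1 : (2 : ℝ) ^ k ≤ 2 * s := by exact_mod_cast hk
    have h2 := le_logb_of_pow_le h1
    rw [Real.logb_mul (by norm_num) (by linarith), Real.logb_self_eq_one (by norm_num)] at h2
    linarith
  have hl' : (l : ℝ) ≤ Real.logb 2 (1 / δ) + 2 := by
    have h1 : (2 : ℝ) ^ l ≤ 2 * ⌈1 / δ⌉₊ := by exact_mod_cast hl
    have h2 := Nat.ceil_lt_add_one (show 0 ≤ 1 / δ by positivity)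
    -- $\lceil 1/\delta\rceil < 1/\delta + 1 \le 2/\delta$.
    have h3 := le_logb_of_pow_le (h1.trans (show (2 : ℝ) * ⌈1 / δ⌉₊ ≤ 2 ^ 2 * (1 / δ) by linarith))
    rw [Real.logb_mul (by norm_num) (by positivity), Real.logb_pow,
      Real.logb_self_eq_one (by norm_num)] at h3
    push_cast at h3
    linarith
  set a := Real.logb 2 s
  set L := Real.logb 2 (1 / δ)
  -- As $s, L \ge 1$, the sum is at most $2s(a+2) + s(L+3) \le 2sa + 8sL$.
  have hE : (2 * s * (k + 1) + l + 1 : ℝ) ≤ 9 * (s * (a + L)) := by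
    have h1 : (2 * s * (k + 1) : ℝ) ≤ 2 * s * (a + 2) :=
      mul_le_mul_of_nonneg_left (by linarith) (by positivity)
    have h2 : L + 3 ≤ s * (L + 3) := le_mul_of_one_le_left (by linarith) hs'
    have h3 : (s : ℝ) * 1 ≤ s * L := by gcongr
    have h4 : (0 : ℝ) ≤ s * a := by positivity
    nlinarith
  rw [hM]
  push_cast
  calc (2 : ℝ) ^ (d + 1) * (2 * s * (k + 1) + l + 1) ≤ 2 ^ (d + 1) * (9 * (s * (a + L))) := by gcongr
    _ = _ := by ring

/-- The search takes little time. -/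
theorem searchTime_le_real {d s M r : ℕ} {δ : ℝ} (hr : r < s) (hs : 2 ≤ s) (hd : 1 ≤ d)
    (hdM : d < M) (hL : 1 ≤ Real.logb 2 (1 / δ))
    (hM : (M : ℝ) ≤ 18 * (s * (2 ^ d * (Real.logb 2 s + Real.logb 2 (1 / δ))))) :
    (searchTime d M r : ℝ) ≤ (s : ℝ) ^ (200 * d) * Real.logb 2 (1 / δ) := by
  have hs2 : (2 : ℝ) ≤ s := by exact_mod_cast hs
  have hs1 : (1 : ℝ) ≤ s := by linarith
  set L := Real.logb 2 (1 / δ)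
  have hlog := logb_le_self (s := s) (by omega)
  have h1 : (searchTime d M r : ℝ) ≤ 680 * ((2 * s) ^ d * (s * M)) := by
    exact_mod_cast searchTime_le hr hs hdM
  have h2 : Real.logb 2 s + L ≤ 2 * s * L := by
    have : (s : ℝ) * 1 ≤ s * L := by gcongr
    have : 1 * L ≤ s * L := by gcongr
    linarith
  have h3 : (M : ℝ) ≤ 36 * (s ^ 2 * 2 ^ d * L) := by
    calc (M : ℝ) ≤ 18 * (s * (2 ^ d * (2 * s * L))) := hM.trans (by gcongr)
      _ = _ := by ring
  have h4 : (2 : ℝ) ^ d ≤ s ^ d := pow_le_pow_left₀ (by norm_num) hs2 d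
  -- $24480 = 680 \cdot 36$. As $s \ge 2$, constants and powers of two become powers of $s$; the
  -- final exponent $3d + 18$ is at most $200d$ because $d \ge 1$.
  have h5 : (24480 : ℝ) ≤ s ^ 15 := by
    calc (24480 : ℝ) ≤ 2 ^ 15 := by norm_num
      _ ≤ s ^ 15 := pow_le_pow_left₀ (by norm_num) hs2 15
  calc (searchTime d M r : ℝ) ≤ 680 * ((2 * s) ^ d * (s * (36 * (s ^ 2 * 2 ^ d * L)))) :=
        h1.trans (by gcongr)
    _ = 24480 * (2 ^ d * s ^ d * s ^ 3 * 2 ^ d) * L := by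
        rw [mul_pow]
        ring
    _ ≤ s ^ 15 * (s ^ d * s ^ d * s ^ 3 * s ^ d) * L := by gcongr
    _ = s ^ (3 * d + 18) * L := by ring
    _ ≤ s ^ (200 * d) * L := by
        gcongr
        omega

end DTLearn

/-! ### The theorem -/

theorem mainTheorem7 :
    ∃ (p : DTLearn.Prog) (c : ℕ), ∀ (n d s : ℕ) (δ : ℝ), 1 ≤ n → 0 < δ → δ ≤ 1 / 2 →
      ∃ m : ℝ,
        m ≤ c * (s * (2 ^ d * Real.logb 2 (s / δ) + Real.logb 2 n)) ∧
        DTLearn.ExactlyProperlyLearns p n d s δ m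
          ((s : ℝ) ^ (c * d) * Real.logb 2 (1 / δ) + c * (m * n)) := by
  open DTLearn in
  -- The query bound `m` is taken to be its upper limit, with the generous constant 200 serving
  -- everywhere.
  refine ⟨learner, 200, fun n d s δ hn hδ hδ' => ⟨_, le_rfl, ?_⟩⟩
  rintro f ⟨T, hd, hs, rfl⟩
  have hV := T.card_vars_lt
  have hs1 : 1 ≤ s := by omega
  have hs' : (1 : ℝ) ≤ s := by exact_mod_cast hs1
  have hn' : (1 : ℝ) ≤ n := by exact_mod_cast hn
  set N := ⌈1 / δ⌉₊ with hN
  have hN0 : 0 < N := Nat.ceil_pos.2 (by positivity)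
  -- The set-up asks no queries and flips no coins; it is run with a dummy black box only to obtain
  -- `k` and `l`.
  obtain ⟨-, -, ⟨k, l, hk, hk', hl, hl', -⟩, -⟩ := run_setup (n := n) (f := fun _ => false)
    (ω := fun _ => false) (d := d) hs1 hN0
  obtain ⟨M, hM⟩ : ∃ M, M = 2 ^ (d + 1) * (2 * s * (k + 1) + l + 1) := ⟨_, rfl⟩
  have hrun := fun ω => run_learner (f := T.eval) (ω := ω) hn hs1 hN0 hk hk' hl hl' hM
  have h2δ : 2 ≤ 1 / δ := by
    rw [le_div_iff₀ hδ]
    linarith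
  have hL : 1 ≤ Real.logb 2 (1 / δ) := by
    have := le_logb_of_pow_le (k := 1) (x := 1 / δ) (by simpa using h2δ)
    simpa using this
  have hls : 0 ≤ Real.logb 2 s := Real.logb_nonneg (by norm_num) hs'
  have hln : 0 ≤ Real.logb 2 n := Real.logb_nonneg (by norm_num) hn'
  have hMle := samples_le hs1 hδ hδ' hk' hl' hM
  constructor
  · intro ω
    obtain ⟨τ, hexec, Rs, h0, hstep, -, -, hq, ht⟩ := hrun ω
    refine ⟨τ, hexec, ?_⟩
    have hR := chain_subset h0 hstep
    generalize hr : (Rs M).card = r at hq ht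
    have hrV : r ≤ T.vars.card := hr ▸ Finset.card_le_card hR
    have hdM : d < M := by
      have h1 : d + 1 < 2 ^ (d + 1) := Nat.lt_two_pow_self
      have h2 : 2 ^ (d + 1) * 1 ≤ 2 ^ (d + 1) * (2 * s * (k + 1) + l + 1) :=
        Nat.mul_le_mul_left _ (by omega)
      omega
    have hG : Real.logb 2 (s / δ) = Real.logb 2 s + Real.logb 2 (1 / δ) := by
      rw [div_eq_mul_one_div, Real.logb_mul (by linarith) (by positivity)]
    have htime : (searchTime d M r : ℝ) ≤
        (s : ℝ) ^ (200 * d) * Real.logb 2 (1 / δ) + 420 * M := by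
      have h0 : 0 ≤ (s : ℝ) ^ (200 * d) * Real.logb 2 (1 / δ) := by positivity
      rcases Nat.eq_zero_or_pos r with rfl | hr0
      · have : (searchTime d M 0 : ℝ) ≤ 420 * M := by exact_mod_cast searchTime_zero_le hdM
        linarith
      -- A found variable occurs in `T`, so `T` is not a leaf. Hence $d \ge 1$ and $s \ge 2$, as the
      -- absorption of constants requires.
      · have hd1 : 1 ≤ d := by
          by_contra h
          cases T with
          | leaf b => simp [DTree.vars] at hrV; omega
          | node i l r => simp [DTree.depth] at hd; omega
        have := searchTime_le_real (r := r) (by omega) (by omega) hd1 hdM hL hMle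
        have : (0 : ℝ) ≤ M := Nat.cast_nonneg M
        linarith
    rw [hG]
    set a := Real.logb 2 s
    set L := Real.logb 2 (1 / δ)
    set Y : ℝ := s * (2 ^ d * (a + L) + Real.logb 2 n) with hY
    have hpow : (1 : ℝ) ≤ 2 ^ d := one_le_pow₀ (by norm_num)
    have hG1 : 1 ≤ 2 ^ d * (a + L) := one_le_mul_of_one_le_of_one_le hpow (by linarith)
    have hMY : (M : ℝ) ≤ 18 * Y := by
      refine hMle.trans ?_
      rw [hY]
      gcongr
      linarith
    have hsY : (s : ℝ) ≤ Y := by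
      rw [hY]
      exact le_mul_of_one_le_right (by linarith) (by linarith)
    have hJ := clog_le_logb hn
    have hrs : (r : ℝ) ≤ s := by exact_mod_cast (by omega : r ≤ s)
    have hrJ : (r : ℝ) * Nat.clog 2 n ≤ Y := by
      rw [hY]
      have : (0 : ℝ) ≤ Nat.clog 2 n := Nat.cast_nonneg _
      gcongr
      linarith
    have hY0 : 0 ≤ Y := by linarith
    have hq' : (τ.queries : ℝ) ≤ 2 * M + r * Nat.clog 2 n := by exact_mod_cast hq
    have ht' : (τ.time : ℝ) ≤ 300 * (M * n) + r * ((Nat.clog 2 n + 2) * (80 * n)) +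
      searchTime d M r := by exact_mod_cast ht
    constructor
    · push_cast
      linarith
    · have h1 : (M : ℝ) * n ≤ 18 * Y * n := by gcongr
      have h2 : (M : ℝ) * 1 ≤ M * n := by gcongr
      have h3 : (r : ℝ) * ((Nat.clog 2 n + 2) * (80 * n)) ≤ 240 * (Y * n) := by
        calc (r : ℝ) * ((Nat.clog 2 n + 2) * (80 * n)) =
            80 * ((r * Nat.clog 2 n + 2 * r) * n) := by ring
          _ ≤ 80 * ((Y + 2 * Y) * n) := by gcongr; linarith
          _ = _ := by ring
      have h4 : 0 ≤ Y * n := by positivity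
      push_cast
      linarith
  · set S := {ω | ∃ σ : State, Exec T.eval ω learner (State.init n d s N) σ ∧
      OutputsTree d s T.eval σ} with hS
    have hbad := coins_bad_le (l := l) hn T hd hs hk hM
    set B := {ω | Misses T.eval M ∅ (fun t => drawn n ω t) ∨
      Fools T.eval d s T.vars M (fun t => drawn n ω t)} with hB
    -- Covering the whole space by `S` and `B` bounds the success probability from below by
    -- subadditivity, which holds without measurability of either set.
    have hcov : (Set.univ : Set (ℕ → Bool)) ⊆ S ∪ B := by
      intro ω _
      by_cases h : ω ∈ B
      · exact Or.inr h
      · left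
        obtain ⟨τ, hexec, Rs, h0, hstep, hsol, hreg, -, -⟩ := hrun ω
        have h' := not_or.1 h
        exact ⟨τ, hexec, outputsTree_of_not_bad hd hs h0 hstep hsol hreg h'.1 h'.2⟩
    have h1 : (1 : ℝ) ≤ coins.real S + coins.real B := by
      calc (1 : ℝ) = coins.real Set.univ := by simp
        _ ≤ coins.real (S ∪ B) := MeasureTheory.measureReal_mono hcov
        _ ≤ _ := MeasureTheory.measureReal_union_le _ _
    have h2 : (1 / 2 : ℝ) ^ l ≤ δ := by
      have h3 : 1 / δ ≤ 2 ^ l := by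
        refine (Nat.le_ceil _).trans ?_
        exact_mod_cast hl.le
      rw [one_div, inv_pow, inv_le_comm₀ (by positivity) hδ, ← one_div]
      exact h3
    linarith
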